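/- **Setting.** For $N\ge1$ spins $\sigma_i=\pm1$ let $H_N(\sigma)=-\frac1{\sqrt N}\sum_{i<j}J_{ij}\sigma_i\sigma_j$, and let $Z_{N,t}=\sum_\sigma e^{-\beta H_N(\sigma)+\sqrt{t/N}\sum_iJ_i\sigma_i}$, with all $J_{ij},J_i$ independent standard Gaussians and $Z_N=Z_{N,0}$. Put $\alpha_N(\beta)=\frac1N\mathbf E\ln Z_N$ and $\Psi_N(t,\beta)=\mathbf E\ln(Z_{N,t}/Z_N)$. Let $\langle\cdot\rangle_t$ be the average over independent replicas with the weights of $Z_{N,t}$ and the same disorder, followed by $\mathbf E$, and $\langle\cdot\rangle=\langle\cdot\rangle_{t=0}$. Let $q_{ab}=\frac1N\sum_i\sigma_i^a\sigma_i^b$. A graph $G$ is a monomial in the overlaps, up to renaming the replicas; it is filled if every replica appears an even number of times. For a graph $G$ with $s$ replicas put $$R_G=\sum_{a<b\le s}q_{ab}^2-s\sum_{a\le s}q_{a,s+1}^2+\tfrac{s(s+1)}2q_{s+1,s+2}^2 .$$ Let $A_N(t,\beta)=\ln2+\Psi_N(t,\beta)-\frac t4(1-\langle q_{12}^2\rangle)$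 (with $\langle\cdot\rangle$ at inverse temperature $\beta$). Its expansion in filled graphs is $\hat\alpha(x,\langle\cdot\rangle)=\sum_nx^n\hat\alpha_n$, $x=t$. It is obtained from $\Psi=\frac12\int_0^t(1-\langle q_{12}\rangle_{t'})dt'$ by repeated use of the streaming equation $\partial_t\langle G\rangle_t=\langle G(\sum_{a<b\le s}q_{ab}-s\sum_{a\le s} q_{a,s+1}+\frac{s(s+1)}2q_{s+1,s+2})\rangle_t$, where filled graphs are kept constant in $t$ and the other graphs vanish at $t=0$. Each $\hat\alpha_n$ is a finite linear combination of averages of filled graphs (constants being multiples of the empty graph, $\langle\emptyset\rangle=1$), and $\hat\alpha^{\le M}=\sum_{n\le M}x^n\hat\alpha_n$. **Proposition** ("thermodynamic" generator of the Aizenman–Contucci restrictions). 1. *Total and partial derivative.* For $N\ge 1$, $\beta>0$, $\frac1N\mathbf E\,\omega(H_N)=-\frac\beta2(1-\langle q_{12}^2\rangle)$ and $\frac{d\alpha_N}{d\beta^2}=\frac14(1-\langle q_{12}^2\rangle)$. Suppose that $\Psi_N(\beta^2,\beta)$ converges as $N\to\infty$, uniformly for $\beta$ in each compact subset of $[0,\infty)$.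 Then for every $\beta>0$ the limits $q(\beta)=\lim\langle q_{12}^2\rangle$ and $\alpha(\beta)=\lim\alpha_N(\beta)=\lim A_N(\beta^2,\beta)$ exist, and $$\frac{d\alpha}{d\beta^2}=\lim_N\partial_tA_N(t,\beta)\big|_{t=\beta^2}=\tfrac14(1-q(\beta)).$$ At finite $N$, $\frac{d}{d\beta^2}A_N(\beta^2,\beta)=\partial_tA_N|_{t=\beta^2}+\partial_{\beta^2}A_N|_{t=\beta^2}$, where the last term is the derivative through the state $\langle\cdot\rangle$ only. The integral of this last term over any interval $[\beta_1^2,\beta_2^2]$ of $\beta^2$, $0<\beta_1\le\beta_2$, tends to $0$ as $N\to\infty$. 2. *Expansion.* With $x=\beta^2$, through order $\beta^8$, $$\hat\alpha=\ln2+\tfrac{x}4[1+(1-x)\langle q_{12}^2\rangle]+\tfrac{x^3}3\langle q_{12}q_{23}q_{13}\rangle+\tfrac{x^4}6\langle q_{12}^2q_{23}^2\rangle-\tfrac{x^4}8\langle q_{12}^2q_{34}^2\rangle-\tfrac{3x^4}4\langle q_{12}q_{23}q_{34}q_{14}\rangle .$$ The coefficients of these five graphs in $\hat\alpha^{\le M}$,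 i.e. the $\partial\hat\alpha^{\le M}/\partial\langle G\rangle$, are the displayed ones for every $M\ge4$. There is a constant $K$ with $|A_N(t,\beta)-\hat\alpha^{\le4}(t,\langle\cdot\rangle)|\le K\left(t^5+t^4|\langle q_{12}^2R_{q_{12}^2}\rangle|\right)$ for all $N\ge1$, all $\beta$ and all $t\ge0$. 3. *Generator.* For all $M\ge 0$, $N\ge1$, $\beta>0$, $\partial\langle G\rangle/\partial\beta^2=\frac N2\langle GR_G\rangle$ for every graph $G$, and $$\frac{d}{d\beta^2}\hat\alpha^{\le M}(\beta^2,\langle\cdot\rangle)=\partial_x\hat\alpha^{\le M}\big|_{x=\beta^2}+\sum_G\frac{\partial\hat\alpha^{\le M}}{\partial\langle G\rangle}\frac{\partial\langle G\rangle}{\partial\beta^2},$$ where the sum runs over the filled graphs contained in $\hat\alpha^{\le M}$. So if the total derivative equals the partial one, then $\sum_G\frac{\partial\hat\alpha^{\le M}}{\partial\langle G\rangle}\frac{\partial\langle G\rangle}{\partial\beta^2}=0$. This sum equals $\frac N2\sum_{n\le M}\beta^{2n}T_n$, where $T_n=\sum_G[x^n]\frac{\partial\hat\alpha}{\partial\langle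 G\rangle}\,\langle GR_G\rangle$. 4. *Order by order.* For $\beta>0$, $L\ge 0$ and any sequence of sizes tending to infinity, the total and the partial derivative of $\hat\alpha^{\le M}$ agree up to $o(N)$ for all $M\le L$ if and only if $T_n\to0$ for all $n\le L$. Here $T_0=0$, and $T_1=-T_2=\frac14\langle q_{12}^4-4q_{12}^2q_{23}^2+3q_{12}^2q_{34}^2\rangle$, $T_3=\langle q_{12}^3q_{23}q_{13}-3q_{12}q_{23}q_{13}q_{14}^2+2q_{12}q_{23}q_{13}q_{45}^2\rangle$ are the first linear Ghirlanda–Guerra/Aizenman–Contucci polynomials, while order $\beta^8$ gives only the sum $$T_4=\tfrac16\langle q_{12}^2q_{23}^2R\rangle-\tfrac18\langle q_{12}^2q_{34}^2R\rangle-\tfrac34\langle q_{12}q_{23}q_{34}q_{14}R\rangle,$$ with $R=R_G$ for the respective graph $G$. These identities for $T_0,\dots,T_4$ hold for every replica-symmetric linear functional in place of $\langle\cdot\rangle$. 5. *Validity in $\beta$-average.* For $0\le\beta_1\le\beta_2$, the integrals over $\beta\in[\beta_1,\beta_2]$ of the following quantities tend to $0$ as $N\to\infty$: $\frac1N|\text{total}-\text{partial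 derivative of }\hat\alpha^{\le M}|$ for every $M$; the absolute values of the two polynomials $4T_1$ and $T_3$ and of the sum $T_4$; and $|\langle GR_G\rangle|$ for every filled graph $G$. 6. *Weaker than the symmetric constraints.* For every replica-symmetric linear functional $\langle\cdot\rangle$ on graphs, the symmetric constraints ($\langle GR_G\rangle=0$ for all filled $G$) imply $T_n=0$ for all $n$. The converse fails. There is such a functional, with value $1$ on the empty graph, bounded by $1$ in absolute value on all graphs and zero on non-filled graphs, such that $T_n=0$ for all $n$, but $\langle GR_G\rangle\ne0$ for each of $G=q_{12}^2q_{23}^2,\ q_{12}^2q_{34}^2,\ q_{12}q_{23}q_{34}q_{14}$. -/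

import Mathlib

open MeasureTheory ProbabilityTheory Filter Topology

/-! ### The Sherrington-Kirkpatrick model with cavity field -/

/-- Configurations of `N` Ising spins, each equal to `1` or `-1`. -/
abbrev SpinConfig (N : ℕ) : Type := Fin N → ℤˣ

/-- The value of a spin as a real number. -/
def spin {N : ℕ} (σ : SpinConfig N) (i : Fin N) : ℝ := ((σ i : ℤ) : ℝ)

/-- The disorder: the couplings `J (i, j)`, of which only those with `i < j` are used, and the
cavity fields `J i`. -/
abbrev Disorder (N : ℕ) : Type := (Fin N × Fin N → ℝ) × (Fin N → ℝ)

/-- All the couplings and the cavity fields are independent standard Gaussian variables. -/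
noncomputable def disorderLaw (N : ℕ) : Measure (Disorder N) :=
  (Measure.pi fun _ => gaussianReal 0 1).prod (Measure.pi fun _ => gaussianReal 0 1)

/-- The Hamiltonian `-(1/√N) ∑_{i<j} J_ij σ_i σ_j` at zero external field. -/
noncomputable def hamiltonian (N : ℕ) (d : Disorder N) (σ : SpinConfig N) : ℝ :=
  -(1 / Real.sqrt N) * ∑ i : Fin N, ∑ j : Fin N,
    if i < j then d.1 (i, j) * spin σ i * spin σ j else 0

/-- The Boltzmann weight `exp (-β H_N(σ) + √(t/N) ∑ J_i σ_i)`. -/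
noncomputable def boltzmannWeight (N : ℕ) (β t : ℝ) (d : Disorder N) (σ : SpinConfig N) : ℝ :=
  Real.exp (-β * hamiltonian N d σ + Real.sqrt (t / N) * ∑ i : Fin N, d.2 i * spin σ i)

/-- The extended partition function `Z_{N,t}`; `t = 0` gives `Z_N`. -/
noncomputable def partitionFn (N : ℕ) (β t : ℝ) (d : Disorder N) : ℝ :=
  ∑ σ : SpinConfig N, boltzmannWeight N β t d σ

/-- The probability of `σ` in the generalized Boltzmann state `ω_t`. -/
noncomputable def gibbs (N : ℕ) (β t : ℝ) (d : Disorder N) (σ : SpinConfig N) : ℝ :=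
  boltzmannWeight N β t d σ / partitionFn N β t d

/-- `α_N(β) = N⁻¹ E ln Z_N`. -/
noncomputable def alphaSK (N : ℕ) (β : ℝ) : ℝ :=
  (1 / N) * ∫ d, Real.log (partitionFn N β 0 d) ∂(disorderLaw N)

/-- The cavity function `Ψ_N(t) = E ln (Z_{N,t} / Z_N)`. -/
noncomputable def cavityFn (N : ℕ) (t β : ℝ) : ℝ :=
  ∫ d, Real.log (partitionFn N β t d / partitionFn N β 0 d) ∂(disorderLaw N)

/-- The internal energy per spin, `N⁻¹ E ω(H_N)`. -/
noncomputable def internalEnergy (N : ℕ) (β : ℝ) : ℝ :=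
  (1 / N) * ∫ d, ∑ σ : SpinConfig N, gibbs N β 0 d σ * hamiltonian N d σ ∂(disorderLaw N)

/-- The overlap `N⁻¹ ∑ σ_i σ'_i` of two replicas. -/
noncomputable def overlap {N : ℕ} (σ τ : SpinConfig N) : ℝ :=
  (1 / N) * ∑ i : Fin N, spin σ i * spin τ i

theorem overlap_comm {N : ℕ} (σ τ : SpinConfig N) : overlap σ τ = overlap τ σ := by
  simp [overlap, mul_comm]

/-! ### Overlap graphs -/

/-- A graph whose vertices are labels of replicas and whose lines (with multiplicity) are
overlaps: the multiset of the factors `q_ab` of a monomial in the overlaps. -/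
abbrev OverlapGraph : Type := Multiset (Sym2 ℕ)

namespace OverlapGraph

/-- The replicas that appear in the graph. -/
def verts (G : OverlapGraph) : Finset ℕ := (G.bind Sym2.toMultiset).toFinset

/-- A graph is filled if every replica appears an even number of times. -/
def Filled (G : OverlapGraph) : Prop := ∀ a, Even ((G.bind Sym2.toMultiset).count a)

/-- The graph with its replicas renamed by `π`. -/
def relabel (π : Equiv.Perm ℕ) (G : OverlapGraph) : OverlapGraph := G.map (Sym2.map π)

/-- The monomial in the overlaps, evaluated on replicas `τ 0, τ 1, …`. -/
noncomputable def value {N : ℕ} (τ : ℕ → SpinConfig N) (G : OverlapGraph) : ℝ :=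
  (G.map (Sym2.lift ⟨fun a b => overlap (τ a) (τ b), fun _ _ => overlap_comm _ _⟩)).prod

end OverlapGraph

/-- Replicas indexed by a finite set of labels, continued arbitrarily to all labels. -/
def extendReplicas {N : ℕ} (V : Finset ℕ) (τ : V → SpinConfig N) : ℕ → SpinConfig N :=
  fun a => if h : a ∈ V then τ ⟨a, h⟩ else 1

/-- `⟨G⟩_t = E Ω_t(G)`: the average of the monomial `G` over independent replicas with the same
disorder, and then over the disorder; `t = 0` gives `⟨G⟩`. -/
noncomputable def graphAvg (N : ℕ) (β t : ℝ) (G : OverlapGraph) : ℝ :=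
  ∫ d, ∑ τ : G.verts → SpinConfig N,
    (∏ a, gibbs N β t d (τ a)) * G.value (extendReplicas G.verts τ) ∂(disorderLaw N)

namespace OverlapGraph

theorem mem_verts {G : OverlapGraph} {a : ℕ} : a ∈ G.verts ↔ ∃ e ∈ G, a ∈ e := by
  simp [verts]

theorem mem_verts_relabel {G : OverlapGraph} (π : Equiv.Perm ℕ) (a : ℕ) :
    π a ∈ (G.relabel π).verts ↔ a ∈ G.verts := by
  simp only [mem_verts, relabel, Multiset.mem_map]
  constructor
  · rintro ⟨_, ⟨e, he, rfl⟩, h⟩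
    obtain ⟨b, hb, hab⟩ := Sym2.mem_map.1 h
    exact ⟨e, he, by rwa [π.injective hab] at hb⟩
  · rintro ⟨e, he, h⟩
    exact ⟨_, ⟨e, he, rfl⟩, Sym2.mem_map.2 ⟨a, h, rfl⟩⟩

/-- Two graphs are identified if they differ by the names of the replicas. -/
instance setoid : Setoid OverlapGraph where
  r G G' := ∃ π : Equiv.Perm ℕ, G.relabel π = G'
  iseqv :=
    { refl := fun G => ⟨1, by simp [relabel]⟩
      symm := by
        rintro G _ ⟨π, rfl⟩
        exact ⟨π⁻¹, by simp [relabel, Multiset.map_map, Sym2.map_map]⟩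
      trans := by
        rintro G _ _ ⟨π, rfl⟩ ⟨ρ, rfl⟩
        exact ⟨ρ * π, by
          simp [relabel, Multiset.map_map, Sym2.map_map, Function.comp_def]⟩ }

end OverlapGraph

/-- The averages are invariant under permutations of the replicas. -/
theorem graphAvg_relabel (N : ℕ) (β t : ℝ) (π : Equiv.Perm ℕ) (G : OverlapGraph) :
    graphAvg N β t (G.relabel π) = graphAvg N β t G := by
  unfold graphAvg
  congr 1
  funext d
  let e : G.verts ≃ (G.relabel π).verts :=
    π.subtypeEquiv fun a => (OverlapGraph.mem_verts_relabel π a).symm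
  refine (Fintype.sum_equiv (e.arrowCongr (Equiv.refl (SpinConfig N))) _ _ fun τ => ?_).symm
  congr 1
  · refine Fintype.prod_equiv e _ _ fun a => ?_
    simp [Equiv.arrowCongr]
  · have key : ∀ c ∈ G.verts, extendReplicas (G.relabel π).verts
        ((e.arrowCongr (Equiv.refl (SpinConfig N))) τ) (π c) = extendReplicas G.verts τ c := by
      intro c h1
      have h2 : π c ∈ (G.relabel π).verts := (OverlapGraph.mem_verts_relabel π c).2 h1
      have h3 : e.symm ⟨π c, h2⟩ = ⟨c, h1⟩ := by
        rw [Equiv.symm_apply_eq]; rfl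
      simp [extendReplicas, h1, h2, Equiv.arrowCongr, h3]
    generalize extendReplicas (G.relabel π).verts
        ((e.arrowCongr (Equiv.refl (SpinConfig N))) τ) = τ' at key ⊢
    unfold OverlapGraph.value
    rw [show G.relabel π = G.map (Sym2.map π) from rfl, Multiset.map_map]
    congr 1
    refine Multiset.map_congr rfl fun x hx => ?_
    induction x using Sym2.ind with
    | _ a b =>
      have ha := key a (OverlapGraph.mem_verts.2 ⟨_, hx, by simp⟩)
      have hb := key b (OverlapGraph.mem_verts.2 ⟨_, hx, by simp⟩)
      simp [ha, hb]

/-- Graphs with unnamed replicas. -/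
abbrev GraphClass : Type := Quotient OverlapGraph.setoid

/-- `⟨G⟩` at inverse temperature `β`, as a function of the graph with unnamed replicas. -/
noncomputable def classAvg (N : ℕ) (β : ℝ) (C : GraphClass) : ℝ :=
  Quotient.lift (graphAvg N β 0) (by
    rintro G _ ⟨π, rfl⟩; exact (graphAvg_relabel N β 0 π G).symm) C

/-! ### Streaming and the expansion of the free energy in filled graphs -/

/-- `∑_{a<b} f(q_ab) - s ∑_a f(q_{a,u}) + (s(s+1)/2) f(q_{u,v})`, where `a, b` run over the set
`V` of `s` replicas and `u`, `v` are two replicas that are not in `V`. -/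
noncomputable def streamSum {M : Type*} [AddCommGroup M] [Module ℝ M] (V : Finset ℕ)
    (f : Sym2 ℕ → M) : M :=
  (∑ a ∈ V, ∑ b ∈ V with a < b, f s(a, b))
    - (V.card : ℝ) • (∑ a ∈ V, f s(a, V.sup id + 1))
    + ((V.card : ℝ) * (V.card + 1) / 2) • f s(V.sup id + 1, V.sup id + 2)

open Classical in
/-- The coefficient of `t ^ n` in the expansion of `⟨G⟩_t` in filled graphs, obtained from the
streaming equation
`∂_t ⟨G⟩_t = ⟨G (∑_{a<b} q_ab - s ∑_a q_{a,s+1} + (s(s+1)/2) q_{s+1,s+2})⟩_t`: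
a filled graph does not depend on `t`, any other graph vanishes at `t = 0` and is the integral
of its streaming. -/
noncomputable def streamCoeff : ℕ → OverlapGraph → (GraphClass →₀ ℝ)
  | 0, G => if G.Filled then Finsupp.single ⟦G⟧ 1 else 0
  | n + 1, G => if G.Filled then 0 else
      (1 / ((n : ℝ) + 1)) • streamSum G.verts fun e => streamCoeff n (e ::ₘ G)

/-- The one-line graph `q_12`. -/
def graphQ : OverlapGraph := {s(1, 2)}
/-- `q_12²`. -/
def graphQ2 : OverlapGraph := {s(1, 2), s(1, 2)}
/-- `q_12 q_23 q_13`. -/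
def graphTri : OverlapGraph := {s(1, 2), s(2, 3), s(1, 3)}
/-- `q_12² q_23²`. -/
def graphA : OverlapGraph := {s(1, 2), s(1, 2), s(2, 3), s(2, 3)}
/-- `q_12² q_34²`. -/
def graphB : OverlapGraph := {s(1, 2), s(1, 2), s(3, 4), s(3, 4)}
/-- `q_12 q_23 q_34 q_14`. -/
def graphC : OverlapGraph := {s(1, 2), s(2, 3), s(3, 4), s(1, 4)}

/-- The coefficient of `t ^ n` in `Ψ(t) = (1/2) ∫₀ᵗ (1 - ⟨q_12⟩_{t'}) dt'`; the constant `1` is the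
average of the empty graph. -/
noncomputable def psiCoeff : ℕ → (GraphClass →₀ ℝ)
  | 0 => 0
  | n + 1 => (1 / (2 * ((n : ℝ) + 1))) •
      ((if n = 0 then Finsupp.single ⟦0⟧ 1 else 0) - streamCoeff n graphQ)

/-- The coefficient of `t ^ n`, a linear combination of graphs, in
`α = ln 2 + Ψ(t) - (t/4) (1 - ⟨q_12²⟩)`. -/
noncomputable def alphaCoeff (n : ℕ) : GraphClass →₀ ℝ :=
  (if n = 0 then Finsupp.single ⟦0⟧ (Real.log 2) else 0) + psiCoeff n
    - (if n = 1 then (1 / 4 : ℝ) • (Finsupp.single ⟦0⟧ 1 - Finsupp.single ⟦graphQ2⟧ 1) else 0)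

/-- The expansion of `α` through order `M` in the explicit variable `x = β²`, as a function of `x`
and of the values `m` of the averages of the graphs. -/
noncomputable def alphaExpansion (M : ℕ) (x : ℝ) (m : GraphClass → ℝ) : ℝ :=
  ∑ n ∈ Finset.range (M + 1), x ^ n * (alphaCoeff n).sum fun C c => c * m C

/-- The graphs that are contained in the expansion of `α` through order `M`. -/
noncomputable def graphsOfAlpha (M : ℕ) : Finset GraphClass := by
  classical exact (Finset.range (M + 1)).biUnion fun n => (alphaCoeff n).support

open Classical in
/-- `∂α/∂⟨C⟩`. -/
noncomputable def derivGraph (M : ℕ) (C : GraphClass) (x : ℝ) (m : GraphClass → ℝ) : ℝ :=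
  deriv (fun z => alphaExpansion M x (Function.update m C z)) (m C)

/-- `∂⟨C⟩/∂β²`. -/
noncomputable def derivAvg (N : ℕ) (β : ℝ) (C : GraphClass) : ℝ :=
  deriv (fun y => classAvg N (Real.sqrt y) C) (β ^ 2)

/-- The total derivative of `α(β², ⟨·⟩_β)` with respect to `β²`. -/
noncomputable def totalDeriv (M N : ℕ) (β : ℝ) : ℝ :=
  deriv (fun y => alphaExpansion M y (classAvg N (Real.sqrt y))) (β ^ 2)

/-- The derivative of `α(x, ⟨·⟩_β)` with respect to the explicit `x` at `x = β²`. -/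
noncomputable def partialDeriv (M N : ℕ) (β : ℝ) : ℝ :=
  deriv (fun x => alphaExpansion M x (classAvg N β)) (β ^ 2)

/-- `ln 2 + Ψ_N(t) - (t/4) (1 - ⟨q_12²⟩)`, the quantity that is expanded above, for the SK model
itself: `t` is explicit and `β` enters through the Gibbs state only. -/
noncomputable def alphaRedundant (N : ℕ) (t β : ℝ) : ℝ :=
  Real.log 2 + cavityFn N t β - t / 4 * (1 - graphAvg N β 0 graphQ2)

/-! ### The constraints -/

/-- For a state `m` on graphs, `m(G (∑_{a<b} q_ab² - s ∑_a q_{a,s+1}² + (s(s+1)/2) q_{s+1,s+2}²))`,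
where `s` is the number of replicas in `G`. -/
noncomputable def bracket (m : OverlapGraph → ℝ) (G : OverlapGraph) : ℝ :=
  streamSum G.verts fun e => m (e ::ₘ e ::ₘ G)

/-- The coefficient of `(β²) ^ n` in the generator
`⟨[∑_G (∂α/∂G) G] [∑ q_ab² - s ∑ q_{a,s+1}² + (s(s+1)/2) q_{s+1,s+2}²]⟩`. -/
noncomputable def thermoConstraint (m : OverlapGraph → ℝ) (n : ℕ) : ℝ :=
  (alphaCoeff n).sum fun C c => c * bracket m C.out

/-- `m` does not depend on the names of the replicas. -/
def ReplicaSymmetric (m : OverlapGraph → ℝ) : Prop :=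
  ∀ (π : Equiv.Perm ℕ) (G : OverlapGraph), m (G.relabel π) = m G

/-- `⟨q_12⁴ - 4 q_12² q_23² + 3 q_12² q_34²⟩`. -/
def firstAC (m : OverlapGraph → ℝ) : ℝ :=
  m {s(1, 2), s(1, 2), s(1, 2), s(1, 2)} - 4 * m {s(1, 2), s(1, 2), s(2, 3), s(2, 3)}
    + 3 * m {s(1, 2), s(1, 2), s(3, 4), s(3, 4)}

/-- `⟨q_12³ q_23 q_13 - 3 q_12 q_23 q_13 q_14² + 2 q_12 q_23 q_13 q_45²⟩`. -/
def secondAC (m : OverlapGraph → ℝ) : ℝ :=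
  m {s(1, 2), s(1, 2), s(1, 2), s(2, 3), s(1, 3)}
    - 3 * m {s(1, 2), s(2, 3), s(1, 3), s(1, 4), s(1, 4)}
    + 2 * m {s(1, 2), s(2, 3), s(1, 3), s(4, 5), s(4, 5)}

/-- `⟨[q_12² q_23² / 6 - q_12² q_34² / 8 - 3 q_12 q_23 q_34 q_14 / 4] [∑ q_ab² - …]⟩`. -/
noncomputable def fourthOrderSum (m : OverlapGraph → ℝ) : ℝ :=
  1 / 6 * bracket m graphA - 1 / 8 * bracket m graphB - 3 / 4 * bracket m graphC

/-! All the disorder is one standard Gaussian vector `g`, and the model is a Gibbs measure with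
weights `exp (∑ s_k(σ) c_k g_k)`: the features `s_k` are spins and products of two spins, and the
scales `c_k` carry `t` and `β`. Integration by parts gives `∂E F(c g)/∂c_k = c_k E (∂_k² F)(c g)`
(`gaussAvg_hasFDerivAt_second`). Since `s_k² = 1`, the second derivative of a replica average is
twice a streaming sum of products of features (`hasGrad_grad_repAvg`). Summed over the fields these
products are overlaps, summed over the pairs they are squared overlaps up to constants, and
constants disappear because the coefficients of a streaming sum add up to zero. This yields the
streaming equation and `∂⟨G⟩/∂β² = (N/2)⟨G R_G⟩`. The same calculus for `log Z` yields the
derivatives of `α_N` and `Ψ_N`.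

The explicit coefficients are a parity count: a line changes the parity of two replicas only, so few
graphs can become filled. The remainder follows from the mean value theorem, applied once per order;
the only loss at order `t⁴` comes from freezing `⟨q_12²⟩_t`, whose second order is proportional to
the first Aizenman-Contucci polynomial (`remainder_graphQ2`).

The product rule splits the total derivative of the expansion into the explicit part and `(N/2) ∑
β^(2n) T_n`; subtracting consecutive truncations isolates each `T_n`. For the `β`-average, `∂⟨G⟩/∂β`
is also a covariance with the energy. The energy variance, averaged over the disorder, is the
derivative of the mean energy, so its integral over `β` is of order `N`. Hence `β N |⟨G R_G⟩|`
integrates to order `√N` and `⟨G R_G⟩` to order `1/√N` away from `β = 0`.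

For the limit, gauging `N + 1` spins by the last one turns its couplings into fields of the same
strength. At fixed coupling variance this is exact, so `α_N` is `log 2` plus a Riemann sum of cavity
functions (`alphaSK_eq_sum`), and `α = log 2 + y⁻¹ ∫₀^y Ψ` in the variable `y = β²`. Convexity in
`β` makes the derivatives converge. The gauge also identifies the limits of `⟨q_12⟩_t` at `t = β²`
and of `⟨q_12²⟩`, which gives the partial derivative; the integrated contribution of the state is
what remains, namely zero.

The converse fails already for a functional that, apart from the empty graph, lives on filled graphs
with six lines and depends on the number of replicas only. Its brackets can be nonzero only for
graphs with four lines, and one free value makes the sum at order `β⁸` cancel. -/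

/-! ### Standard Gaussian vectors -/

section Gauss

variable {ι : Type*} [Fintype ι]

/-- The law of a vector of independent standard Gaussian variables. -/
noncomputable def stdGauss (ι : Type*) [Fintype ι] : Measure (ι → ℝ) :=
  Measure.pi fun _ => gaussianReal 0 1

instance : IsProbabilityMeasure (stdGauss ι) := by unfold stdGauss; infer_instance

/-- Selecting distinct coordinates of a standard Gaussian vector gives a standard Gaussian
vector. -/
theorem measurePreserving_comp_injective {κ : Type*} [Fintype κ] (j : κ → ι)
    (hj : Function.Injective j) :
    MeasurePreserving (fun g : ι → ℝ => fun k => g (j k)) (stdGauss ι) (stdGauss κ) := by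
  classical
  have hm : Measurable (fun g : ι → ℝ => fun k => g (j k)) := by fun_prop
  refine ⟨hm, ?_⟩
  unfold stdGauss
  refine (Measure.pi_eq fun s hs => ?_).symm
  rw [Measure.map_apply hm (MeasurableSet.univ_pi hs)]
  -- The preimage of a box is a box. Its side at `i` is `s k` if `i = j k`, for the only such `k`,
  -- and the whole line if `i` is not in the range of `j`.
  have h1 : (fun g : ι → ℝ => fun k => g (j k)) ⁻¹' (Set.pi Set.univ s)
      = Set.pi Set.univ (fun i : ι => ⋂ k ∈ {k | j k = i}, s k) := by
    ext g
    simp only [Set.mem_preimage, Set.mem_univ_pi, Set.mem_iInter, Set.mem_ofPred_eq]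
    exact ⟨fun h i k hk => hk ▸ h k, fun h k => h (j k) k rfl⟩
  rw [h1, Measure.pi_pi]
  have h2 : ∀ k, (⋂ k' ∈ {k' | j k' = j k}, s k') = s k := by
    intro k
    ext x
    simp only [Set.mem_iInter, Set.mem_ofPred_eq]
    exact ⟨fun h => h k rfl, fun h k' hk => hj hk ▸ h⟩
  rw [← Finset.prod_subset (Finset.subset_univ (Finset.univ.image j)),
    Finset.prod_image (fun a _ b _ h => hj h)]
  · exact Finset.prod_congr rfl fun k _ => by rw [h2]
  · intro i _ hi
    have : (⋂ k ∈ {k | j k = i}, s k) = Set.univ := by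
      ext x
      simp only [Set.mem_iInter, Set.mem_ofPred_eq, Set.mem_univ, iff_true]
      intro k hk
      exact absurd (Finset.mem_image.2 ⟨k, Finset.mem_univ _, hk⟩) hi
    rw [this, measure_univ]

/-- Resampling one coordinate preserves the law of a standard Gaussian vector. -/
theorem measurePreserving_update [DecidableEq ι] (k : ι) :
    MeasurePreserving (fun p : (ι → ℝ) × ℝ => Function.update p.1 k p.2)
      ((stdGauss ι).prod (gaussianReal 0 1)) (stdGauss ι) := by
  have hm : Measurable (fun p : (ι → ℝ) × ℝ => Function.update p.1 k p.2) := by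
    refine measurable_pi_lambda _ fun i => ?_
    by_cases h : i = k
    · subst h; simpa using measurable_snd
    · simp only [Function.update_of_ne h]; fun_prop
  refine ⟨hm, ?_⟩
  conv_rhs => unfold stdGauss
  refine (Measure.pi_eq fun s hs => ?_).symm
  rw [Measure.map_apply hm (MeasurableSet.univ_pi hs)]
  have h1 : (fun p : (ι → ℝ) × ℝ => Function.update p.1 k p.2) ⁻¹' (Set.pi Set.univ s)
      = (Set.pi Set.univ (Function.update s k Set.univ)) ×ˢ (s k) := by
    ext ⟨g, z⟩
    simp only [Set.mem_preimage, Set.mem_univ_pi, Set.mem_prod]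
    constructor
    · intro h
      refine ⟨fun i => ?_, by simpa using h k⟩
      by_cases hi : i = k
      · subst hi; simp
      · simpa [Function.update_of_ne hi] using h i
    · rintro ⟨h, hz⟩ i
      by_cases hi : i = k
      · subst hi; simpa using hz
      · simpa [Function.update_of_ne hi] using h i
  rw [h1, Measure.prod_prod]
  unfold stdGauss
  rw [Measure.pi_pi, ← Finset.mul_prod_erase _ _ (Finset.mem_univ k),
    ← Finset.mul_prod_erase (a := k) _ (fun i => (gaussianReal 0 1) (s i)) (Finset.mem_univ k)]
  simp only [Function.update_self, measure_univ, one_mul]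
  rw [mul_comm]
  congr 1
  refine Finset.prod_congr rfl fun i hi => ?_
  rw [Function.update_of_ne (Finset.ne_of_mem_erase hi)]

theorem integrable_abs_pow_stdGauss (k : ι) (n : ℕ) :
    Integrable (fun g : ι → ℝ => |g k| ^ n) (stdGauss ι) := by
  have h : MemLp (id : ℝ → ℝ) n (gaussianReal 0 1) := memLp_id_gaussianReal n
  have h1 : Integrable (fun x : ℝ => |x| ^ n) (gaussianReal 0 1) := by
    simpa using h.integrable_norm_pow'
  exact (measurePreserving_eval (fun _ : ι => gaussianReal 0 1) k).integrable_comp_of_integrable h1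

theorem integrable_abs_stdGauss (k : ι) : Integrable (fun g : ι → ℝ => |g k|) (stdGauss ι) := by
  simpa using integrable_abs_pow_stdGauss k 1

theorem integrable_sum_abs_stdGauss :
    Integrable (fun g : ι → ℝ => ∑ k, |g k|) (stdGauss ι) :=
  integrable_finsetSum _ fun k _ => integrable_abs_stdGauss k

theorem integrable_sum_abs_sq_stdGauss :
    Integrable (fun g : ι → ℝ => (∑ k, |g k|) ^ 2) (stdGauss ι) := by
  have h : Integrable (fun g : ι → ℝ => (Fintype.card ι : ℝ) * ∑ k, |g k| ^ 2) (stdGauss ι) :=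
    (integrable_finsetSum _ fun k _ => integrable_abs_pow_stdGauss k 2).const_mul _
  refine h.mono' (Continuous.aestronglyMeasurable (by fun_prop)) (ae_of_all _ fun g => ?_)
  rw [Real.norm_of_nonneg (by positivity)]
  simpa using sq_sum_le_card_mul_sum_sq (s := Finset.univ) (f := fun k => |g k|)

/-- A continuous function of a Gaussian vector with at most quadratic growth is integrable. -/
theorem integrable_stdGauss_of_le {F : (ι → ℝ) → ℝ} (hF : Continuous F) {A B C : ℝ}
    (h : ∀ g, |F g| ≤ A + B * ∑ k, |g k| + C * (∑ k, |g k|) ^ 2) :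
    Integrable F (stdGauss ι) := by
  refine Integrable.mono' (((integrable_const A).add
    (integrable_sum_abs_stdGauss.const_mul B)).add (integrable_sum_abs_sq_stdGauss.const_mul C))
    hF.aestronglyMeasurable (ae_of_all _ fun g => ?_)
  simpa using h g

theorem integrable_stdGauss_of_bdd {F : (ι → ℝ) → ℝ} (hF : Continuous F) {A : ℝ}
    (h : ∀ g, |F g| ≤ A) : Integrable F (stdGauss ι) :=
  integrable_stdGauss_of_le (B := 0) (C := 0) hF (by simpa using h)

/-- `D` is the family of partial derivatives of `F`. -/
def HasGrad (F : (ι → ℝ) → ℝ) (D : ι → (ι → ℝ) → ℝ) : Prop :=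
  ∀ x, HasFDerivAt F (∑ k, D k x • (ContinuousLinearMap.proj k : (ι → ℝ) →L[ℝ] ℝ)) x

theorem HasGrad.continuous {F : (ι → ℝ) → ℝ} {D : ι → (ι → ℝ) → ℝ} (h : HasGrad F D) :
    Continuous F :=
  continuous_iff_continuousAt.2 fun x => (h x).continuousAt

/-- Mean value inequality on the segment from `0` to `x`. The resulting linear growth makes
functions with bounded gradient, such as `log Z`, integrable. -/
theorem HasGrad.comp_mul_abs_le {F : (ι → ℝ) → ℝ} {D : ι → (ι → ℝ) → ℝ} (h : HasGrad F D)
    {C : ℝ} (hC : ∀ k x, |D k x| ≤ C) (x : ι → ℝ) : |F x| ≤ |F 0| + C * ∑ k, |x k| := by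
  have h1 : ∀ r ∈ Set.Icc (0 : ℝ) 1, HasDerivWithinAt (fun r : ℝ => F (r • x))
      (∑ k, D k (r • x) * x k) (Set.Icc (0 : ℝ) 1) r := by
    intro r _
    have h2 : HasDerivAt (fun r : ℝ => r • x) x r := by
      simpa using (hasDerivAt_id r).smul_const x
    have h3 := (h (r • x)).comp_hasDerivAt r h2
    refine HasDerivAt.hasDerivWithinAt ?_
    simpa [sum_apply, Function.comp_def] using h3
  have h2 := norm_image_sub_le_of_norm_deriv_le_segment' h1 (C := C * ∑ k, |x k|)
    (fun r _ => by
      rw [Real.norm_eq_abs, Finset.mul_sum]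
      refine (Finset.abs_sum_le_sum_abs _ _).trans (Finset.sum_le_sum fun k _ => ?_)
      rw [abs_mul]
      exact mul_le_mul_of_nonneg_right (hC _ _) (abs_nonneg _)) 1 (by simp)
  simp only [one_smul, zero_smul, sub_zero, mul_one, Real.norm_eq_abs] at h2
  have := abs_sub_abs_le_abs_sub (F x) (F 0)
  linarith

/-- The average of a function of a centered Gaussian vector with standard deviations `c`. -/
noncomputable def gaussAvg (F : (ι → ℝ) → ℝ) (c : ι → ℝ) : ℝ := ∫ g, F (c * g) ∂(stdGauss ι)

/-- Differentiation under the expectation; a bounded gradient leaves a majorant linear in the `|g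
k|`. The factors `g k` are removed afterwards by integration by parts. -/
theorem gaussAvg_hasFDerivAt {F : (ι → ℝ) → ℝ} {D : ι → (ι → ℝ) → ℝ} (h : HasGrad F D)
    (hD : ∀ k, Continuous (D k)) {C : ℝ} (hC : ∀ k x, |D k x| ≤ C) (c : ι → ℝ) :
    HasFDerivAt (gaussAvg F)
      (∑ k, (∫ g, g k * D k (c * g) ∂(stdGauss ι)) •
        (ContinuousLinearMap.proj k : (ι → ℝ) →L[ℝ] ℝ)) c := by
  classical
  have hFc := h.continuous
  have hint : ∀ k, Integrable (fun g : ι → ℝ => g k * D k (c * g)) (stdGauss ι) := by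
    intro k
    refine ((integrable_abs_stdGauss k).const_mul C).mono'
      (Continuous.aestronglyMeasurable (by have := hD k; fun_prop)) (ae_of_all _ fun g => ?_)
    rw [Real.norm_eq_abs, abs_mul, mul_comm]
    exact mul_le_mul_of_nonneg_right (hC _ _) (abs_nonneg _)
  have key := hasFDerivAt_integral_of_dominated_of_fderiv_le (μ := stdGauss ι) (𝕜 := ℝ)
    (F := fun c g => F (c * g)) (s := Set.univ) (x₀ := c)
    (F' := fun c g => ∑ k, (g k * D k (c * g)) • (ContinuousLinearMap.proj k : (ι → ℝ) →L[ℝ] ℝ))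
    (bound := fun g => ∑ k, |g k| * C * ‖(ContinuousLinearMap.proj k : (ι → ℝ) →L[ℝ] ℝ)‖)
    univ_mem (Eventually.of_forall fun c =>
      Continuous.aestronglyMeasurable (by fun_prop))
    ?_ ?_ ?_ ?_ ?_
  · have e : ∫ g, ∑ k, (g k * D k (c * g)) • (ContinuousLinearMap.proj k : (ι → ℝ) →L[ℝ] ℝ)
        ∂(stdGauss ι) = ∑ k, (∫ g, g k * D k (c * g) ∂(stdGauss ι)) •
        (ContinuousLinearMap.proj k : (ι → ℝ) →L[ℝ] ℝ) := by
      rw [integral_finsetSum _ fun k _ => (hint k).smul_const _]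
      exact Finset.sum_congr rfl fun k _ => integral_smul_const _ _
    rw [e] at key
    exact key
  · refine integrable_stdGauss_of_le (A := |F 0|) (B := C * ∑ k, |c k|) (C := 0) (by fun_prop)
      fun g => ?_
    refine (h.comp_mul_abs_le hC _).trans ?_
    -- The bound `C` can be negative only if there is no coordinate at all.
    have hC0 : 0 ≤ C ∨ IsEmpty ι := by
      rcases isEmpty_or_nonempty ι with hi | ⟨⟨k⟩⟩
      · exact Or.inr hi
      · exact Or.inl ((abs_nonneg _).trans (hC k 0))
    rcases hC0 with hC0 | hi
    · have : ∑ k, |(c * g) k| ≤ (∑ k, |c k|) * ∑ k, |g k| := by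
        rw [Finset.sum_mul]
        refine Finset.sum_le_sum fun k _ => ?_
        rw [Pi.mul_apply, abs_mul]
        exact mul_le_mul_of_nonneg_left
          (Finset.single_le_sum (f := fun k => |g k|) (fun _ _ => abs_nonneg _)
            (Finset.mem_univ k)) (abs_nonneg _)
      have := mul_le_mul_of_nonneg_left this hC0
      linarith
    · simp
  · refine Continuous.aestronglyMeasurable (continuous_finsetSum _ fun k _ => ?_)
    have := hD k
    fun_prop
  · refine ae_of_all _ fun g x _ => (norm_sum_le _ _).trans (Finset.sum_le_sum fun k _ => ?_)
    rw [norm_smul, Real.norm_eq_abs, abs_mul]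
    gcongr
    exact hC _ _
  · exact integrable_finsetSum _ fun k _ => ((integrable_abs_stdGauss k).mul_const _).mul_const _
  · refine ae_of_all _ fun g x _ => ?_
    have h1 : HasFDerivAt (fun c : ι → ℝ => c * g)
        (ContinuousLinearMap.pi fun k => g k • (ContinuousLinearMap.proj k : (ι → ℝ) →L[ℝ] ℝ))
        x := by
      refine hasFDerivAt_pi.2 fun k => ?_
      have := ((ContinuousLinearMap.proj k : (ι → ℝ) →L[ℝ] ℝ).hasFDerivAt (x := x)).mul_const (g k)
      simpa using this
    have h2 := (h (x * g)).comp x h1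
    refine h2.congr_fderiv ?_
    ext v
    simp
    exact Finset.sum_congr rfl fun k _ => by ring

/-- Integration by parts for one standard Gaussian variable. -/
theorem gaussianReal_integral_mul {f f' : ℝ → ℝ} (hf : ∀ x, HasDerivAt f (f' x) x) {A : ℝ}
    (hA : ∀ x, |f x| ≤ A) (hA' : ∀ x, |f' x| ≤ A) :
    ∫ x, x * f x ∂(gaussianReal 0 1) = ∫ x, f' x ∂(gaussianReal 0 1) := by
  have hfc : Continuous f := continuous_iff_continuousAt.2 fun x => (hf x).continuousAt
  have hm : Measurable f' := by
    rw [show f' = deriv f from funext fun x => (hf x).deriv.symm]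
    exact measurable_deriv f
  set φ := gaussianPDFReal 0 1
  have hφ : ∀ x, HasDerivAt φ (-(x * φ x)) x := by
    intro x
    have e : φ = fun y : ℝ => (√(2 * Real.pi * 1))⁻¹ * Real.exp (-(y - 0) ^ 2 / (2 * 1)) := by
      funext y; simp [φ, gaussianPDFReal]
    have h1 : HasDerivAt (fun y : ℝ => -(y - 0) ^ 2 / (2 * 1)) (-x) x := by
      have := ((((hasDerivAt_id x).sub_const 0).pow 2).neg).div_const (2 * 1)
      refine this.congr_deriv ?_
      simp only [id]
      ring
    rw [e]
    refine (h1.exp.const_mul _).congr_deriv ?_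
    ring
  have hx : Integrable (fun x : ℝ => |x| * φ x) := by
    have h1 : Integrable (fun x : ℝ => |x|) (gaussianReal 0 1) := by
      have h : MemLp (id : ℝ → ℝ) 1 (gaussianReal 0 1) := memLp_id_gaussianReal 1
      simpa using (memLp_one_iff_integrable.1 h).abs
    rw [gaussianReal_of_var_ne_zero _ one_ne_zero] at h1
    have := (integrable_withDensity_iff_integrable_smul' (measurable_gaussianPDF 0 1)
      (ae_of_all _ fun _ => gaussianPDF_lt_top)).1 h1
    simp only [toReal_gaussianPDF, smul_eq_mul] at this
    exact this.congr (ae_of_all _ fun x => mul_comm _ _)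
  have hφi : Integrable φ := integrable_gaussianPDFReal 0 1
  have hφ0 : ∀ x, 0 ≤ φ x := gaussianPDFReal_nonneg 0 1
  have hφc : Continuous φ := continuous_iff_continuousAt.2 fun x => (hφ x).continuousAt
  rw [integral_gaussianReal_eq_integral_smul one_ne_zero,
    integral_gaussianReal_eq_integral_smul one_ne_zero]
  have key := integral_mul_deriv_eq_deriv_mul_of_integrable (u := f) (u' := f') (v := φ)
    (v' := fun x => -(x * φ x)) (fun x _ => hf x) (fun x _ => hφ x) ?_ ?_ ?_
  · have e1 : ∫ x, gaussianPDFReal 0 1 x • (x * f x) = -∫ x, f x * -(x * φ x) := by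
      rw [← integral_neg]
      exact integral_congr_ae (ae_of_all _ fun x => by simp only [smul_eq_mul, φ]; ring)
    rw [e1, key, neg_neg]
    exact integral_congr_ae (ae_of_all _ fun x => by simp only [smul_eq_mul, φ]; ring)
  · refine (hx.const_mul A).mono' (Continuous.aestronglyMeasurable (by fun_prop))
      (ae_of_all _ fun x => ?_)
    simp only [Pi.mul_apply, Real.norm_eq_abs, abs_mul, abs_neg, abs_of_nonneg (hφ0 x)]
    exact mul_le_mul_of_nonneg_right (hA x) (by have := hφ0 x; positivity)
  · refine (hφi.const_mul A).mono' (hm.mul hφc.measurable).aestronglyMeasurable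
      (ae_of_all _ fun x => ?_)
    simp only [Pi.mul_apply, Real.norm_eq_abs, abs_mul, abs_of_nonneg (hφ0 x)]
    exact mul_le_mul_of_nonneg_right (hA' x) (hφ0 x)
  · refine (hφi.const_mul A).mono' (Continuous.aestronglyMeasurable (by fun_prop))
      (ae_of_all _ fun x => ?_)
    simp only [Pi.mul_apply, Real.norm_eq_abs, abs_mul, abs_of_nonneg (hφ0 x)]
    exact mul_le_mul_of_nonneg_right (hA x) (hφ0 x)

/-- Integration by parts for a standard Gaussian vector. -/
theorem stdGauss_integral_mul {G : (ι → ℝ) → ℝ} {D : ι → (ι → ℝ) → ℝ} (h : HasGrad G D)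
    (k : ι) (hD : Continuous (D k)) {A : ℝ} (hG : ∀ x, |G x| ≤ A) (hA : ∀ x, |D k x| ≤ A)
    (c : ι → ℝ) :
    ∫ g, g k * G (c * g) ∂(stdGauss ι) = c k * gaussAvg (D k) c := by
  classical
  have hGc := h.continuous
  -- Coordinate `k` is resampled independently, so that Fubini reduces the claim to one Gaussian
  -- variable with the other coordinates frozen.
  have hmp := measurePreserving_update (ι := ι) k
  unfold gaussAvg
  rw [← integral_const_mul]
  have i1 : Integrable (fun g : ι → ℝ => g k * G (c * g)) (stdGauss ι) := by
    refine ((integrable_abs_stdGauss k).const_mul A).mono'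
      (Continuous.aestronglyMeasurable (by fun_prop)) (ae_of_all _ fun g => ?_)
    rw [Real.norm_eq_abs, abs_mul, mul_comm]
    exact mul_le_mul_of_nonneg_right (hG _) (abs_nonneg _)
  have i2 : Integrable (fun g : ι → ℝ => c k * D k (c * g)) (stdGauss ι) :=
    (integrable_stdGauss_of_bdd (A := A) (by fun_prop) fun g => hA _).const_mul _
  have e1 := hmp.map_eq
  rw [← e1, integral_map hmp.measurable.aemeasurable (by rw [e1]; exact i1.1),
    integral_map hmp.measurable.aemeasurable (by rw [e1]; exact i2.1),
    integral_prod (fun p : (ι → ℝ) × ℝ => Function.update p.1 k p.2 k *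
      G (c * Function.update p.1 k p.2)) (hmp.integrable_comp_of_integrable i1),
    integral_prod (fun p : (ι → ℝ) × ℝ => c k * D k (c * Function.update p.1 k p.2))
      (hmp.integrable_comp_of_integrable i2)]
  refine integral_congr_ae (ae_of_all _ fun g => ?_)
  have hA0 : 0 ≤ A := (abs_nonneg _).trans (hA 0)
  -- A single constant has to bound the function and its derivative, which carries the factor `c k`
  -- of the chain rule.
  have := gaussianReal_integral_mul (f := fun z => G (c * Function.update g k z))
    (f' := fun z => c k * D k (c * Function.update g k z)) (A := A + |c k| * A) ?_ ?_ ?_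
  · simpa using this
  · intro z
    have h1 : HasDerivAt (fun z => c * Function.update g k z) (Pi.single k (c k)) z := by
      refine hasDerivAt_pi.2 fun i => ?_
      by_cases hi : i = k
      · subst hi
        simpa using (hasDerivAt_id z).const_mul (c i)
      · simpa [Function.update_of_ne hi, Pi.single_eq_of_ne hi] using
          hasDerivAt_const z (c i * g i)
    refine ((h _).comp_hasDerivAt z h1).congr_deriv ?_
    simp [sum_apply, Pi.single_apply, mul_comm]
  · intro z
    have := hG (c * Function.update g k z)
    nlinarith [abs_nonneg (c k)]
  · intro z
    rw [abs_mul]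
    have := mul_le_mul_of_nonneg_left (hA (c * Function.update g k z)) (abs_nonneg (c k))
    linarith

/-- The derivative of a Gaussian average with respect to the standard deviations. -/
theorem gaussAvg_hasFDerivAt_second {F : (ι → ℝ) → ℝ} {D : ι → (ι → ℝ) → ℝ}
    {DD : ι → ι → (ι → ℝ) → ℝ} (h : HasGrad F D) (h' : ∀ k, HasGrad (D k) (DD k))
    (hDD : ∀ k, Continuous (DD k k)) {C : ℝ} (hC : ∀ k x, |D k x| ≤ C)
    (hC' : ∀ k x, |DD k k x| ≤ C) (c : ι → ℝ) :
    HasFDerivAt (gaussAvg F)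
      (∑ k, (c k * gaussAvg (DD k k) c) •
        (ContinuousLinearMap.proj k : (ι → ℝ) →L[ℝ] ℝ)) c := by
  have := gaussAvg_hasFDerivAt h (fun k => (h' k).continuous) hC c
  simpa only [fun k => stdGauss_integral_mul (h' k) k (hDD k) (hC k) (hC' k) c] using this

theorem continuous_gaussAvg {F : (ι → ℝ) → ℝ} (hF : Continuous F) {A : ℝ} (hA : ∀ x, |F x| ≤ A) :
    Continuous (gaussAvg F) := by
  refine continuous_of_dominated (bound := fun _ => A)
    (fun c => Continuous.aestronglyMeasurable (by fun_prop))
    (fun c => ae_of_all _ fun g => by simpa using hA _) (integrable_const _)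
    (ae_of_all _ fun g => by fun_prop)

end Gauss

/-! ### Gibbs measures with linear energies -/

section HasGradAlgebra

variable {ι : Type*} [Fintype ι]

theorem HasGrad.congr {F : (ι → ℝ) → ℝ} {D D' : ι → (ι → ℝ) → ℝ} (h : HasGrad F D)
    (e : ∀ k x, D k x = D' k x) : HasGrad F D' := by
  intro x
  have := h x
  simp only [e] at this
  exact this

theorem HasGrad.mul {F G : (ι → ℝ) → ℝ} {D E : ι → (ι → ℝ) → ℝ} (h : HasGrad F D)
    (h' : HasGrad G E) :
    HasGrad (fun x => F x * G x) (fun k x => D k x * G x + F x * E k x) := by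
  intro x
  refine ((h x).mul (h' x)).congr_fderiv ?_
  ext v
  simp only [add_apply, smul_apply, sum_apply,
    ContinuousLinearMap.proj_apply, smul_eq_mul, Finset.mul_sum, ← Finset.sum_add_distrib]
  exact Finset.sum_congr rfl fun k _ => by ring

theorem HasGrad.sub {F G : (ι → ℝ) → ℝ} {D E : ι → (ι → ℝ) → ℝ} (h : HasGrad F D)
    (h' : HasGrad G E) : HasGrad (fun x => F x - G x) (fun k x => D k x - E k x) := by
  intro x
  refine ((h x).sub (h' x)).congr_fderiv ?_
  ext v
  simp [sum_apply, ← Finset.sum_sub_distrib, sub_mul]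

theorem HasGrad.const_mul {F : (ι → ℝ) → ℝ} {D : ι → (ι → ℝ) → ℝ} (h : HasGrad F D) (a : ℝ) :
    HasGrad (fun x => a * F x) (fun k x => a * D k x) := by
  intro x
  refine ((h x).const_mul a).congr_fderiv ?_
  ext v
  simp [sum_apply, Finset.mul_sum, mul_assoc]

theorem HasGrad.sum {α : Type*} {A : Finset α} {F : α → (ι → ℝ) → ℝ}
    {D : α → ι → (ι → ℝ) → ℝ} (h : ∀ a ∈ A, HasGrad (F a) (D a)) :
    HasGrad (fun x => ∑ a ∈ A, F a x) (fun k x => ∑ a ∈ A, D a k x) := by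
  intro x
  refine (HasFDerivAt.fun_sum fun a ha => h a ha x).congr_fderiv ?_
  simp only [Finset.sum_smul]
  exact Finset.sum_comm

/-- Gradients are given in logarithmic form, as they come for Gibbs probabilities; logarithmic
derivatives of a product add, and no division is needed. -/
theorem HasGrad.prod {α : Type*} [DecidableEq α] {A : Finset α} {F : α → (ι → ℝ) → ℝ}
    {D : α → ι → (ι → ℝ) → ℝ} (h : ∀ a ∈ A, HasGrad (F a) (fun k x => F a x * D a k x)) :
    HasGrad (fun x => ∏ a ∈ A, F a x) (fun k x => (∏ a ∈ A, F a x) * ∑ a ∈ A, D a k x) := by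
  induction A using Finset.induction_on with
  | empty => intro x; simpa using hasFDerivAt_const (1 : ℝ) x
  | insert a A ha ih =>
    have h1 := (h a (Finset.mem_insert_self _ _)).mul
      (ih fun b hb => h b (Finset.mem_insert_of_mem hb))
    simp only [Finset.prod_insert ha, Finset.sum_insert ha]
    exact h1.congr fun k x => by ring

end HasGradAlgebra

section Gibbs

variable {ι S : Type*} [Fintype ι] [Fintype S] (s : ι → S → ℝ)

/-- The weight of the configuration `σ` in the fields `x`. -/
noncomputable def linWeight (x : ι → ℝ) (σ : S) : ℝ := Real.exp (∑ k, s k σ * x k)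

/-- The partition function. -/
noncomputable def linPart (x : ι → ℝ) : ℝ := ∑ σ, linWeight s x σ

/-- The Gibbs probability of `σ`. -/
noncomputable def linGibbs (x : ι → ℝ) (σ : S) : ℝ := linWeight s x σ / linPart s x

/-- The Gibbs average of an observable. -/
noncomputable def gibbsAvg (h : S → ℝ) (x : ι → ℝ) : ℝ := ∑ σ, linGibbs s x σ * h σ

theorem linWeight_pos (x : ι → ℝ) (σ : S) : 0 < linWeight s x σ := Real.exp_pos _

variable [Nonempty S]

theorem linPart_pos (x : ι → ℝ) : 0 < linPart s x :=
  Finset.sum_pos (fun σ _ => linWeight_pos s x σ) Finset.univ_nonempty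

theorem linGibbs_pos (x : ι → ℝ) (σ : S) : 0 < linGibbs s x σ :=
  div_pos (linWeight_pos s x σ) (linPart_pos s x)

theorem sum_linGibbs (x : ι → ℝ) : ∑ σ, linGibbs s x σ = 1 := by
  unfold linGibbs
  rw [← Finset.sum_div]
  exact div_self (linPart_pos s x).ne'

theorem gibbsAvg_const (a : ℝ) (x : ι → ℝ) : gibbsAvg s (fun _ => a) x = a := by
  unfold gibbsAvg
  rw [← Finset.sum_mul, sum_linGibbs, one_mul]

theorem gibbsAvg_mono {f h : S → ℝ} (hfh : ∀ σ, f σ ≤ h σ) (x : ι → ℝ) :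
    gibbsAvg s f x ≤ gibbsAvg s h x :=
  Finset.sum_le_sum fun σ _ => mul_le_mul_of_nonneg_left (hfh σ) (linGibbs_pos s x σ).le

theorem gibbsAvg_add (f h : S → ℝ) (x : ι → ℝ) :
    gibbsAvg s (fun σ => f σ + h σ) x = gibbsAvg s f x + gibbsAvg s h x := by
  simp [gibbsAvg, mul_add, Finset.sum_add_distrib]

theorem gibbsAvg_const_mul (a : ℝ) (f : S → ℝ) (x : ι → ℝ) :
    gibbsAvg s (fun σ => a * f σ) x = a * gibbsAvg s f x := by
  simp only [gibbsAvg, Finset.mul_sum]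
  exact Finset.sum_congr rfl fun σ _ => by ring

theorem gibbsAvg_sub (f h : S → ℝ) (x : ι → ℝ) :
    gibbsAvg s (fun σ => f σ - h σ) x = gibbsAvg s f x - gibbsAvg s h x := by
  simp [gibbsAvg, mul_sub, Finset.sum_sub_distrib]

theorem gibbsAvg_sum {α : Type*} (A : Finset α) (f : α → S → ℝ) (x : ι → ℝ) :
    gibbsAvg s (fun σ => ∑ a ∈ A, f a σ) x = ∑ a ∈ A, gibbsAvg s (f a) x := by
  simp only [gibbsAvg, Finset.mul_sum]
  exact Finset.sum_comm

theorem abs_gibbsAvg_le {f : S → ℝ} {A : ℝ} (h : ∀ σ, |f σ| ≤ A) (x : ι → ℝ) :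
    |gibbsAvg s f x| ≤ A := by
  rw [abs_le]
  constructor
  · rw [← gibbsAvg_const s (-A) x]
    exact gibbsAvg_mono s (fun σ => (abs_le.1 (h σ)).1) x
  · rw [← gibbsAvg_const s A x]
    exact gibbsAvg_mono s (fun σ => (abs_le.1 (h σ)).2) x

omit [Nonempty S] in
theorem hasGrad_linWeight (σ : S) :
    HasGrad (fun x => linWeight s x σ) (fun k x => linWeight s x σ * s k σ) := by
  intro x
  have h1 : HasFDerivAt (fun x : ι → ℝ => ∑ k, s k σ * x k)
      (∑ k, s k σ • (ContinuousLinearMap.proj k : (ι → ℝ) →L[ℝ] ℝ)) x :=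
    HasFDerivAt.fun_sum fun k _ =>
      ((ContinuousLinearMap.proj k : (ι → ℝ) →L[ℝ] ℝ).hasFDerivAt (x := x)).const_mul (s k σ)
  refine h1.exp.congr_fderiv ?_
  rw [Finset.smul_sum]
  exact Finset.sum_congr rfl fun k _ => by rw [smul_smul]; rfl

omit [Nonempty S] in
theorem hasGrad_linPart :
    HasGrad (linPart s) (fun k x => ∑ σ, linWeight s x σ * s k σ) :=
  HasGrad.sum fun σ _ => hasGrad_linWeight s σ

theorem sum_linWeight_mul (h : S → ℝ) (x : ι → ℝ) :
    ∑ σ, linWeight s x σ * h σ = linPart s x * gibbsAvg s h x := by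
  have hp := (linPart_pos s x).ne'
  simp only [gibbsAvg, linGibbs, Finset.mul_sum]
  exact Finset.sum_congr rfl fun σ _ => by field_simp

theorem hasGrad_log_linPart :
    HasGrad (fun x => Real.log (linPart s x)) (fun k => gibbsAvg s (s k)) := by
  intro x
  refine ((hasGrad_linPart s x).log (linPart_pos s x).ne').congr_fderiv ?_
  rw [Finset.smul_sum]
  refine Finset.sum_congr rfl fun k _ => ?_
  simp only [smul_smul]
  rw [sum_linWeight_mul, inv_mul_cancel_left₀ (linPart_pos s x).ne']

/-- The weight contributes the logarithmic derivative `s k σ`, and the normalization subtracts `∂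
log Z`, the Gibbs mean of the feature. -/
theorem hasGrad_linGibbs (σ : S) :
    HasGrad (fun x => linGibbs s x σ)
      (fun k x => linGibbs s x σ * (s k σ - gibbsAvg s (s k) x)) := by
  intro x
  have hp := (linPart_pos s x).ne'
  have h1 := ((hasFDerivAt_inv hp).comp x (hasGrad_linPart s x))
  have h2 := (hasGrad_linWeight s σ x).mul h1
  refine (h2.congr_fderiv ?_).congr_of_eventuallyEq (Eventually.of_forall fun y => ?_)
  · ext v
    simp only [sum_linWeight_mul, sum_apply, add_apply,
      smul_apply, ContinuousLinearMap.comp_apply,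
      ContinuousLinearMap.proj_apply, smul_eq_mul, Finset.mul_sum, linGibbs, Function.comp,
      ContinuousLinearMap.toSpanSingleton_apply, Finset.sum_mul, ← Finset.sum_add_distrib]
    refine Finset.sum_congr rfl fun k _ => ?_
    field_simp
    ring
  · simp [linGibbs, div_eq_mul_inv]

/-- Linear response: the derivative of a mean is the covariance with the feature that is coupled to
the field. -/
theorem hasGrad_gibbsAvg (h : S → ℝ) :
    HasGrad (gibbsAvg s h)
      (fun k x => gibbsAvg s (fun σ => h σ * s k σ) x - gibbsAvg s h x * gibbsAvg s (s k) x) := by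
  have h1 : HasGrad (gibbsAvg s h) (fun k x => ∑ σ, h σ *
      (linGibbs s x σ * (s k σ - gibbsAvg s (s k) x))) := by
    have := HasGrad.sum (A := (Finset.univ : Finset S))
      fun σ _ => (hasGrad_linGibbs s σ).const_mul (h σ)
    unfold gibbsAvg at this ⊢
    simpa only [mul_comm (h _)] using this
  refine h1.congr fun k x => ?_
  rw [gibbsAvg.eq_1 s (fun σ => h σ * s k σ), gibbsAvg.eq_1 s h, Finset.sum_mul,
    ← Finset.sum_sub_distrib]
  exact Finset.sum_congr rfl fun σ _ => by ring

theorem continuous_gibbsAvg (h : S → ℝ) : Continuous (gibbsAvg s h) :=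
  (hasGrad_gibbsAvg s h).continuous

/-- The variance of an observable is nonnegative; it controls the first absolute moment. -/
theorem gibbsAvg_abs_sub_le (h : S → ℝ) (x : ι → ℝ) {r : ℝ} (hr : 0 < r) :
    gibbsAvg s (fun σ => |h σ - gibbsAvg s h x|) x
      ≤ r / 2 + (gibbsAvg s (fun σ => h σ ^ 2) x - gibbsAvg s h x ^ 2) / (2 * r) := by
  set m := gibbsAvg s h x with hm
  -- This is `|y| ≤ r / 2 + y² / (2 r)` for `y = h σ - m`, that is `(|y| - r)² ≥ 0`. The free `r`
  -- will be chosen to balance the two terms.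
  have h1 : ∀ σ, |h σ - m| ≤ r / 2 + 1 / (2 * r) * ((h σ ^ 2 - 2 * m * h σ) + m ^ 2) := by
    intro σ
    have : r / 2 + 1 / (2 * r) * ((h σ ^ 2 - 2 * m * h σ) + m ^ 2) - |h σ - m|
        = (|h σ - m| - r) ^ 2 / (2 * r) := by
      field_simp
      have := sq_abs (h σ - m)
      linear_combination -this
    have h2 : 0 ≤ (|h σ - m| - r) ^ 2 / (2 * r) := by positivity
    linarith
  refine (gibbsAvg_mono s h1 x).trans (le_of_eq ?_)
  rw [gibbsAvg_add, gibbsAvg_const, gibbsAvg_const_mul, gibbsAvg_add, gibbsAvg_const,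
    gibbsAvg_sub, gibbsAvg_const_mul, ← hm]
  ring

theorem gibbsAvg_variance_nonneg (h : S → ℝ) (x : ι → ℝ) :
    0 ≤ gibbsAvg s (fun σ => h σ ^ 2) x - gibbsAvg s h x ^ 2 := by
  set m := gibbsAvg s h x with hm
  have h1 : 0 ≤ gibbsAvg s (fun σ => (h σ ^ 2 - 2 * m * h σ) + m ^ 2) x := by
    rw [← gibbsAvg_const s 0 x]
    exact gibbsAvg_mono s (fun σ => by nlinarith [sq_nonneg (h σ - m)]) x
  rw [gibbsAvg_add, gibbsAvg_const, gibbsAvg_sub, gibbsAvg_const_mul, ← hm] at h1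
  linarith

/-! ### Replicas -/

variable [One S]

/-- Replicas with labels in `V`, continued arbitrarily. -/
def extendRep (V : Finset ℕ) (τ : V → S) : ℕ → S :=
  fun a => if h : a ∈ V then τ ⟨a, h⟩ else 1

/-- The average over independent replicas with labels in `V`. -/
noncomputable def repAvg (V : Finset ℕ) (f : (ℕ → S) → ℝ) (x : ι → ℝ) : ℝ :=
  ∑ τ : V → S, (∏ a, linGibbs s x (τ a)) * f (extendRep V τ)

omit [Fintype S] [Nonempty S] in
theorem extendRep_coe (V : Finset ℕ) (τ : V → S) (a : V) : extendRep V τ a = τ a := by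
  simp [extendRep]

omit [Nonempty S] in
theorem repAvg_empty (f : (ℕ → S) → ℝ) (x : ι → ℝ) :
    repAvg s ∅ f x = f (fun _ => 1) := by
  have : ∀ τ : (∅ : Finset ℕ) → S, extendRep ∅ τ = fun _ => 1 := by
    intro τ; funext a; simp [extendRep]
  simp [repAvg, this]

omit [Nonempty S] in
-- Given the fields the replicas are independent, so one of them can be averaged separately.
-- Factorization and the removal of idle replicas both come from this.
theorem repAvg_insert {V : Finset ℕ} {u : ℕ} (hu : u ∉ V) (f : (ℕ → S) → ℝ) (x : ι → ℝ) :
    repAvg s (insert u V) f x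
      = ∑ σ, linGibbs s x σ * repAvg s V (fun τ => f (Function.update τ u σ)) x := by
  let e : (↥(insert u V) → S) ≃ S × (V → S) :=
    { toFun := fun τ => (τ ⟨u, Finset.mem_insert_self _ _⟩,
        fun a => τ ⟨a, Finset.mem_insert_of_mem a.2⟩)
      invFun := fun p a => if h : (a : ℕ) = u then p.1 else
        p.2 ⟨a, (Finset.mem_insert.1 a.2).resolve_left h⟩
      left_inv := by
        intro τ
        funext ⟨a, ha⟩
        by_cases h : a = u
        · subst h; simp
        · simp [h]
      right_inv := by
        rintro ⟨σ, τ⟩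
        ext a
        · simp
        · have : (a : ℕ) ≠ u := fun h => hu (h ▸ a.2)
          simp [this] }
  have hext : ∀ τ : ↥(insert u V) → S,
      extendRep (insert u V) τ = Function.update (extendRep V (e τ).2) u (e τ).1 := by
    intro τ
    funext a
    by_cases h : a = u
    · subst h; simp [extendRep, e]
    · by_cases h' : a ∈ V <;> simp [extendRep, e, h, h']
  have hprod : ∀ τ : ↥(insert u V) → S,
      ∏ a, linGibbs s x (τ a) = linGibbs s x (e τ).1 * ∏ a, linGibbs s x ((e τ).2 a) := by
    intro τ
    have h1 : ∏ a, linGibbs s x (τ a)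
        = ∏ a ∈ insert u V, linGibbs s x (extendRep (insert u V) τ a) := by
      rw [← Finset.prod_coe_sort (insert u V)]
      simp only [extendRep_coe]
    have h2 : ∏ a, linGibbs s x ((e τ).2 a)
        = ∏ a ∈ V, linGibbs s x (extendRep V (e τ).2 a) := by
      rw [← Finset.prod_coe_sort V]
      simp only [extendRep_coe]
    rw [h1, h2, Finset.prod_insert hu, hext, Function.update_self]
    congr 1
    refine Finset.prod_congr rfl fun a ha => ?_
    rw [Function.update_of_ne (ne_of_mem_of_not_mem ha hu)]
  unfold repAvg
  rw [Fintype.sum_equiv e (fun τ => (∏ a, linGibbs s x (τ a)) * f (extendRep (insert u V) τ))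
    (fun p => (linGibbs s x p.1 * ∏ a, linGibbs s x (p.2 a)) *
      f (Function.update (extendRep V p.2) u p.1)) (fun τ => by rw [hprod, hext]),
    Fintype.sum_prod_type]
  refine Finset.sum_congr rfl fun σ _ => ?_
  rw [Finset.mul_sum]
  exact Finset.sum_congr rfl fun τ _ => by ring

/-- `f` does not depend on the replicas outside `V`. -/
def DependsOnReps (V : Finset ℕ) (f : (ℕ → S) → ℝ) : Prop :=
  ∀ u ∉ V, ∀ τ σ, f (Function.update τ u σ) = f τ

omit [Nonempty S] in
theorem repAvg_mul_right (V : Finset ℕ) (f : (ℕ → S) → ℝ) (a : ℝ) (x : ι → ℝ) :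
    repAvg s V (fun τ => f τ * a) x = repAvg s V f x * a := by
  simp [repAvg, Finset.sum_mul, mul_assoc]

omit [Nonempty S] in
theorem repAvg_insert_mul {V : Finset ℕ} {u : ℕ} (hu : u ∉ V) {f : (ℕ → S) → ℝ}
    (hf : ∀ τ σ, f (Function.update τ u σ) = f τ) (h : S → ℝ) (x : ι → ℝ) :
    repAvg s (insert u V) (fun τ => f τ * h (τ u)) x = repAvg s V f x * gibbsAvg s h x := by
  rw [repAvg_insert s hu]
  simp only [hf, Function.update_self, repAvg_mul_right]
  rw [gibbsAvg, Finset.mul_sum]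
  exact Finset.sum_congr rfl fun σ _ => by ring

theorem repAvg_insert_of_indep {V : Finset ℕ} {u : ℕ} (hu : u ∉ V) {f : (ℕ → S) → ℝ}
    (hf : ∀ τ σ, f (Function.update τ u σ) = f τ) (x : ι → ℝ) :
    repAvg s (insert u V) f x = repAvg s V f x := by
  have := repAvg_insert_mul s hu hf (fun _ => 1) x
  simpa [gibbsAvg_const] using this

/-- Idle replicas integrate to one. This lets the graphs in a streaming sum, which involve different
replicas, be averaged over one common set. -/
theorem repAvg_of_subset {V W : Finset ℕ} (hVW : V ⊆ W) {f : (ℕ → S) → ℝ}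
    (hf : DependsOnReps V f) (x : ι → ℝ) : repAvg s W f x = repAvg s V f x := by
  have : ∀ W' : Finset ℕ, Disjoint W' V → repAvg s (W' ∪ V) f x = repAvg s V f x := by
    intro W'
    induction W' using Finset.induction_on with
    | empty => intro _; rw [Finset.empty_union]
    | insert u W' hu ih =>
      intro hd
      rw [Finset.disjoint_insert_left] at hd
      rw [Finset.insert_union, repAvg_insert_of_indep s (by simp [hu, hd.1]) (hf u hd.1), ih hd.2]
  have h2 := this (W \ V) Finset.sdiff_disjoint
  rwa [Finset.sdiff_union_of_subset hVW] at h2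

omit [Nonempty S] in
theorem repAvg_add (V : Finset ℕ) (f h : (ℕ → S) → ℝ) (x : ι → ℝ) :
    repAvg s V (fun τ => f τ + h τ) x = repAvg s V f x + repAvg s V h x := by
  simp [repAvg, mul_add, Finset.sum_add_distrib]

omit [Nonempty S] in
theorem repAvg_sub (V : Finset ℕ) (f h : (ℕ → S) → ℝ) (x : ι → ℝ) :
    repAvg s V (fun τ => f τ - h τ) x = repAvg s V f x - repAvg s V h x := by
  simp [repAvg, mul_sub, Finset.sum_sub_distrib]

omit [Nonempty S] in
theorem repAvg_sum {α : Type*} (A : Finset α) (V : Finset ℕ) (f : α → (ℕ → S) → ℝ)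
    (x : ι → ℝ) :
    repAvg s V (fun τ => ∑ a ∈ A, f a τ) x = ∑ a ∈ A, repAvg s V (f a) x := by
  simp only [repAvg, Finset.mul_sum]
  exact Finset.sum_comm

theorem repAvg_const (V : Finset ℕ) (a : ℝ) (x : ι → ℝ) : repAvg s V (fun _ => a) x = a := by
  rw [repAvg_of_subset s (Finset.empty_subset V) (fun _ _ _ _ => rfl), repAvg_empty]

theorem repAvg_mono (V : Finset ℕ) {f h : (ℕ → S) → ℝ} (hfh : ∀ τ, f τ ≤ h τ) (x : ι → ℝ) :
    repAvg s V f x ≤ repAvg s V h x :=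
  Finset.sum_le_sum fun τ _ => mul_le_mul_of_nonneg_left (hfh _)
    (Finset.prod_nonneg fun a _ => (linGibbs_pos s x _).le)

theorem abs_repAvg_le_repAvg_abs (V : Finset ℕ) (f : (ℕ → S) → ℝ) (x : ι → ℝ) :
    |repAvg s V f x| ≤ repAvg s V (fun τ => |f τ|) x := by
  refine (Finset.abs_sum_le_sum_abs _ _).trans (le_of_eq (Finset.sum_congr rfl fun τ _ => ?_))
  rw [abs_mul, abs_of_nonneg (Finset.prod_nonneg fun a _ => (linGibbs_pos s x _).le)]

theorem abs_repAvg_le (V : Finset ℕ) {f : (ℕ → S) → ℝ} {A : ℝ} (h : ∀ τ, |f τ| ≤ A)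
    (x : ι → ℝ) : |repAvg s V f x| ≤ A :=
  (abs_repAvg_le_repAvg_abs s V f x).trans
    ((repAvg_mono s V h x).trans (repAvg_const s V A x).le)

theorem repAvg_single {V : Finset ℕ} {a : ℕ} (ha : a ∈ V) (h : S → ℝ) (x : ι → ℝ) :
    repAvg s V (fun τ => h (τ a)) x = gibbsAvg s h x := by
  have h1 : DependsOnReps {a} (fun τ : ℕ → S => h (τ a)) := by
    intro u hu τ σ
    have : a ≠ u := fun h => hu (by simp [h])
    simp [Function.update_of_ne this]
  rw [repAvg_of_subset s (Finset.singleton_subset_iff.2 ha) h1]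
  have := repAvg_insert_mul s (V := ∅) (u := a) (by simp) (f := fun _ => 1) (fun _ _ => rfl) h x
  simp only [one_mul, repAvg_empty, insert_empty_eq] at this
  exact this

/-- Each replica in `V` contributes its own centred feature; the `V.card` equal means are collected
in the last term. -/
theorem hasGrad_repAvg (V : Finset ℕ) (f : (ℕ → S) → ℝ) :
    HasGrad (repAvg s V f) (fun k x => repAvg s V (fun τ => f τ * ∑ a ∈ V, s k (τ a)) x
      - V.card * (repAvg s V f x * gibbsAvg s (s k) x)) := by
  classical
  have h1 := HasGrad.sum (A := (Finset.univ : Finset (V → S))) fun τ _ =>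
    (HasGrad.prod (A := (Finset.univ : Finset V)) fun a _ =>
      hasGrad_linGibbs s (τ a)).const_mul (f (extendRep V τ))
  have h2 : (fun x => ∑ τ : V → S, f (extendRep V τ) * ∏ a, linGibbs s x (τ a))
      = repAvg s V f := by
    funext x
    exact Finset.sum_congr rfl fun τ _ => mul_comm _ _
  rw [h2] at h1
  refine h1.congr fun k x => ?_
  unfold repAvg
  rw [Finset.sum_mul, Finset.mul_sum, ← Finset.sum_sub_distrib]
  refine Finset.sum_congr rfl fun τ _ => ?_
  have h3 : ∑ a ∈ V, s k (extendRep V τ a) = ∑ a : V, s k (τ a) := by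
    rw [← Finset.sum_coe_sort V]
    simp only [extendRep_coe]
  simp only [h3, Finset.sum_sub_distrib]
  simp only [Finset.sum_const, Finset.card_univ, Fintype.card_coe, nsmul_eq_mul]
  ring

theorem continuous_repAvg (V : Finset ℕ) (f : (ℕ → S) → ℝ) : Continuous (repAvg s V f) :=
  (hasGrad_repAvg s V f).continuous

/-- The product of the features `k` of the replicas at the two ends of a line. -/
def edgeFeature (k : ι) (τ : ℕ → S) : Sym2 ℕ → ℝ :=
  Sym2.lift ⟨fun a b => s k (τ a) * s k (τ b), fun _ _ => mul_comm _ _⟩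

theorem Finset.sum_sum_eq_lt {M : Type*} [AddCommMonoid M] (V : Finset ℕ) (f : ℕ → ℕ → M) :
    ∑ a ∈ V, ∑ b ∈ V, f a b = (∑ a ∈ V, ∑ b ∈ V with a < b, f a b)
      + (∑ a ∈ V, ∑ b ∈ V with a < b, f b a) + ∑ a ∈ V, f a a := by
  have h1 : ∑ a ∈ V, ∑ b ∈ V with a < b, f b a = ∑ a ∈ V, ∑ b ∈ V with b < a, f a b := by
    simp only [Finset.sum_filter]
    exact Finset.sum_comm
  rw [h1, ← Finset.sum_add_distrib, ← Finset.sum_add_distrib]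
  refine Finset.sum_congr rfl fun a ha => ?_
  rw [← Finset.sum_filter_add_sum_filter_not V (fun b => a < b), add_assoc]
  congr 1
  rw [← Finset.sum_filter_add_sum_filter_not (V.filter fun b => ¬ a < b) (fun b => b < a),
    Finset.filter_filter, Finset.filter_filter]
  congr 1
  · exact Finset.sum_congr (Finset.filter_congr fun b _ => by omega) fun _ _ => rfl
  · rw [Finset.sum_eq_single a]
    · intro b hb hba
      simp only [Finset.mem_filter] at hb
      omega
    · intro h
      simp [ha] at h

/-- The second derivative of a replica average with respect to a field. -/
theorem hasGrad_grad_repAvg (hs : ∀ k σ, s k σ ^ 2 = 1) (V : Finset ℕ) {f : (ℕ → S) → ℝ}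
    (hf : DependsOnReps V f) (k : ι) :
    ∃ E : ι → (ι → ℝ) → ℝ,
      HasGrad (fun x => repAvg s V (fun τ => f τ * ∑ a ∈ V, s k (τ a)) x
        - V.card * (repAvg s V f x * gibbsAvg s (s k) x)) E ∧
      ∀ x, E k x = 2 * streamSum V fun e =>
        repAvg s (insert (V.sup id + 1) (insert (V.sup id + 2) V))
          (fun τ => f τ * edgeFeature s k τ e) x := by
  refine ⟨_, (hasGrad_repAvg s V _).sub
    (((hasGrad_repAvg s V f).mul (hasGrad_gibbsAvg s (s k))).const_mul _), fun x => ?_⟩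
  set u := V.sup id + 1
  set v := V.sup id + 2
  have hle : ∀ a ∈ V, a ≤ V.sup id := fun a ha => Finset.le_sup (f := id) ha
  have hu : u ∉ V := fun h => by have := hle _ h; omega
  have hv : v ∉ V := fun h => by have := hle _ h; omega
  have huv : u ≠ v := by omega
  have hsV : V ⊆ insert u (insert v V) :=
    (Finset.subset_insert _ _).trans (Finset.subset_insert _ _)
  have hss : gibbsAvg s (fun σ => s k σ * s k σ) x = 1 := by
    simp only [← sq, hs, gibbsAvg_const]
  -- the three kinds of lines
  have e1 : ∀ a ∈ V, ∀ b ∈ V, repAvg s (insert u (insert v V))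
      (fun τ => f τ * edgeFeature s k τ s(a, b)) x
      = repAvg s V (fun τ => f τ * (s k (τ a) * s k (τ b))) x := by
    intro a ha b hb
    refine repAvg_of_subset s hsV ?_ x
    intro w hw τ σ
    have h1 : a ≠ w := fun h => hw (h ▸ ha)
    have h2 : b ≠ w := fun h => hw (h ▸ hb)
    simp [edgeFeature, Function.update_of_ne h1, Function.update_of_ne h2, hf w hw]
  have e2 : ∀ a ∈ V, repAvg s (insert u (insert v V))
      (fun τ => f τ * edgeFeature s k τ s(a, u)) x
      = repAvg s V (fun τ => f τ * s k (τ a)) x * gibbsAvg s (s k) x := by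
    intro a ha
    have hau : a ≠ u := fun h => hu (h ▸ ha)
    have hsub : insert u V ⊆ insert u (insert v V) :=
      Finset.insert_subset_insert _ (Finset.subset_insert _ _)
    rw [repAvg_of_subset s hsub]
    · have := repAvg_insert_mul s hu (f := fun τ => f τ * s k (τ a)) (fun τ σ => by
        rw [hf u hu, Function.update_of_ne hau]) (s k) x
      rw [← this]
      congr 1
      funext τ
      simp [edgeFeature, mul_assoc]
    · intro w hw τ σ
      rw [Finset.mem_insert, not_or] at hw
      have h1 : a ≠ w := fun h => hw.2 (h ▸ ha)
      have h2 : u ≠ w := fun h => hw.1 h.symm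
      simp [edgeFeature, Function.update_of_ne h1, Function.update_of_ne h2, hf w hw.2]
  have e3 : repAvg s (insert u (insert v V))
      (fun τ => f τ * edgeFeature s k τ s(u, v)) x
      = repAvg s V f x * gibbsAvg s (s k) x ^ 2 := by
    have h1 := repAvg_insert_mul s (V := insert v V) (u := u) (by simp [huv, hu])
      (f := fun τ => f τ * s k (τ v)) (fun τ σ => by
        rw [hf u hu, Function.update_of_ne huv.symm]) (s k) x
    rw [repAvg_insert_mul s hv (hf v hv)] at h1
    rw [sq, ← mul_assoc, ← h1]
    congr 1
    funext τ
    simp [edgeFeature]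
    ring
  -- The square of the sum contains each pair twice and, because `s k ^ 2 = 1`, the diagonal `V.card
  -- * f τ`. The diagonal cancels against the `1` in the variance of `s k`, so that only lines
  -- between different replicas survive.
  have hsq : ∀ τ : ℕ → S, (f τ * ∑ a ∈ V, s k (τ a)) * ∑ a ∈ V, s k (τ a)
      = 2 * (∑ a ∈ V, ∑ b ∈ V with a < b, f τ * (s k (τ a) * s k (τ b))) + V.card * f τ := by
    intro τ
    rw [mul_assoc, Finset.sum_mul_sum, Finset.sum_sum_eq_lt]
    have h1 : ∑ a ∈ V, s k (τ a) * s k (τ a) = V.card := by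
      simp [← sq, hs]
    rw [h1]
    simp only [mul_comm (s k (τ _)) (s k (τ _)), ← Finset.mul_sum]
    ring
  have d1 : repAvg s V (fun τ => (f τ * ∑ a ∈ V, s k (τ a)) * ∑ a ∈ V, s k (τ a)) x
      = 2 * (∑ a ∈ V, ∑ b ∈ V with a < b, repAvg s V (fun τ => f τ * (s k (τ a) * s k (τ b))) x)
        + V.card * repAvg s V f x := by
    simp only [hsq, repAvg_add]
    have h1 : repAvg s V (fun τ => (V.card : ℝ) * f τ) x = V.card * repAvg s V f x := by
      simp only [mul_comm (V.card : ℝ), repAvg_mul_right]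
    rw [h1]
    simp only [mul_comm (2 : ℝ), repAvg_mul_right, repAvg_sum]
  have d2 : repAvg s V (fun τ => f τ * ∑ a ∈ V, s k (τ a)) x
      = ∑ a ∈ V, repAvg s V (fun τ => f τ * s k (τ a)) x := by
    simp only [Finset.mul_sum, repAvg_sum]
  have r1 : ∑ a ∈ V, ∑ b ∈ V with a < b, repAvg s (insert u (insert v V))
      (fun τ => f τ * edgeFeature s k τ s(a, b)) x
      = ∑ a ∈ V, ∑ b ∈ V with a < b, repAvg s V (fun τ => f τ * (s k (τ a) * s k (τ b))) x :=
    Finset.sum_congr rfl fun a ha => Finset.sum_congr rfl fun b hb =>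
      e1 a ha b (Finset.mem_of_mem_filter b hb)
  have r2 : ∑ a ∈ V, repAvg s (insert u (insert v V))
      (fun τ => f τ * edgeFeature s k τ s(a, u)) x
      = (∑ a ∈ V, repAvg s V (fun τ => f τ * s k (τ a)) x) * gibbsAvg s (s k) x := by
    rw [Finset.sum_mul]
    exact Finset.sum_congr rfl e2
  unfold streamSum
  beta_reduce
  rw [r1, r2, e3, d1, hss, d2]
  simp only [smul_eq_mul]
  ring

end Gibbs

/-! ### Streaming sums -/

section StreamSum

variable {M : Type*} [AddCommGroup M] [Module ℝ M]

theorem le_sup_id {V : Finset ℕ} {a : ℕ} (ha : a ∈ V) : a ≤ V.sup id :=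
  Finset.le_sup (f := id) ha

/-- The replicas of `V` and the two additional ones of the streaming sum. -/
def streamVerts (V : Finset ℕ) : Finset ℕ := insert (V.sup id + 1) (insert (V.sup id + 2) V)

theorem subset_streamVerts (V : Finset ℕ) : V ⊆ streamVerts V :=
  (Finset.subset_insert _ _).trans (Finset.subset_insert _ _)

theorem streamSum_congr {V : Finset ℕ} {f h : Sym2 ℕ → M}
    (e : ∀ a ∈ streamVerts V, ∀ b ∈ streamVerts V, a ≠ b → f s(a, b) = h s(a, b)) :
    streamSum V f = streamSum V h := by
  have hV := subset_streamVerts V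
  have hu : V.sup id + 1 ∈ streamVerts V := by simp [streamVerts]
  have hv : V.sup id + 2 ∈ streamVerts V := by simp [streamVerts]
  unfold streamSum
  rw [e _ hu _ hv (by omega)]
  congr 2
  · refine Finset.sum_congr rfl fun a ha => Finset.sum_congr rfl fun b hb => ?_
    rw [Finset.mem_filter] at hb
    exact e a (hV ha) b (hV hb.1) hb.2.ne
  · congr 1
    exact Finset.sum_congr rfl fun a ha => e a (hV ha) _ hu (by have := le_sup_id ha; omega)

theorem map_streamSum {M' : Type*} [AddCommGroup M'] [Module ℝ M'] (L : M →ₗ[ℝ] M')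
    (V : Finset ℕ) (f : Sym2 ℕ → M) : L (streamSum V f) = streamSum V fun e => L (f e) := by
  simp [streamSum, map_sum]

theorem streamSum_smul (V : Finset ℕ) (r : ℝ) (f : Sym2 ℕ → M) :
    streamSum V (fun e => r • f e) = r • streamSum V f :=
  (map_streamSum (LinearMap.lsmul ℝ M r) V f).symm

theorem streamSum_mul (V : Finset ℕ) (r : ℝ) (f : Sym2 ℕ → ℝ) :
    streamSum V (fun e => r * f e) = r * streamSum V f :=
  streamSum_smul V r f

theorem streamSum_add (V : Finset ℕ) (f h : Sym2 ℕ → M) :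
    streamSum V (fun e => f e + h e) = streamSum V f + streamSum V h := by
  simp only [streamSum, Finset.sum_add_distrib, smul_add]
  abel

theorem streamSum_sub (V : Finset ℕ) (f h : Sym2 ℕ → M) :
    streamSum V (fun e => f e - h e) = streamSum V f - streamSum V h := by
  simp only [streamSum, Finset.sum_sub_distrib, smul_sub]
  abel

theorem streamSum_finsetSum {α : Type*} (A : Finset α) (V : Finset ℕ) (f : α → Sym2 ℕ → M) :
    streamSum V (fun e => ∑ i ∈ A, f i e) = ∑ i ∈ A, streamSum V (f i) := by
  classical
  induction A using Finset.induction_on with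
  | empty => simp [streamSum]
  | insert i A hi ih => simp only [Finset.sum_insert hi, streamSum_add, ih]

theorem card_lt_pairs (V : Finset ℕ) :
    (∑ a ∈ V, ∑ b ∈ V with a < b, (1 : ℝ)) = V.card * (V.card - 1) / 2 := by
  have := Finset.sum_sum_eq_lt V (fun _ _ => (1 : ℝ))
  simp only [Finset.sum_const, nsmul_eq_mul, mul_one] at this ⊢
  linarith

/-- The streaming sum when all terms of a kind are equal. -/
theorem streamSum_of_eq {V : Finset ℕ} {f : Sym2 ℕ → ℝ} {x y z : ℝ}
    (hx : ∀ a ∈ V, ∀ b ∈ V, a < b → f s(a, b) = x) (hy : ∀ a ∈ V, f s(a, V.sup id + 1) = y)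
    (hz : f s(V.sup id + 1, V.sup id + 2) = z) :
    streamSum V f = (V.card * (V.card - 1) / 2) * x - V.card ^ 2 * y
      + (V.card * (V.card + 1) / 2) * z := by
  have h1 : ∑ a ∈ V, ∑ b ∈ V with a < b, f s(a, b) = (V.card * (V.card - 1) / 2) * x := by
    rw [← card_lt_pairs, Finset.sum_mul]
    refine Finset.sum_congr rfl fun a ha => ?_
    rw [Finset.sum_mul]
    refine Finset.sum_congr rfl fun b hb => ?_
    rw [Finset.mem_filter] at hb
    rw [hx a ha b hb.1 hb.2, one_mul]
  unfold streamSum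
  rw [h1, hz, Finset.sum_congr rfl hy]
  simp only [Finset.sum_const, nsmul_eq_mul, smul_eq_mul]
  ring

/-- With `s` replicas the coefficients add up to `s(s-1)/2 - s² + s(s+1)/2 = 0`. This removes the
constants left over by the missing diagonal couplings. -/
theorem streamSum_const (V : Finset ℕ) (r : ℝ) : streamSum V (fun _ => r) = 0 := by
  rw [streamSum_of_eq (fun _ _ _ _ _ => rfl) (fun _ _ => rfl) rfl]
  ring

/-- The sum of the absolute values of the coefficients of the streaming sum. -/
noncomputable def streamBound (V : Finset ℕ) : ℝ :=
  V.card * (V.card - 1) / 2 + V.card ^ 2 + V.card * (V.card + 1) / 2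

theorem streamBound_nonneg (V : Finset ℕ) : 0 ≤ streamBound V := by
  have : (V.card : ℝ) * (V.card - 1) / 2 + V.card ^ 2 + V.card * (V.card + 1) / 2
      = 2 * (V.card : ℝ) ^ 2 := by ring
  rw [streamBound, this]
  positivity

theorem abs_streamSum_le {V : Finset ℕ} {f : Sym2 ℕ → ℝ} {B : ℝ}
    (h : ∀ a b, a ≠ b → |f s(a, b)| ≤ B) : |streamSum V f| ≤ streamBound V * B := by
  have h1 : |∑ a ∈ V, ∑ b ∈ V with a < b, f s(a, b)| ≤ (V.card * (V.card - 1) / 2) * B := by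
    rw [← card_lt_pairs, Finset.sum_mul]
    refine (Finset.abs_sum_le_sum_abs _ _).trans (Finset.sum_le_sum fun a _ => ?_)
    rw [Finset.sum_mul]
    refine (Finset.abs_sum_le_sum_abs _ _).trans (Finset.sum_le_sum fun b hb => ?_)
    rw [one_mul]
    exact h _ _ (Finset.mem_filter.1 hb).2.ne
  have h2 : |∑ a ∈ V, f s(a, V.sup id + 1)| ≤ V.card * B := by
    refine (Finset.abs_sum_le_sum_abs _ _).trans ((Finset.sum_le_sum fun a ha =>
      h _ _ (by have := le_sup_id ha; omega)).trans ?_)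
    simp
  have h3 : |(V.card : ℝ) • (∑ a ∈ V, f s(a, V.sup id + 1))| ≤ V.card ^ 2 * B := by
    rw [smul_eq_mul, abs_mul, abs_of_nonneg (Nat.cast_nonneg _), sq, mul_assoc]
    exact mul_le_mul_of_nonneg_left h2 (Nat.cast_nonneg _)
  have h4 : |((V.card : ℝ) * (V.card + 1) / 2) • f s(V.sup id + 1, V.sup id + 2)|
      ≤ (V.card * (V.card + 1) / 2) * B := by
    rw [smul_eq_mul, abs_mul, abs_of_nonneg (by positivity)]
    exact mul_le_mul_of_nonneg_left (h _ _ (by omega)) (by positivity)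
  unfold streamSum streamBound
  rw [add_mul, add_mul]
  exact (abs_add_le _ _).trans (add_le_add ((abs_sub _ _).trans (add_le_add h1 h3)) h4)

theorem continuous_streamSum {X : Type*} [TopologicalSpace X] {V : Finset ℕ}
    {f : Sym2 ℕ → X → ℝ} (h : ∀ e, Continuous (f e)) :
    Continuous fun x => streamSum V fun e => f e x := by
  unfold streamSum
  simp only [smul_eq_mul]
  fun_prop

theorem gaussAvg_streamSum {ι : Type*} [Fintype ι] {V : Finset ℕ} {F : Sym2 ℕ → (ι → ℝ) → ℝ}
    (hF : ∀ e, Continuous (F e)) {A : ℝ} (hA : ∀ e x, |F e x| ≤ A) (c : ι → ℝ) :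
    gaussAvg (fun x => streamSum V fun e => F e x) c = streamSum V fun e => gaussAvg (F e) c := by
  have hi : ∀ e, Integrable (fun g => F e (c * g)) (stdGauss ι) := fun e =>
    integrable_stdGauss_of_bdd (by have := hF e; fun_prop) fun g => hA e _
  unfold gaussAvg streamSum
  simp only [smul_eq_mul]
  have i1 : ∀ a, Integrable (fun g => ∑ b ∈ V with a < b, F s(a, b) (c * g)) (stdGauss ι) :=
    fun a => integrable_finsetSum _ fun b _ => hi _
  have i2 : Integrable (fun g => ∑ a ∈ V, F s(a, V.sup id + 1) (c * g)) (stdGauss ι) :=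
    integrable_finsetSum _ fun a _ => hi _
  have i3 : Integrable (fun g => ∑ a ∈ V, ∑ b ∈ V with a < b, F s(a, b) (c * g)) (stdGauss ι) :=
    integrable_finsetSum _ fun a _ => i1 a
  have i4 : Integrable (fun g => (∑ a ∈ V, ∑ b ∈ V with a < b, F s(a, b) (c * g))
      - V.card * ∑ a ∈ V, F s(a, V.sup id + 1) (c * g)) (stdGauss ι) :=
    i3.sub (i2.const_mul _)
  rw [integral_add i4 ((hi _).const_mul _), integral_sub i3 (i2.const_mul _),
    integral_const_mul, integral_const_mul, integral_finsetSum _ fun a _ => i1 a,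
    integral_finsetSum _ fun a _ => hi _]
  congr 2
  exact Finset.sum_congr rfl fun a _ => integral_finsetSum _ fun b _ => hi _

end StreamSum

/-! ### The model as a Gibbs measure with Gaussian fields -/

section SK

variable {N : ℕ}

theorem spin_sq (σ : SpinConfig N) (i : Fin N) : spin σ i ^ 2 = 1 := by
  unfold spin
  rcases Int.units_eq_one_or (σ i) with h | h <;> simp [h]

theorem spin_neg (σ : SpinConfig N) (i : Fin N) : spin (-σ) i = -spin σ i := by
  simp [spin]

/-- Couplings and cavity fields in one family. -/
abbrev SKIndex (N : ℕ) : Type := (Fin N × Fin N) ⊕ Fin N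

/-- The products of spins that couple to the Gaussian variables. -/
noncomputable def skFeature (N : ℕ) : SKIndex N → SpinConfig N → ℝ
  | Sum.inl p, σ => spin σ p.1 * spin σ p.2
  | Sum.inr i, σ => spin σ i

/-- The standard deviations of the Gaussian fields. -/
noncomputable def skScale (N : ℕ) (a b : ℝ) : SKIndex N → ℝ
  | Sum.inl p => if p.1 < p.2 then a else 0
  | Sum.inr _ => b

theorem skFeature_sq (k : SKIndex N) (σ : SpinConfig N) : skFeature N k σ ^ 2 = 1 := by
  rcases k with p | i
  · simp [skFeature, mul_pow, spin_sq]
  · simp [skFeature, spin_sq]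

theorem abs_eq_one_of_sq {x : ℝ} (h : x ^ 2 = 1) : |x| = 1 := by
  rw [← sq_eq_sq₀ (abs_nonneg _) zero_le_one, sq_abs, h, one_pow]

theorem abs_skFeature (k : SKIndex N) (σ : SpinConfig N) : |skFeature N k σ| = 1 :=
  abs_eq_one_of_sq (skFeature_sq k σ)

/-- Couplings and fields are merged into one Gaussian vector; what distinguishes them, including the
absence of the pairs with `i ≥ j`, is moved to the scales. -/
theorem disorder_integral (Φ : Disorder N → ℝ) :
    ∫ d, Φ d ∂(disorderLaw N)
      = ∫ g, Φ (fun p => g (Sum.inl p), fun i => g (Sum.inr i)) ∂(stdGauss (SKIndex N)) := by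
  have h := measurePreserving_sumPiEquivProdPi (ι := Fin N × Fin N) (ι' := Fin N)
    (X := fun _ => ℝ) (fun _ => gaussianReal 0 1)
  exact (h.integral_comp' Φ).symm

/-- The disorder made of the components of a Gaussian vector. -/
def toDisorder (g : SKIndex N → ℝ) : Disorder N :=
  (fun p => g (Sum.inl p), fun i => g (Sum.inr i))

/-- The scale that corresponds to the parameters of the model. -/
noncomputable def skPoint (N : ℕ) (β t : ℝ) : SKIndex N → ℝ :=
  skScale N (β / √N) (√(t / N))

theorem hamiltonian_eq (g : SKIndex N → ℝ) (σ : SpinConfig N) :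
    hamiltonian N (toDisorder g) σ
      = -∑ k, skScale N (1 / √N) 0 k * g k * skFeature N k σ := by
  rw [Fintype.sum_sum_type, Fintype.sum_prod_type]
  simp only [hamiltonian, toDisorder, skScale, skFeature, zero_mul, Finset.sum_const_zero,
    add_zero, neg_mul, Finset.mul_sum, ← Finset.sum_neg_distrib]
  refine Finset.sum_congr rfl fun i _ => Finset.sum_congr rfl fun j _ => ?_
  split_ifs <;> ring

theorem boltzmannWeight_eq (β t : ℝ) (g : SKIndex N → ℝ) (σ : SpinConfig N) :
    boltzmannWeight N β t (toDisorder g) σ = linWeight (skFeature N) (skPoint N β t * g) σ := by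
  unfold boltzmannWeight linWeight
  rw [hamiltonian_eq]
  congr 1
  rw [Fintype.sum_sum_type, Fintype.sum_sum_type]
  simp only [skPoint, skScale, skFeature, toDisorder, Pi.mul_apply, zero_mul,
    Finset.sum_const_zero, add_zero, neg_mul_neg, Finset.mul_sum]
  congr 1
  · refine Finset.sum_congr rfl fun p _ => ?_
    split_ifs <;> ring
  · exact Finset.sum_congr rfl fun i _ => by ring

theorem partitionFn_eq (β t : ℝ) (g : SKIndex N → ℝ) :
    partitionFn N β t (toDisorder g) = linPart (skFeature N) (skPoint N β t * g) := by
  simp [partitionFn, linPart, boltzmannWeight_eq]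

theorem gibbs_eq (β t : ℝ) (g : SKIndex N → ℝ) (σ : SpinConfig N) :
    gibbs N β t (toDisorder g) σ = linGibbs (skFeature N) (skPoint N β t * g) σ := by
  simp [gibbs, linGibbs, boltzmannWeight_eq, partitionFn_eq]

/-- The overlap of the replicas at the two ends of a line. -/
noncomputable def edgeOverlap (τ : ℕ → SpinConfig N) : Sym2 ℕ → ℝ :=
  Sym2.lift ⟨fun a b => overlap (τ a) (τ b), fun _ _ => overlap_comm _ _⟩

theorem value_cons (τ : ℕ → SpinConfig N) (e : Sym2 ℕ) (G : OverlapGraph) :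
    OverlapGraph.value τ (e ::ₘ G) = edgeOverlap τ e * OverlapGraph.value τ G := by
  simp [OverlapGraph.value, edgeOverlap]

theorem value_zero (τ : ℕ → SpinConfig N) : OverlapGraph.value τ 0 = 1 := by
  simp [OverlapGraph.value]

theorem abs_overlap_le (σ τ : SpinConfig N) : |overlap σ τ| ≤ 1 := by
  have h : |∑ i : Fin N, spin σ i * spin τ i| ≤ N := by
    refine (Finset.abs_sum_le_sum_abs _ _).trans ?_
    have : ∀ i, |spin σ i * spin τ i| = 1 := by
      intro i
      exact abs_eq_one_of_sq (by rw [mul_pow, spin_sq, spin_sq, one_mul])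
    simp [this]
  unfold overlap
  rw [abs_mul, abs_of_nonneg (by positivity)]
  rcases Nat.eq_zero_or_pos N with rfl | hN
  · simp
  · have : (0 : ℝ) < N := by exact_mod_cast hN
    calc 1 / (N : ℝ) * _ ≤ 1 / N * N := by gcongr
      _ = 1 := by field_simp

theorem abs_edgeOverlap_le (τ : ℕ → SpinConfig N) (e : Sym2 ℕ) : |edgeOverlap τ e| ≤ 1 := by
  induction e using Sym2.ind with
  | _ a b => exact abs_overlap_le _ _

theorem abs_value_le (τ : ℕ → SpinConfig N) (G : OverlapGraph) :
    |OverlapGraph.value τ G| ≤ 1 := by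
  induction G using Multiset.induction_on with
  | empty => simp [value_zero]
  | cons e G ih =>
    rw [value_cons, abs_mul]
    exact mul_le_one₀ (abs_edgeOverlap_le _ _) (abs_nonneg _) ih

theorem verts_cons (e : Sym2 ℕ) (G : OverlapGraph) (a : ℕ) :
    a ∈ OverlapGraph.verts (e ::ₘ G) ↔ a ∈ e ∨ a ∈ G.verts := by
  simp [OverlapGraph.mem_verts]

theorem dependsOnReps_value (G : OverlapGraph) :
    DependsOnReps G.verts (fun τ : ℕ → SpinConfig N => G.value τ) := by
  intro u hu τ σ
  induction G using Multiset.induction_on with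
  | empty => simp [value_zero]
  | cons e G ih =>
    rw [verts_cons, not_or] at hu
    simp only [value_cons]
    congr 1
    · induction e using Sym2.ind with
      | _ a b =>
        have h := hu.1
        rw [Sym2.mem_iff, not_or] at h
        simp [edgeOverlap, Function.update_of_ne (Ne.symm h.1), Function.update_of_ne (Ne.symm h.2)]
    · exact ih hu.2

/-- The average of a monomial over replicas, for given fields. -/
noncomputable def monAvg (N : ℕ) (W : Finset ℕ) (G : OverlapGraph) :
    (SKIndex N → ℝ) → ℝ :=
  repAvg (skFeature N) W fun τ => G.value τ

theorem abs_monAvg_le (W : Finset ℕ) (G : OverlapGraph) (x : SKIndex N → ℝ) :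
    |monAvg N W G x| ≤ 1 :=
  abs_repAvg_le _ _ (fun _ => abs_value_le _ _) _

theorem continuous_monAvg (W : Finset ℕ) (G : OverlapGraph) : Continuous (monAvg N W G) :=
  continuous_repAvg _ _ _

theorem monAvg_of_subset {W : Finset ℕ} {G : OverlapGraph} (h : G.verts ⊆ W) :
    monAvg N W G = monAvg N G.verts G := by
  funext x
  exact repAvg_of_subset _ h (dependsOnReps_value G) x

theorem graphAvg_eq (β t : ℝ) (G : OverlapGraph) :
    graphAvg N β t G = gaussAvg (monAvg N G.verts G) (skPoint N β t) := by
  unfold graphAvg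
  rw [disorder_integral]
  change ∫ g, ∑ τ : G.verts → SpinConfig N, (∏ a, gibbs N β t (toDisorder g) (τ a)) * _
    ∂(stdGauss (SKIndex N)) = _
  simp only [gibbs_eq]
  rfl

theorem graphAvg_eq_of_subset (β t : ℝ) {W : Finset ℕ} {G : OverlapGraph} (h : G.verts ⊆ W) :
    graphAvg N β t G = gaussAvg (monAvg N W G) (skPoint N β t) := by
  rw [graphAvg_eq, monAvg_of_subset h]

theorem abs_gaussAvg_le {ι : Type*} [Fintype ι] {F : (ι → ℝ) → ℝ} {A : ℝ} (h : ∀ x, |F x| ≤ A)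
    (c : ι → ℝ) : |gaussAvg F c| ≤ A := by
  have := norm_integral_le_of_norm_le_const (μ := stdGauss ι) (f := fun g => F (c * g))
    (ae_of_all _ fun g => by simpa using h (c * g))
  simpa [gaussAvg] using this

theorem abs_graphAvg_le (β t : ℝ) (G : OverlapGraph) : |graphAvg N β t G| ≤ 1 := by
  rw [graphAvg_eq]
  exact abs_gaussAvg_le (abs_monAvg_le _ _) _

theorem continuous_skScale : Continuous fun p : ℝ × ℝ => skScale N p.1 p.2 := by
  refine continuous_pi fun k => ?_
  rcases k with p | i
  · by_cases h : p.1 < p.2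
    · simpa [skScale, h] using continuous_fst
    · simpa [skScale, h] using continuous_const
  · exact continuous_snd

theorem continuous_skPoint : Continuous fun p : ℝ × ℝ => skPoint N p.1 p.2 :=
  continuous_skScale.comp ((continuous_fst.div_const _).prodMk
    (Real.continuous_sqrt.comp (continuous_snd.div_const _)))

theorem continuous_graphAvg (G : OverlapGraph) :
    Continuous fun p : ℝ × ℝ => graphAvg N p.1 p.2 G := by
  simp only [graphAvg_eq]
  exact (continuous_gaussAvg (continuous_monAvg _ _) (abs_monAvg_le _ _)).comp continuous_skPoint

theorem skScale_hasDerivAt {a b : ℝ → ℝ} {a' b' y : ℝ} (ha : HasDerivAt a a' y)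
    (hb : HasDerivAt b b' y) :
    HasDerivAt (fun y => skScale N (a y) (b y)) (skScale N a' b') y := by
  refine hasDerivAt_pi.2 fun k => ?_
  rcases k with p | i
  · by_cases h : p.1 < p.2
    · simpa [skScale, h] using ha
    · simpa [skScale, h] using hasDerivAt_const y (0 : ℝ)
  · exact hb

/-- Derivative of a Gaussian average along a path of scales. -/
theorem gaussAvg_skScale_hasDerivAt {F : (SKIndex N → ℝ) → ℝ}
    {D : SKIndex N → (SKIndex N → ℝ) → ℝ} {DD : SKIndex N → SKIndex N → (SKIndex N → ℝ) → ℝ}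
    (h : HasGrad F D) (h' : ∀ k, HasGrad (D k) (DD k))
    (hDD : ∀ k, Continuous (DD k k)) {C : ℝ} (hC : ∀ k x, |D k x| ≤ C)
    (hC' : ∀ k x, |DD k k x| ≤ C) {a b : ℝ → ℝ} {a' b' y : ℝ} (ha : HasDerivAt a a' y)
    (hb : HasDerivAt b b' y) :
    HasDerivAt (fun y => gaussAvg F (skScale N (a y) (b y)))
      (a y * a' * gaussAvg (fun x => ∑ p : Fin N × Fin N with p.1 < p.2,
          DD (Sum.inl p) (Sum.inl p) x) (skScale N (a y) (b y))
        + b y * b' * gaussAvg (fun x => ∑ i, DD (Sum.inr i) (Sum.inr i) x)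
          (skScale N (a y) (b y))) y := by
  have hi : ∀ k, Integrable (fun g => DD k k (skScale N (a y) (b y) * g))
      (stdGauss (SKIndex N)) := fun k =>
    integrable_stdGauss_of_bdd (by have := hDD k; fun_prop) fun g => hC' k _
  have h1 := (gaussAvg_hasFDerivAt_second h h' hDD hC hC'
    (skScale N (a y) (b y))).comp_hasDerivAt y (skScale_hasDerivAt ha hb)
  refine h1.congr_deriv ?_
  rw [sum_apply, Fintype.sum_sum_type]
  simp only [smul_apply, ContinuousLinearMap.proj_apply, smul_eq_mul]
  congr 1
  · rw [gaussAvg, integral_finsetSum _ fun p _ => hi _, Finset.mul_sum, Finset.sum_filter]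
    refine Finset.sum_congr rfl fun p _ => ?_
    simp only [skScale]
    split_ifs
    · simp only [gaussAvg]; ring
    · ring
  · rw [gaussAvg, integral_finsetSum _ fun p _ => hi _, Finset.mul_sum]
    refine Finset.sum_congr rfl fun i _ => ?_
    simp only [skScale, gaussAvg]; ring

theorem sum_edgeFeature_inr (hN : 1 ≤ N) (τ : ℕ → SpinConfig N) (e : Sym2 ℕ) :
    ∑ i, edgeFeature (skFeature N) (Sum.inr i) τ e = N * edgeOverlap τ e := by
  have : (N : ℝ) ≠ 0 := by positivity
  induction e using Sym2.ind with
  | _ a b =>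
    simp only [edgeFeature, edgeOverlap, Sym2.lift_mk, skFeature, overlap]
    field_simp

/-- The square of the sum consists of two equal halves and the diagonal `N`. Applied to products of
spins of two replicas it converts couplings into squared overlaps. -/
theorem sum_lt_mul_eq (f : Fin N → ℝ) (hf : ∀ i, f i ^ 2 = 1) :
    ∑ p : Fin N × Fin N with p.1 < p.2, f p.1 * f p.2 = ((∑ i, f i) ^ 2 - N) / 2 := by
  have h1 : (∑ i, f i) ^ 2 = 2 * (∑ p : Fin N × Fin N with p.1 < p.2, f p.1 * f p.2) + N := by
    rw [sq, Finset.sum_mul_sum, ← Fintype.sum_prod_type' (f := fun i j => f i * f j),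
      ← Finset.sum_filter_add_sum_filter_not Finset.univ (fun p : Fin N × Fin N => p.1 < p.2),
      ← Finset.sum_filter_add_sum_filter_not
        (Finset.univ.filter fun p : Fin N × Fin N => ¬ p.1 < p.2) (fun p => p.2 < p.1),
      Finset.filter_filter, Finset.filter_filter]
    have h2 : ∑ p : Fin N × Fin N with ¬ p.1 < p.2 ∧ p.2 < p.1, f p.1 * f p.2
        = ∑ p : Fin N × Fin N with p.1 < p.2, f p.1 * f p.2 := by
      refine Finset.sum_equiv (Equiv.prodComm _ _) (fun p => ?_) fun p _ => ?_
      · simp only [Finset.mem_filter, Finset.mem_univ, true_and, Equiv.prodComm_apply,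
          Prod.fst_swap, Prod.snd_swap]
        exact ⟨fun h => h.2, fun h => ⟨h.le.not_gt, h⟩⟩
      · simp [mul_comm]
    have h3 : ∑ p : Fin N × Fin N with ¬ p.1 < p.2 ∧ ¬ p.2 < p.1, f p.1 * f p.2 = N := by
      have : (Finset.univ.filter fun p : Fin N × Fin N => ¬ p.1 < p.2 ∧ ¬ p.2 < p.1)
          = Finset.univ.image fun i : Fin N => (i, i) := by
        ext ⟨i, j⟩
        simp only [Finset.mem_filter, Finset.mem_univ, true_and, Finset.mem_image, Prod.mk.injEq,
          not_lt]
        constructor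
        · rintro ⟨h, h'⟩; exact ⟨i, rfl, le_antisymm h' h⟩
        · rintro ⟨k, rfl, rfl⟩; exact ⟨le_rfl, le_rfl⟩
      rw [this, Finset.sum_image (by intro i _ j _ h; exact (Prod.mk.inj h).1)]
      simp [← sq, hf]
    rw [h2, h3]
    ring
  linarith

theorem sum_edgeFeature_inl (hN : 1 ≤ N) (τ : ℕ → SpinConfig N) (e : Sym2 ℕ) :
    ∑ p : Fin N × Fin N with p.1 < p.2, edgeFeature (skFeature N) (Sum.inl p) τ e
      = (N ^ 2 * (edgeOverlap τ e * edgeOverlap τ e) - N) / 2 := by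
  have hN' : (N : ℝ) ≠ 0 := by positivity
  induction e using Sym2.ind with
  | _ a b =>
    have := sum_lt_mul_eq (fun i => spin (τ a) i * spin (τ b) i)
      (fun i => by rw [mul_pow, spin_sq, spin_sq, one_mul])
    simp only [edgeFeature, edgeOverlap, Sym2.lift_mk, skFeature, overlap]
    rw [show (N : ℝ) ^ 2 * ((1 / N * ∑ i, spin (τ a) i * spin (τ b) i)
      * (1 / N * ∑ i, spin (τ a) i * spin (τ b) i)) = (∑ i, spin (τ a) i * spin (τ b) i) ^ 2 by
        field_simp, ← this]
    exact Finset.sum_congr rfl fun p _ => by ring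

theorem abs_edgeFeature (k : SKIndex N) (τ : ℕ → SpinConfig N) (e : Sym2 ℕ) :
    |edgeFeature (skFeature N) k τ e| = 1 := by
  induction e using Sym2.ind with
  | _ a b => simp [edgeFeature, abs_mul, abs_skFeature]

/-- Derivative of the average of a monomial along a path of scales. -/
theorem gaussAvg_monAvg_hasDerivAt (hN : 1 ≤ N) (G : OverlapGraph) {a b : ℝ → ℝ} {a' b' y : ℝ}
    (ha : HasDerivAt a a' y) (hb : HasDerivAt b b' y) :
    HasDerivAt (fun y => gaussAvg (monAvg N G.verts G) (skScale N (a y) (b y)))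
      (a y * a' * (N ^ 2 * streamSum G.verts fun e =>
          gaussAvg (monAvg N (streamVerts G.verts) (e ::ₘ e ::ₘ G)) (skScale N (a y) (b y)))
        + b y * b' * (2 * N * streamSum G.verts fun e =>
          gaussAvg (monAvg N (streamVerts G.verts) (e ::ₘ G)) (skScale N (a y) (b y)))) y := by
  choose E hE hE' using fun k => hasGrad_grad_repAvg (skFeature N) skFeature_sq G.verts
    (dependsOnReps_value (N := N) G) k
  set W := streamVerts G.verts
  replace hE' : ∀ k x, E k k x = 2 * streamSum G.verts fun e => repAvg (skFeature N) W
    (fun τ => G.value τ * edgeFeature (skFeature N) k τ e) x := hE'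
  have hbd : ∀ k e x, |repAvg (skFeature N) W
      (fun τ => G.value τ * edgeFeature (skFeature N) k τ e) x| ≤ 1 := by
    intro k e x
    refine abs_repAvg_le _ _ (fun τ => ?_) x
    rw [abs_mul, abs_edgeFeature, mul_one]
    exact abs_value_le _ _
  have hcE : ∀ k, Continuous (E k k) := by
    intro k
    rw [show E k k = _ from funext (hE' k)]
    exact (continuous_streamSum fun e => continuous_repAvg _ _ _).const_mul 2
  have hC' : ∀ k x, |E k k x| ≤ 2 * streamBound G.verts := by
    intro k x
    rw [hE', abs_mul, abs_two]
    have := abs_streamSum_le (V := G.verts) (f := fun e => repAvg (skFeature N) W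
      (fun τ => G.value τ * edgeFeature (skFeature N) k τ e) x) (B := 1)
      (fun a b _ => hbd k s(a, b) x)
    rw [mul_one] at this
    exact mul_le_mul_of_nonneg_left this zero_le_two
  have hC : ∀ k x, |repAvg (skFeature N) G.verts
      (fun τ => G.value τ * ∑ a ∈ G.verts, skFeature N k (τ a)) x
      - G.verts.card * (repAvg (skFeature N) G.verts (fun τ => G.value τ) x
        * gibbsAvg (skFeature N) (skFeature N k) x)| ≤ 2 * G.verts.card := by
    intro k x
    have h1 : |repAvg (skFeature N) G.verts
      (fun τ => G.value τ * ∑ a ∈ G.verts, skFeature N k (τ a)) x| ≤ G.verts.card := by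
      refine abs_repAvg_le _ _ (fun τ => ?_) x
      rw [abs_mul]
      have h2 : |∑ a ∈ G.verts, skFeature N k (τ a)| ≤ G.verts.card := by
        refine (Finset.abs_sum_le_sum_abs _ _).trans ?_
        simp [abs_skFeature]
      calc _ ≤ 1 * (G.verts.card : ℝ) :=
            mul_le_mul (abs_value_le _ _) h2 (abs_nonneg _) zero_le_one
        _ = _ := one_mul _
    have h3 : |(G.verts.card : ℝ) * (repAvg (skFeature N) G.verts (fun τ => G.value τ) x
        * gibbsAvg (skFeature N) (skFeature N k) x)| ≤ G.verts.card := by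
      rw [abs_mul, abs_mul, abs_of_nonneg (Nat.cast_nonneg _)]
      have h4 := abs_monAvg_le (N := N) G.verts G x
      have h5 := abs_gibbsAvg_le (skFeature N) (f := skFeature N k)
        (fun σ => (abs_skFeature k σ).le) x
      have := mul_le_one₀ h4 (abs_nonneg _) h5
      calc _ ≤ (G.verts.card : ℝ) * 1 := mul_le_mul_of_nonneg_left this (Nat.cast_nonneg _)
        _ = _ := mul_one _
    have := abs_sub (repAvg (skFeature N) G.verts
      (fun τ => G.value τ * ∑ a ∈ G.verts, skFeature N k (τ a)) x)
      (G.verts.card * (repAvg (skFeature N) G.verts (fun τ => G.value τ) x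
        * gibbsAvg (skFeature N) (skFeature N k) x))
    linarith
  have key := gaussAvg_skScale_hasDerivAt (hasGrad_repAvg (skFeature N) G.verts
    fun τ => G.value τ) hE hcE
    (C := 2 * G.verts.card + 2 * streamBound G.verts)
    (fun k x => (hC k x).trans (by have := streamBound_nonneg G.verts; linarith))
    (fun k x => (hC' k x).trans (by
      have : (0 : ℝ) ≤ G.verts.card := Nat.cast_nonneg _
      linarith)) ha hb
  refine key.congr_deriv ?_
  have e1 : (fun x => ∑ p : Fin N × Fin N with p.1 < p.2, E (Sum.inl p) (Sum.inl p) x)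
      = fun x => streamSum G.verts fun e => N ^ 2 * monAvg N W (e ::ₘ e ::ₘ G) x := by
    funext x
    simp only [hE', ← Finset.mul_sum, ← streamSum_finsetSum]
    rw [← streamSum_mul]
    have : ∀ e, 2 * ∑ p : Fin N × Fin N with p.1 < p.2, repAvg (skFeature N) W
        (fun τ => G.value τ * edgeFeature (skFeature N) (Sum.inl p) τ e) x
        = N ^ 2 * monAvg N W (e ::ₘ e ::ₘ G) x - N * monAvg N W G x := by
      intro e
      rw [← repAvg_sum]
      simp only [← Finset.mul_sum, sum_edgeFeature_inl hN]
      unfold monAvg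
      rw [mul_comm, mul_comm _ (repAvg _ _ _ _), mul_comm _ (repAvg _ _ _ _), ← repAvg_mul_right,
        ← repAvg_mul_right, ← repAvg_mul_right, ← repAvg_sub]
      congr 1
      funext τ
      rw [value_cons, value_cons]
      ring
    -- The term `-N` from the diagonal pairs is the same for every line and therefore has streaming
    -- sum zero.
    simp only [this, streamSum_sub, streamSum_const, sub_zero]
  have e2 : (fun x => ∑ i, E (Sum.inr i) (Sum.inr i) x)
      = fun x => streamSum G.verts fun e => 2 * N * monAvg N W (e ::ₘ G) x := by
    funext x
    simp only [hE', ← Finset.mul_sum, ← streamSum_finsetSum]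
    rw [← streamSum_mul]
    congr 1
    funext e
    rw [← repAvg_sum]
    have hτ : ∀ τ : ℕ → SpinConfig N, ∑ i, G.value τ * edgeFeature (skFeature N) (Sum.inr i) τ e
        = G.value τ * (N * edgeOverlap τ e) := fun τ => by
      rw [← Finset.mul_sum, sum_edgeFeature_inr hN]
    simp only [hτ]
    unfold monAvg
    rw [mul_comm, mul_comm _ (repAvg _ _ _ _), ← repAvg_mul_right, ← repAvg_mul_right]
    congr 1
    funext τ
    rw [value_cons]
    ring
  have hmul : ∀ (r : ℝ) (H : OverlapGraph) (c : SKIndex N → ℝ),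
      gaussAvg (fun x => r * monAvg N W H x) c = r * gaussAvg (monAvg N W H) c :=
    fun r H c => integral_const_mul _ _
  have hb' : ∀ (r : ℝ) (H : OverlapGraph) (x : SKIndex N → ℝ), |r * monAvg N W H x| ≤ |r| := by
    intro r H x
    rw [abs_mul]
    exact mul_le_of_le_one_right (abs_nonneg _) (abs_monAvg_le _ _ _)
  rw [e1, e2, gaussAvg_streamSum (fun e => (continuous_monAvg _ _).const_mul _)
    (fun e x => hb' _ _ x), gaussAvg_streamSum (fun e => (continuous_monAvg _ _).const_mul _)
    (fun e x => hb' _ _ x)]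
  simp only [hmul, streamSum_mul]

theorem verts_cons_subset_streamVerts {G : OverlapGraph} {V : Finset ℕ} {a b : ℕ}
    (hG : G.verts ⊆ streamVerts V) (ha : a ∈ streamVerts V) (hb : b ∈ streamVerts V) :
    OverlapGraph.verts (s(a, b) ::ₘ G) ⊆ streamVerts V := by
  intro c hc
  rw [verts_cons, Sym2.mem_iff] at hc
  rcases hc with (rfl | rfl) | hc
  · exact ha
  · exact hb
  · exact hG hc

theorem streamSum_gaussAvg_one (β t : ℝ) (G : OverlapGraph) :
    (streamSum G.verts fun e =>
        gaussAvg (monAvg N (streamVerts G.verts) (e ::ₘ G)) (skPoint N β t))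
      = streamSum G.verts fun e => graphAvg N β t (e ::ₘ G) :=
  streamSum_congr fun _ ha _ hb _ => (graphAvg_eq_of_subset β t
    (verts_cons_subset_streamVerts (subset_streamVerts _) ha hb)).symm

theorem streamSum_gaussAvg_two (β t : ℝ) (G : OverlapGraph) :
    (streamSum G.verts fun e =>
        gaussAvg (monAvg N (streamVerts G.verts) (e ::ₘ e ::ₘ G)) (skPoint N β t))
      = streamSum G.verts fun e => graphAvg N β t (e ::ₘ e ::ₘ G) :=
  streamSum_congr fun _ ha _ hb _ => (graphAvg_eq_of_subset β t
    (verts_cons_subset_streamVerts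
      (verts_cons_subset_streamVerts (subset_streamVerts _) ha hb) ha hb)).symm

theorem sqrt_div_hasDerivAt {y : ℝ} (hy : 0 < y) (hN : 1 ≤ N) :
    HasDerivAt (fun y : ℝ => √(y / N)) (1 / (2 * √(y / N)) * (1 / N)) y := by
  have hN' : (0 : ℝ) < N := by exact_mod_cast hN
  have h1 : HasDerivAt (fun y : ℝ => y / N) (1 / N) y := (hasDerivAt_id y).div_const _
  refine (h1.sqrt (by positivity)).congr_deriv ?_
  ring

/-- This is half the derivative of the variance `y / N`. Both `t` and `β²` enter as variances, which
is why derivatives in these variables have constant prefactors; positivity is needed because the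
root is singular at `0`. -/
theorem sqrt_div_mul_deriv {y : ℝ} (hy : 0 < y) (hN : 1 ≤ N) :
    √(y / N) * (1 / (2 * √(y / N)) * (1 / N)) = 1 / (2 * N) := by
  have hN' : (0 : ℝ) < N := by exact_mod_cast hN
  have : 0 < √(y / N) := Real.sqrt_pos.2 (by positivity)
  field_simp

theorem skPoint_sqrt {y : ℝ} (hy : 0 ≤ y) (t : ℝ) :
    skPoint N (√y) t = skScale N (√(y / N)) (√(t / N)) := by
  rw [skPoint, Real.sqrt_div hy]

/-- The streaming equation. -/
theorem graphAvg_hasDerivAt_field (hN : 1 ≤ N) (β : ℝ) {t : ℝ} (ht : 0 < t) (G : OverlapGraph) :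
    HasDerivAt (fun t => graphAvg N β t G)
      (streamSum G.verts fun e => graphAvg N β t (e ::ₘ G)) t := by
  have hN' : (0 : ℝ) < N := by exact_mod_cast hN
  have h := gaussAvg_monAvg_hasDerivAt hN G (hasDerivAt_const t (β / √N))
    (sqrt_div_hasDerivAt ht hN)
  simp only [graphAvg_eq (β := β) (G := G), skPoint]
  refine h.congr_deriv ?_
  rw [sqrt_div_mul_deriv ht hN]
  change _ + 1 / (2 * (N : ℝ)) * (2 * N * streamSum G.verts fun e =>
    gaussAvg (monAvg N (streamVerts G.verts) (e ::ₘ G)) (skPoint N β t)) = _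
  rw [streamSum_gaussAvg_one]
  field_simp
  ring

/-- Only the couplings move: the variance contributes `1 / (2 N)` and the second derivatives `N ^ 2`
times the bracket. The cavity field may be kept at any strength. -/
theorem graphAvg_hasDerivAt_sq (hN : 1 ≤ N) (t : ℝ) {y : ℝ} (hy : 0 < y) (G : OverlapGraph) :
    HasDerivAt (fun y => graphAvg N (√y) t G)
      (N / 2 * bracket (graphAvg N (√y) t) G) y := by
  have hN' : (0 : ℝ) < N := by exact_mod_cast hN
  have h := gaussAvg_monAvg_hasDerivAt hN G (sqrt_div_hasDerivAt hy hN)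
    (hasDerivAt_const y (√(t / N)))
  have e : (fun y => graphAvg N (√y) t G) =ᶠ[𝓝 y]
      fun y => gaussAvg (monAvg N G.verts G) (skScale N (√(y / N)) (√(t / N))) := by
    filter_upwards [lt_mem_nhds hy] with z hz
    rw [graphAvg_eq, skPoint_sqrt hz.le]
  refine (h.congr_deriv ?_).congr_of_eventuallyEq e
  rw [sqrt_div_mul_deriv hy hN]
  simp only [← skPoint_sqrt hy.le]
  rw [streamSum_gaussAvg_two]
  unfold bracket
  field_simp
  ring

end SK

/-! ### Free energy and internal energy, and the vanishing of unfilled graphs -/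

section SK

variable {N : ℕ}

/-- `E ln Z_{N,t}`. -/
noncomputable def freeEnergy (N : ℕ) (β t : ℝ) : ℝ :=
  gaussAvg (fun x => Real.log (linPart (skFeature N) x)) (skPoint N β t)

theorem verts_graphQ : graphQ.verts = {1, 2} := by
  ext a; simp [OverlapGraph.mem_verts, graphQ]

theorem verts_graphQ2 : graphQ2.verts = {1, 2} := by
  ext a; simp [OverlapGraph.mem_verts, graphQ2]

theorem sq_gibbsAvg_feature (k : SKIndex N) (x : SKIndex N → ℝ) :
    gibbsAvg (skFeature N) (skFeature N k) x ^ 2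
      = repAvg (skFeature N) {1, 2} (fun τ => edgeFeature (skFeature N) k τ s(1, 2)) x := by
  have h1 := repAvg_insert_mul (skFeature N) (V := {2}) (u := 1) (by simp)
    (f := fun τ => skFeature N k (τ 2)) (fun τ σ => by simp) (skFeature N k) x
  rw [repAvg_single _ (by simp)] at h1
  rw [sq, ← h1]
  congr 1
  funext τ
  simp [edgeFeature, mul_comm]

theorem sum_variance_inr (hN : 1 ≤ N) (x : SKIndex N → ℝ) :
    ∑ i, (gibbsAvg (skFeature N) (fun σ => skFeature N (Sum.inr i) σ * skFeature N (Sum.inr i) σ) x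
      - gibbsAvg (skFeature N) (skFeature N (Sum.inr i)) x
        * gibbsAvg (skFeature N) (skFeature N (Sum.inr i)) x)
      = N * (1 - monAvg N graphQ.verts graphQ x) := by
  simp only [← sq, skFeature_sq, gibbsAvg_const, Finset.sum_sub_distrib, sq_gibbsAvg_feature,
    ← repAvg_sum, sum_edgeFeature_inr hN]
  simp only [mul_comm (N : ℝ), repAvg_mul_right, monAvg, verts_graphQ]
  have : ∀ τ : ℕ → SpinConfig N, graphQ.value τ = edgeOverlap τ s(1, 2) := fun τ => by
    simp [graphQ, OverlapGraph.value, edgeOverlap]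
  simp [this]
  ring

/-- A feature of square one has variance `1 - ω(s)²`, and the squared mean is an average over two
replicas. The `N` missing diagonal terms cancel between the number of pairs and the squared overlap.
-/
theorem sum_variance_inl (hN : 1 ≤ N) (x : SKIndex N → ℝ) :
    ∑ p : Fin N × Fin N with p.1 < p.2,
      (gibbsAvg (skFeature N) (fun σ => skFeature N (Sum.inl p) σ * skFeature N (Sum.inl p) σ) x
      - gibbsAvg (skFeature N) (skFeature N (Sum.inl p)) x
        * gibbsAvg (skFeature N) (skFeature N (Sum.inl p)) x)
      = N ^ 2 / 2 * (1 - monAvg N graphQ2.verts graphQ2 x) := by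
  have hc : ∑ p : Fin N × Fin N with p.1 < p.2, (1 : ℝ) = (N ^ 2 - N) / 2 := by
    simpa using sum_lt_mul_eq (N := N) (fun _ => 1) (by simp)
  simp only [← sq, skFeature_sq, gibbsAvg_const, Finset.sum_sub_distrib, sq_gibbsAvg_feature,
    ← repAvg_sum, sum_edgeFeature_inl hN, hc]
  have h1 : ∀ τ : ℕ → SpinConfig N, ((N : ℝ) ^ 2 * edgeOverlap τ s(1, 2) ^ 2
      - N) / 2 = graphQ2.value τ * (N ^ 2 / 2) - N / 2 := fun τ => by
    simp [graphQ2, OverlapGraph.value, edgeOverlap]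
    ring
  simp only [h1, repAvg_sub, repAvg_mul_right, repAvg_const, monAvg, verts_graphQ2]
  ring

theorem abs_gibbsAvg_feature_le (k : SKIndex N) (x : SKIndex N → ℝ) :
    |gibbsAvg (skFeature N) (skFeature N k) x| ≤ 1 :=
  abs_gibbsAvg_le _ (fun σ => (abs_skFeature k σ).le) x

theorem abs_variance_feature_le (k : SKIndex N) (x : SKIndex N → ℝ) :
    |gibbsAvg (skFeature N) (fun σ => skFeature N k σ * skFeature N k σ) x
      - gibbsAvg (skFeature N) (skFeature N k) x * gibbsAvg (skFeature N) (skFeature N k) x|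
      ≤ 1 := by
  have h := abs_le.1 (abs_gibbsAvg_feature_le k x)
  simp only [← sq, skFeature_sq, gibbsAvg_const]
  rw [abs_le]
  constructor <;> nlinarith

theorem continuous_variance_feature (k : SKIndex N) :
    Continuous fun x => gibbsAvg (skFeature N) (fun σ => skFeature N k σ * skFeature N k σ) x
      - gibbsAvg (skFeature N) (skFeature N k) x * gibbsAvg (skFeature N) (skFeature N k) x :=
  (continuous_gibbsAvg _ _).sub ((continuous_gibbsAvg _ _).mul (continuous_gibbsAvg _ _))

theorem gaussAvg_const_mul_one_sub {ι : Type*} [Fintype ι] {F : (ι → ℝ) → ℝ} (hF : Continuous F)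
    {A : ℝ} (hA : ∀ x, |F x| ≤ A) (r : ℝ) (c : ι → ℝ) :
    gaussAvg (fun x => r * (1 - F x)) c = r * (1 - gaussAvg F c) := by
  unfold gaussAvg
  rw [integral_const_mul, integral_sub (integrable_const _)
    (integrable_stdGauss_of_bdd (by fun_prop) fun g => hA _)]
  simp

/-- Both scales move at once, so that the derivatives in `t`, in `β²` and along the diagonal `t =
β²` are three instances of one formula. -/
theorem freeEnergy_hasDerivAt_path (hN : 1 ≤ N) {a b : ℝ → ℝ} {a' b' y : ℝ}
    (ha : HasDerivAt a a' y) (hb : HasDerivAt b b' y) :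
    HasDerivAt (fun y => gaussAvg (fun x => Real.log (linPart (skFeature N) x))
        (skScale N (a y) (b y)))
      (a y * a' * (N ^ 2 / 2 * (1 - gaussAvg (monAvg N graphQ2.verts graphQ2)
          (skScale N (a y) (b y))))
        + b y * b' * (N * (1 - gaussAvg (monAvg N graphQ.verts graphQ)
          (skScale N (a y) (b y))))) y := by
  have key := gaussAvg_skScale_hasDerivAt (hasGrad_log_linPart (skFeature N))
    (fun k => hasGrad_gibbsAvg (skFeature N) (skFeature N k)) continuous_variance_feature
    abs_gibbsAvg_feature_le abs_variance_feature_le ha hb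
  refine key.congr_deriv ?_
  simp only [sum_variance_inl hN, sum_variance_inr hN,
    gaussAvg_const_mul_one_sub (continuous_monAvg _ _) (abs_monAvg_le _ _)]

theorem freeEnergy_hasDerivAt_field (hN : 1 ≤ N) (β : ℝ) {t : ℝ} (ht : 0 < t) :
    HasDerivAt (fun t => freeEnergy N β t) (1 / 2 * (1 - graphAvg N β t graphQ)) t := by
  have hN' : (0 : ℝ) < N := by exact_mod_cast hN
  have h := freeEnergy_hasDerivAt_path hN (hasDerivAt_const t (β / √N))
    (sqrt_div_hasDerivAt ht hN)
  refine h.congr_deriv ?_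
  rw [sqrt_div_mul_deriv ht hN, graphAvg_eq, skPoint]
  field_simp
  ring

theorem freeEnergy_hasDerivAt_sq (hN : 1 ≤ N) (t : ℝ) {y : ℝ} (hy : 0 < y) :
    HasDerivAt (fun y => freeEnergy N (√y) t) (N / 4 * (1 - graphAvg N (√y) t graphQ2)) y := by
  have hN' : (0 : ℝ) < N := by exact_mod_cast hN
  have h := freeEnergy_hasDerivAt_path hN (sqrt_div_hasDerivAt hy hN)
    (hasDerivAt_const y (√(t / N)))
  have e : (fun y => freeEnergy N (√y) t) =ᶠ[𝓝 y] fun y => gaussAvg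
      (fun x => Real.log (linPart (skFeature N) x)) (skScale N (√(y / N)) (√(t / N))) := by
    filter_upwards [lt_mem_nhds hy] with z hz
    rw [freeEnergy, skPoint_sqrt hz.le]
  refine (h.congr_deriv ?_).congr_of_eventuallyEq e
  rw [sqrt_div_mul_deriv hy hN, graphAvg_eq, skPoint_sqrt hy.le]
  field_simp
  ring

theorem freeEnergy_hasDerivAt_diag (hN : 1 ≤ N) {y : ℝ} (hy : 0 < y) :
    HasDerivAt (fun y => freeEnergy N (√y) y) (N / 4 * (1 - graphAvg N (√y) y graphQ2)
      + 1 / 2 * (1 - graphAvg N (√y) y graphQ)) y := by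
  have hN' : (0 : ℝ) < N := by exact_mod_cast hN
  have h := freeEnergy_hasDerivAt_path hN (sqrt_div_hasDerivAt hy hN) (sqrt_div_hasDerivAt hy hN)
  have e : (fun y => freeEnergy N (√y) y) =ᶠ[𝓝 y] fun y => gaussAvg
      (fun x => Real.log (linPart (skFeature N) x)) (skScale N (√(y / N)) (√(y / N))) := by
    filter_upwards [lt_mem_nhds hy] with z hz
    rw [freeEnergy, skPoint_sqrt hz.le]
  refine (h.congr_deriv ?_).congr_of_eventuallyEq e
  rw [sqrt_div_mul_deriv hy hN, graphAvg_eq, graphAvg_eq, skPoint_sqrt hy.le]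
  field_simp
  ring

theorem abs_log_linPart_le (x : SKIndex N → ℝ) :
    |Real.log (linPart (skFeature N) x)|
      ≤ |Real.log (linPart (skFeature N) 0)| + 1 * ∑ k, |x k| :=
  (hasGrad_log_linPart (skFeature N)).comp_mul_abs_le abs_gibbsAvg_feature_le x

theorem continuous_log_linPart : Continuous fun x => Real.log (linPart (skFeature N) x) :=
  (hasGrad_log_linPart (skFeature N)).continuous

theorem integrable_log_linPart (c : SKIndex N → ℝ) :
    Integrable (fun g => Real.log (linPart (skFeature N) (c * g))) (stdGauss (SKIndex N)) := by
  have := continuous_log_linPart (N := N)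
  refine integrable_stdGauss_of_le (A := |Real.log (linPart (skFeature N) 0)|)
    (B := ∑ k, |c k|) (C := 0) (this.comp (continuous_const.mul continuous_id)) fun g => (abs_log_linPart_le _).trans ?_
  rw [one_mul, zero_mul, add_zero, Finset.sum_mul]
  gcongr with k _
  rw [Pi.mul_apply, abs_mul]
  exact mul_le_mul_of_nonneg_left (Finset.single_le_sum (f := fun k => |g k|)
    (fun _ _ => abs_nonneg _) (Finset.mem_univ k)) (abs_nonneg _)

theorem continuous_freeEnergy : Continuous fun p : ℝ × ℝ => freeEnergy N p.1 p.2 := by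
  have h : Continuous (gaussAvg fun x => Real.log (linPart (skFeature N) x)) :=
    continuous_iff_continuousAt.2 fun c =>
      (gaussAvg_hasFDerivAt (hasGrad_log_linPart (skFeature N))
        (fun k => continuous_gibbsAvg _ _) abs_gibbsAvg_feature_le c).continuousAt
  exact h.comp continuous_skPoint

theorem alphaSK_eq (β : ℝ) : alphaSK N β = 1 / N * freeEnergy N β 0 := by
  unfold alphaSK
  rw [disorder_integral]
  congr 1
  exact integral_congr_ae (ae_of_all _ fun g => congrArg Real.log (partitionFn_eq β 0 g))

theorem cavityFn_eq (β t : ℝ) : cavityFn N t β = freeEnergy N β t - freeEnergy N β 0 := by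
  unfold cavityFn freeEnergy gaussAvg
  rw [disorder_integral, ← integral_sub (integrable_log_linPart _) (integrable_log_linPart _)]
  refine integral_congr_ae (ae_of_all _ fun g => ?_)
  have e : ∀ t, partitionFn N β t (fun p => g (Sum.inl p), fun i => g (Sum.inr i))
    = linPart (skFeature N) (skPoint N β t * g) := fun t => partitionFn_eq β t g
  beta_reduce
  rw [e, e, Real.log_div (linPart_pos _ _).ne' (linPart_pos _ _).ne']

theorem alphaSK_hasDerivAt (hN : 1 ≤ N) {y : ℝ} (hy : 0 < y) :
    HasDerivAt (fun y => alphaSK N (√y)) (1 / 4 * (1 - graphAvg N (√y) 0 graphQ2)) y := by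
  have hN' : (0 : ℝ) < N := by exact_mod_cast hN
  simp only [alphaSK_eq]
  refine ((freeEnergy_hasDerivAt_sq hN 0 hy).const_mul (1 / (N : ℝ))).congr_deriv ?_
  field_simp

/-- The coefficients of the Hamiltonian. -/
noncomputable def hamCoeff (N : ℕ) : SKIndex N → ℝ := skScale N (1 / √N) 0

/-- Minus the Hamiltonian. -/
noncomputable def negHam (g : SKIndex N → ℝ) (σ : SpinConfig N) : ℝ :=
  ∑ k, hamCoeff N k * g k * skFeature N k σ

/-- `-E ω(H_N)`. -/
noncomputable def meanNegHam (N : ℕ) (β : ℝ) : ℝ :=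
  ∫ g, gibbsAvg (skFeature N) (negHam g) (skPoint N β 0 * g) ∂(stdGauss (SKIndex N))

theorem gibbsAvg_negHam (g x : SKIndex N → ℝ) :
    gibbsAvg (skFeature N) (negHam g) x
      = ∑ k, hamCoeff N k * (g k * gibbsAvg (skFeature N) (skFeature N k) x) := by
  unfold negHam
  rw [gibbsAvg_sum]
  refine Finset.sum_congr rfl fun k _ => ?_
  rw [gibbsAvg_const_mul, mul_assoc]

theorem integrable_mul_gibbsAvg_feature (k : SKIndex N) (c : SKIndex N → ℝ) :
    Integrable (fun g => g k * gibbsAvg (skFeature N) (skFeature N k) (c * g))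
      (stdGauss (SKIndex N)) := by
  have := continuous_gibbsAvg (skFeature N) (skFeature N k)
  refine (integrable_abs_stdGauss k).mono' (Continuous.aestronglyMeasurable (by fun_prop))
    (ae_of_all _ fun g => ?_)
  rw [Real.norm_eq_abs, abs_mul]
  exact mul_le_of_le_one_right (abs_nonneg _) (abs_gibbsAvg_feature_le _ _)

/-- Integration by parts in each coupling turns `g_k ω(s_k)` into a variance. The prefactor is `β /
N`: one `1/√N` from the Hamiltonian and `β/√N` from the weight. -/
theorem meanNegHam_eq (hN : 1 ≤ N) (β : ℝ) :
    meanNegHam N β = N * β / 2 * (1 - graphAvg N β 0 graphQ2) := by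
  have hN' : (0 : ℝ) < N := by exact_mod_cast hN
  unfold meanNegHam
  simp only [gibbsAvg_negHam]
  rw [integral_finsetSum _ fun k _ => (integrable_mul_gibbsAvg_feature k _).const_mul _]
  simp only [integral_const_mul]
  simp only [fun k => stdGauss_integral_mul (hasGrad_gibbsAvg (skFeature N) (skFeature N k)) k
    (continuous_variance_feature k) (abs_gibbsAvg_feature_le k) (abs_variance_feature_le k)
    (skPoint N β 0)]
  rw [Fintype.sum_sum_type]
  have h0 : ∀ i, hamCoeff N (Sum.inr i) = 0 := fun _ => rfl
  simp only [h0, zero_mul, Finset.sum_const_zero, add_zero]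
  have h1 := gaussAvg_const_mul_one_sub (continuous_monAvg graphQ2.verts graphQ2)
    (abs_monAvg_le (N := N) graphQ2.verts graphQ2) (N ^ 2 / 2) (skPoint N β 0)
  simp only [← sum_variance_inl hN] at h1
  have hint : ∀ k, Integrable (fun g =>
      gibbsAvg (skFeature N) (fun σ => skFeature N k σ * skFeature N k σ) (skPoint N β 0 * g)
      - gibbsAvg (skFeature N) (skFeature N k) (skPoint N β 0 * g)
        * gibbsAvg (skFeature N) (skFeature N k) (skPoint N β 0 * g)) (stdGauss (SKIndex N)) :=
    fun k => integrable_stdGauss_of_bdd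
      ((continuous_variance_feature k).comp (continuous_const.mul continuous_id))
      fun g => abs_variance_feature_le k (skPoint N β 0 * g)
  rw [gaussAvg, integral_finsetSum _ fun p _ => hint (Sum.inl p), ← graphAvg_eq] at h1
  have h2 : √(N : ℝ) * √N = N := Real.mul_self_sqrt hN'.le
  have h3 : 0 < √(N : ℝ) := Real.sqrt_pos.2 hN'
  have h4 : N * β / 2 * (1 - graphAvg N β 0 graphQ2)
      = β / N * (N ^ 2 / 2 * (1 - graphAvg N β 0 graphQ2)) := by field_simp
  rw [h4, ← h1, Finset.mul_sum, Finset.sum_filter]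
  refine Finset.sum_congr rfl fun p _ => ?_
  simp only [hamCoeff, skPoint, skScale]
  split_ifs
  · unfold gaussAvg
    rw [← mul_assoc, show 1 / √(N : ℝ) * (β / √N) = β / (√N * √N) by field_simp, h2]
  · ring

theorem internalEnergy_eq (β : ℝ) : internalEnergy N β = -(1 / N * meanNegHam N β) := by
  unfold internalEnergy meanNegHam
  rw [disorder_integral, ← mul_neg, ← integral_neg]
  congr 1
  refine integral_congr_ae (ae_of_all _ fun g => ?_)
  change ∑ σ, gibbs N β 0 (toDisorder g) σ * hamiltonian N (toDisorder g) σ = _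
  simp only [gibbs_eq, hamiltonian_eq, gibbsAvg, mul_neg, Finset.sum_neg_distrib]
  rfl

/-! ### Averages of graphs that are not filled -/

theorem overlap_neg_left (σ τ : SpinConfig N) : overlap (-σ) τ = -overlap σ τ := by
  simp [overlap, spin_neg]

theorem overlap_neg_right (σ τ : SpinConfig N) : overlap σ (-τ) = -overlap σ τ := by
  rw [overlap_comm, overlap_neg_left, overlap_comm]

/-- The number of line ends at a replica. -/
def OverlapGraph.degree (G : OverlapGraph) (a : ℕ) : ℕ := (G.bind Sym2.toMultiset).count a

theorem OverlapGraph.degree_cons (x y : ℕ) (G : OverlapGraph) (a : ℕ) :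
    OverlapGraph.degree (s(x, y) ::ₘ G) a
      = (if a = x then 1 else 0) + (if a = y then 1 else 0) + G.degree a := by
  unfold OverlapGraph.degree
  rw [Multiset.cons_bind, Multiset.count_add]
  congr 1
  change Multiset.count a {x, y} = _
  simp [Multiset.count_cons, Multiset.count_singleton, add_comm]

theorem OverlapGraph.degree_zero (a : ℕ) : OverlapGraph.degree 0 a = 0 := by
  simp [OverlapGraph.degree]

theorem value_update_neg (G : OverlapGraph) (τ : ℕ → SpinConfig N) (a : ℕ) (σ : SpinConfig N) :
    G.value (Function.update τ a (-σ)) = (-1) ^ G.degree a * G.value (Function.update τ a σ) := by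
  induction G using Multiset.induction_on with
  | empty => simp [value_zero, OverlapGraph.degree_zero]
  | cons e G ih =>
    induction e using Sym2.ind with
    | _ x y =>
      rw [value_cons, value_cons, OverlapGraph.degree_cons, ih]
      by_cases hx : x = a
      · by_cases hy : y = a
        · subst hx; subst hy
          simp [edgeOverlap, overlap_neg_left, overlap_neg_right, pow_add]
          ring
        · subst hx
          simp [edgeOverlap, overlap_neg_left, pow_add, Function.update_of_ne hy, Ne.symm hy]
          ring
      · by_cases hy : y = a
        · subst hy
          simp [edgeOverlap, overlap_neg_right, pow_add, Function.update_of_ne hx, Ne.symm hx]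
          ring
        · simp [edgeOverlap, Function.update_of_ne hx, Function.update_of_ne hy, Ne.symm hx,
            Ne.symm hy]
          ring

theorem mem_verts_of_degree {G : OverlapGraph} {a : ℕ} (h : G.degree a ≠ 0) : a ∈ G.verts := by
  unfold OverlapGraph.verts
  rw [Multiset.mem_toFinset]
  exact Multiset.count_ne_zero.1 h

theorem linGibbs_neg {x : SKIndex N → ℝ} (hx : ∀ i, x (Sum.inr i) = 0) (σ : SpinConfig N) :
    linGibbs (skFeature N) x (-σ) = linGibbs (skFeature N) x σ := by
  unfold linGibbs linWeight
  rw [Fintype.sum_sum_type, Fintype.sum_sum_type]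
  simp [hx, skFeature, spin_neg]

/-- Without cavity fields the Gibbs measure is invariant under a global flip of a single replica,
while flipping a replica of odd degree changes the sign of the monomial. -/
theorem monAvg_eq_zero {G : OverlapGraph} (hG : ¬ G.Filled) {x : SKIndex N → ℝ}
    (hx : ∀ i, x (Sum.inr i) = 0) : monAvg N G.verts G x = 0 := by
  obtain ⟨a, ha⟩ : ∃ a, ¬ Even (G.degree a) := not_forall.1 hG
  have hodd := Nat.not_even_iff_odd.1 ha
  have hav : a ∈ G.verts := mem_verts_of_degree hodd.pos.ne'
  have h1 := repAvg_insert (skFeature N) (Finset.notMem_erase a G.verts)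
    (fun τ : ℕ → SpinConfig N => G.value τ) x
  rw [Finset.insert_erase hav] at h1
  have h2 : ∑ σ, linGibbs (skFeature N) x σ * repAvg (skFeature N) (G.verts.erase a)
        (fun τ => G.value (Function.update τ a σ)) x
      = ∑ σ, linGibbs (skFeature N) x (-σ) * repAvg (skFeature N) (G.verts.erase a)
        (fun τ => G.value (Function.update τ a (-σ))) x :=
    (Equiv.sum_comp (Equiv.neg (SpinConfig N)) fun σ => linGibbs (skFeature N) x σ *
      repAvg (skFeature N) (G.verts.erase a) (fun τ => G.value (Function.update τ a σ)) x).symm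
  have h3 : ∀ σ, repAvg (skFeature N) (G.verts.erase a)
        (fun τ => G.value (Function.update τ a (-σ))) x
      = repAvg (skFeature N) (G.verts.erase a)
        (fun τ => G.value (Function.update τ a σ)) x * (-1) := by
    intro σ
    rw [← repAvg_mul_right]
    congr 1
    funext τ
    rw [value_update_neg, hodd.neg_one_pow]
    ring
  simp only [linGibbs_neg hx, h3] at h2
  simp only [mul_neg, mul_one, Finset.sum_neg_distrib] at h2
  unfold monAvg
  rw [h1]
  linarith

theorem graphAvg_eq_zero (β : ℝ) {G : OverlapGraph} (hG : ¬ G.Filled) :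
    graphAvg N β 0 G = 0 := by
  rw [graphAvg_eq, gaussAvg]
  have : ∀ g : SKIndex N → ℝ, monAvg N G.verts G (skPoint N β 0 * g) = 0 := fun g =>
    monAvg_eq_zero hG fun i => by simp [skPoint, skScale]
  simp [this]

end SK

/-! ### Combinatorics of overlap graphs -/

namespace OverlapGraph

theorem filled_iff (G : OverlapGraph) : G.Filled ↔ ∀ a ∈ G.verts, Even (G.degree a) := by
  refine ⟨fun h a _ => h a, fun h a => ?_⟩
  by_cases ha : a ∈ G.verts
  · exact h a ha
  · have : G.degree a = 0 := by
      by_contra h0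
      exact ha (mem_verts_of_degree h0)
    change Even (G.degree a)
    simp [this]

/-- Only the finitely many replicas of the graph have to be inspected, so concrete graphs can be
settled by `decide`. -/
instance (G : OverlapGraph) : Decidable G.Filled := decidable_of_iff _ (filled_iff G).symm

theorem relabel_cons (π : Equiv.Perm ℕ) (e : Sym2 ℕ) (G : OverlapGraph) :
    relabel π (e ::ₘ G) = Sym2.map π e ::ₘ relabel π G :=
  Multiset.map_cons _ _ _

theorem card_relabel (π : Equiv.Perm ℕ) (G : OverlapGraph) :
    Multiset.card (G.relabel π) = Multiset.card G :=
  Multiset.card_map _ _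

theorem verts_relabel (π : Equiv.Perm ℕ) (G : OverlapGraph) :
    (G.relabel π).verts = G.verts.image π := by
  ext a
  rw [Finset.mem_image]
  constructor
  · intro h
    refine ⟨π.symm a, ?_, π.apply_symm_apply a⟩
    rw [← mem_verts_relabel π, π.apply_symm_apply]
    exact h
  · rintro ⟨b, hb, rfl⟩
    exact (mem_verts_relabel π b).2 hb

theorem card_verts_relabel (π : Equiv.Perm ℕ) (G : OverlapGraph) :
    (G.relabel π).verts.card = G.verts.card := by
  rw [verts_relabel, Finset.card_image_of_injective _ π.injective]

theorem degree_relabel (π : Equiv.Perm ℕ) (G : OverlapGraph) (a : ℕ) :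
    (G.relabel π).degree (π a) = G.degree a := by
  induction G using Multiset.induction_on with
  | empty => simp [relabel, degree_zero]
  | cons e G ih =>
    induction e using Sym2.ind with
    | _ x y =>
      rw [relabel_cons, Sym2.map_mk, degree_cons, degree_cons, ih]
      simp

theorem filled_relabel (π : Equiv.Perm ℕ) (G : OverlapGraph) :
    (G.relabel π).Filled ↔ G.Filled := by
  constructor
  · intro h a
    have := h (π a)
    change Even ((G.relabel π).degree (π a)) at this
    rwa [degree_relabel] at this
  · intro h a
    change Even ((G.relabel π).degree a)
    rw [← π.apply_symm_apply a, degree_relabel]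
    exact h _

theorem nodup_relabel (π : Equiv.Perm ℕ) (G : OverlapGraph) :
    (G.relabel π).Nodup ↔ G.Nodup :=
  Multiset.nodup_map_iff_of_injective (Sym2.map.injective π.injective)

theorem relabel_congr {π ρ : Equiv.Perm ℕ} {G : OverlapGraph} (h : ∀ a ∈ G.verts, π a = ρ a) :
    G.relabel π = G.relabel ρ := by
  refine Multiset.map_congr rfl fun e he => ?_
  induction e using Sym2.ind with
  | _ x y =>
    rw [Sym2.map_mk, Sym2.map_mk, h x (mem_verts.2 ⟨_, he, by simp⟩),
      h y (mem_verts.2 ⟨_, he, by simp⟩)]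

theorem filled_cons_cons (e : Sym2 ℕ) {G : OverlapGraph} (hG : G.Filled) :
    Filled (e ::ₘ e ::ₘ G) := by
  intro a
  change Even (degree _ a)
  induction e using Sym2.ind with
  | _ x y =>
    rw [degree_cons, degree_cons, ← add_assoc]
    exact (Even.add_self _).add (hG a)

end OverlapGraph

open OverlapGraph

/-- A function of graphs that does not depend on the names of the replicas agrees on equivalent
graphs. -/
theorem ReplicaSymmetric.eq_of_relabel {m : OverlapGraph → ℝ} (hm : ReplicaSymmetric m)
    {G G' : OverlapGraph} (π : Equiv.Perm ℕ) (h : G.relabel π = G') : m G = m G' := by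
  rw [← h, hm]

/-- The condition `a < b` refers to the names of the replicas and is destroyed by a renaming; the
full double sum is not. -/
theorem two_nsmul_sum_lt {M : Type*} [AddCommGroup M] (V : Finset ℕ) (f : Sym2 ℕ → M) :
    2 • (∑ a ∈ V, ∑ b ∈ V with a < b, f s(a, b))
      = (∑ a ∈ V, ∑ b ∈ V, f s(a, b)) - ∑ a ∈ V, f s(a, a) := by
  rw [Finset.sum_sum_eq_lt V fun a b => f s(a, b), add_sub_cancel_right, two_nsmul]
  congr 1
  exact Finset.sum_congr rfl fun a _ => Finset.sum_congr rfl fun b _ => by rw [Sym2.eq_swap]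

/-- Renaming the replicas in a streaming sum. -/
theorem streamSum_image {M : Type*} [AddCommGroup M] [Module ℝ M] (V : Finset ℕ)
    (ρ : Equiv.Perm ℕ) (h1 : ρ (V.sup id + 1) = (V.image ρ).sup id + 1)
    (h2 : ρ (V.sup id + 2) = (V.image ρ).sup id + 2) (f : Sym2 ℕ → M) :
    streamSum (V.image ρ) f = streamSum V fun e => f (Sym2.map ρ e) := by
  have hinj : ∀ g : ℕ → M, ∑ a ∈ V.image ρ, g a = ∑ a ∈ V, g (ρ a) := fun g =>
    Finset.sum_image fun a _ b _ h => ρ.injective h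
  have h3 : (∑ a ∈ V.image ρ, ∑ b ∈ V.image ρ with a < b, f s(a, b))
      = ∑ a ∈ V, ∑ b ∈ V with a < b, f (Sym2.map ρ s(a, b)) := by
    have e1 := two_nsmul_sum_lt (V.image ρ) f
    have e2 := two_nsmul_sum_lt V fun e => f (Sym2.map ρ e)
    rw [hinj fun a => ∑ b ∈ V.image ρ, f s(a, b), hinj fun a => f s(a, a)] at e1
    simp only [hinj fun b => f s(ρ _, b)] at e1
    simp only [Sym2.map_mk] at e2
    have h : (2 : ℝ) • (∑ a ∈ V.image ρ, ∑ b ∈ V.image ρ with a < b, f s(a, b))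
        = (2 : ℝ) • ∑ a ∈ V, ∑ b ∈ V with a < b, f (Sym2.map ρ s(a, b)) := by
      simp only [two_smul, Sym2.map_mk]
      rw [two_nsmul] at e1 e2
      rw [e1, e2]
    exact smul_right_injective M (two_ne_zero' ℝ) h
  unfold streamSum
  rw [h3, hinj, Finset.card_image_of_injective _ ρ.injective]
  simp only [Sym2.map_mk, h1, h2]

/-- A renaming of the replicas of `V` extends to one that respects the additional replicas of the
streaming sum. -/
theorem exists_perm_extend (π : Equiv.Perm ℕ) (V : Finset ℕ) :
    ∃ ρ : Equiv.Perm ℕ, (∀ a ∈ V, ρ a = π a) ∧ ρ (V.sup id + 1) = (V.image π).sup id + 1 ∧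
      ρ (V.sup id + 2) = (V.image π).sup id + 2 := by
  set u := V.sup id + 1
  set v := V.sup id + 2
  set u' := (V.image π).sup id + 1
  set v' := (V.image π).sup id + 2
  have hu : ∀ a ∈ V, a ≠ u := fun a ha h => by have := le_sup_id ha; omega
  have hv : ∀ a ∈ V, a ≠ v := fun a ha h => by have := le_sup_id ha; omega
  have hu' : ∀ a ∈ V, π a ≠ u' := fun a ha h => by
    have := le_sup_id (Finset.mem_image_of_mem π ha); omega
  have hv' : ∀ a ∈ V, π a ≠ v' := fun a ha h => by
    have := le_sup_id (Finset.mem_image_of_mem π ha); omega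
  -- A swap moves the image of `u` to `u'`, and a second one moves that of `v` to `v'`. Neither
  -- touches the images of `V`, and the second leaves `u'` in place.
  set ρ₁ : Equiv.Perm ℕ := Equiv.swap (π u) u' * π
  have h1 : ∀ a ∈ V, ρ₁ a = π a := fun a ha =>
    Equiv.swap_apply_of_ne_of_ne (fun h => hu a ha (π.injective h)) (hu' a ha)
  have h2 : ρ₁ u = u' := Equiv.swap_apply_left _ _
  refine ⟨Equiv.swap (ρ₁ v) v' * ρ₁, fun a ha => ?_, ?_, Equiv.swap_apply_left _ _⟩
  · rw [Equiv.Perm.mul_apply, Equiv.swap_apply_of_ne_of_ne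
      (fun h => hv a ha (ρ₁.injective h)), h1 a ha]
    rw [h1 a ha]
    exact hv' a ha
  · rw [Equiv.Perm.mul_apply, Equiv.swap_apply_of_ne_of_ne
      (fun h => absurd (ρ₁.injective h) (by omega)), h2]
    rw [h2]
    omega

/-- The additional replicas `sup + 1` and `sup + 2` are not carried along by `π`. Hence `π` is
replaced by a permutation that agrees with it on the graph and moves them correctly. -/
theorem bracket_relabel {m : OverlapGraph → ℝ} (hm : ReplicaSymmetric m) (π : Equiv.Perm ℕ)
    (G : OverlapGraph) : bracket m (G.relabel π) = bracket m G := by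
  obtain ⟨ρ, h1, h2, h3⟩ := exists_perm_extend π G.verts
  have hG : G.relabel π = G.relabel ρ := relabel_congr fun a ha => (h1 a ha).symm
  have hV : G.verts.image π = G.verts.image ρ :=
    Finset.image_congr fun a ha => (h1 a ha).symm
  rw [hV] at h2 h3
  unfold bracket
  rw [hG, verts_relabel, streamSum_image _ ρ h2 h3]
  simp only [← relabel_cons, hm ρ]

/-- The definition of `thermoConstraint` uses arbitrary representatives of the classes; for a
symmetric functional the choice is immaterial. -/
theorem bracket_out {m : OverlapGraph → ℝ} (hm : ReplicaSymmetric m) (G : OverlapGraph) :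
    bracket m (⟦G⟧ : GraphClass).out = bracket m G := by
  obtain ⟨π, hπ⟩ := Quotient.mk_out (s := OverlapGraph.setoid) G
  conv_rhs => rw [← hπ]
  exact (bracket_relabel hm π _).symm

/-! ### The coefficients of the expansion -/

theorem streamCoeff_zero_of_filled {G : OverlapGraph} (h : G.Filled) :
    streamCoeff 0 G = Finsupp.single ⟦G⟧ 1 := by
  rw [streamCoeff, if_pos h]

theorem streamCoeff_zero_of_not_filled {G : OverlapGraph} (h : ¬ G.Filled) :
    streamCoeff 0 G = 0 := by
  rw [streamCoeff, if_neg h]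

theorem streamCoeff_succ_of_filled (n : ℕ) {G : OverlapGraph} (h : G.Filled) :
    streamCoeff (n + 1) G = 0 := by
  rw [streamCoeff, if_pos h]

theorem streamCoeff_succ_of_not_filled (n : ℕ) {G : OverlapGraph} (h : ¬ G.Filled) :
    streamCoeff (n + 1) G
      = (1 / ((n : ℝ) + 1)) • streamSum G.verts fun e => streamCoeff n (e ::ₘ G) := by
  rw [streamCoeff, if_neg h]

theorem streamSum_zero {M : Type*} [AddCommGroup M] [Module ℝ M] (V : Finset ℕ) :
    streamSum V (fun _ => (0 : M)) = 0 := by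
  simp [streamSum]

/-- The graphs that appear in the expansion are filled and have the right number of lines. -/
theorem streamCoeff_apply_ne_zero (n : ℕ) (G H : OverlapGraph) (h : streamCoeff n G ⟦H⟧ ≠ 0) :
    H.Filled ∧ Multiset.card H = Multiset.card G + n := by
  classical
  induction n generalizing G with
  | zero =>
    by_cases hG : G.Filled
    · rw [streamCoeff_zero_of_filled hG, Finsupp.single_apply] at h
      split_ifs at h with h1
      · obtain ⟨π, hπ⟩ := Quotient.exact h1
        rw [← hπ, filled_relabel, card_relabel]
        exact ⟨hG, rfl⟩
      · exact absurd rfl h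
    · rw [streamCoeff_zero_of_not_filled hG] at h
      exact absurd rfl h
  | succ n ih =>
    by_cases hG : G.Filled
    · rw [streamCoeff_succ_of_filled n hG] at h
      exact absurd rfl h
    · by_contra hc
      refine h ?_
      rw [streamCoeff_succ_of_not_filled n hG, Finsupp.smul_apply]
      have h1 := map_streamSum (Finsupp.lapply (R := ℝ) (⟦H⟧ : GraphClass)) G.verts
        fun e => streamCoeff n (e ::ₘ G)
      rw [Finsupp.lapply_apply] at h1
      rw [h1]
      have h2 : ∀ e, Finsupp.lapply (R := ℝ) (⟦H⟧ : GraphClass) (streamCoeff n (e ::ₘ G)) = 0 := by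
        intro e
        by_contra h3
        refine hc ?_
        have := ih (e ::ₘ G) h3
        rw [Multiset.card_cons] at this
        exact ⟨this.1, by omega⟩
      simp only [h2, streamSum_zero, smul_zero]

/-- A line changes the parity of two replicas only. -/
theorem streamCoeff_eq_zero_of_odd (n : ℕ) (G : OverlapGraph) (O : Finset ℕ)
    (hO : ∀ a ∈ O, Odd (G.degree a)) (h : 2 * n < O.card) : streamCoeff n G = 0 := by
  have hG : ¬ G.Filled := by
    obtain ⟨a, ha⟩ := Finset.card_pos.1 (Nat.zero_le _ |>.trans_lt h)
    exact fun hf => Nat.not_even_iff_odd.2 (hO a ha) (hf a)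
  induction n generalizing G O with
  | zero => exact streamCoeff_zero_of_not_filled hG
  | succ n ih =>
    rw [streamCoeff_succ_of_not_filled n hG]
    have h1 : ∀ e, streamCoeff n (e ::ₘ G) = 0 := by
      intro e
      induction e using Sym2.ind with
      | _ x y =>
        have h2 : ∀ a ∈ (O.erase x).erase y, Odd (degree (s(x, y) ::ₘ G) a) := by
          intro a ha
          simp only [Finset.mem_erase] at ha
          rw [degree_cons, if_neg ha.2.1, if_neg ha.1, zero_add, zero_add]
          exact hO a ha.2.2
        have h3 : 2 * n < ((O.erase x).erase y).card := by
          have := Finset.pred_card_le_card_erase (s := O) (a := x)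
          have := Finset.pred_card_le_card_erase (s := O.erase x) (a := y)
          omega
        refine ih _ _ h2 h3 ?_
        obtain ⟨a, ha⟩ := Finset.card_pos.1 (Nat.zero_le _ |>.trans_lt h3)
        exact fun hf => Nat.not_even_iff_odd.2 (h2 a ha) (hf a)
    simp only [h1, streamSum_zero, smul_zero]

theorem streamSum_eq_single {M : Type*} [AddCommGroup M] [Module ℝ M] {V : Finset ℕ}
    {f : Sym2 ℕ → M} {p q : ℕ} (hp : p ∈ V) (hq : q ∈ V) (hpq : p < q)
    (h : ∀ a b, a ≠ b → s(a, b) ≠ s(p, q) → f s(a, b) = 0) : streamSum V f = f s(p, q) := by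
  have hpu := le_sup_id hp
  have hqu := le_sup_id hq
  have h1 : ∑ a ∈ V, ∑ b ∈ V with a < b, f s(a, b) = f s(p, q) := by
    rw [Finset.sum_eq_single_of_mem p hp, Finset.sum_eq_single_of_mem q (by simp [hq, hpq])]
    · intro b hb hbq
      rw [Finset.mem_filter] at hb
      refine h _ _ hb.2.ne fun he => hbq ?_
      rw [Sym2.eq_iff] at he
      omega
    · intro a ha hap
      refine Finset.sum_eq_zero fun b hb => ?_
      rw [Finset.mem_filter] at hb
      refine h _ _ hb.2.ne fun he => ?_
      rw [Sym2.eq_iff] at he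
      omega
  have h2 : ∑ a ∈ V, f s(a, V.sup id + 1) = 0 := by
    refine Finset.sum_eq_zero fun a ha => h _ _ (by have := le_sup_id ha; omega) fun he => ?_
    rw [Sym2.eq_iff] at he
    omega
  have h3 : f s(V.sup id + 1, V.sup id + 2) = 0 := by
    refine h _ _ (by omega) fun he => ?_
    rw [Sym2.eq_iff] at he
    omega
  rw [streamSum, h1, h2, h3]
  simp

/-- A graph with two replicas of odd degree is completed by the line that joins them. -/
theorem streamCoeff_one_of_two_odd {G : OverlapGraph} {p q : ℕ} (hpq : p < q)
    (hG : ∀ a ∈ G.verts, Odd (G.degree a) ↔ a = p ∨ a = q)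
    (hp : p ∈ G.verts) (hq : q ∈ G.verts) :
    streamCoeff 1 G = Finsupp.single ⟦s(p, q) ::ₘ G⟧ 1 := by
  have hodd : ∀ a, Odd (G.degree a) ↔ a = p ∨ a = q := by
    intro a
    by_cases ha : a ∈ G.verts
    · exact hG a ha
    · have h0 : G.degree a = 0 := by
        by_contra h0
        exact ha (mem_verts_of_degree h0)
      rw [h0]
      constructor
      · intro h; simp at h
      · rintro (rfl | rfl)
        · exact absurd hp ha
        · exact absurd hq ha
  have hnf : ¬ G.Filled := fun hf => Nat.not_even_iff_odd.2 ((hodd p).2 (Or.inl rfl)) (hf p)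
  rw [streamCoeff_succ_of_not_filled 0 hnf, streamSum_eq_single hp hq hpq]
  · rw [streamCoeff_zero_of_filled]
    · simp
    · intro a
      change Even (degree _ a)
      have := hodd a
      rw [degree_cons]
      by_cases ha : a = p
      · subst ha
        rw [if_pos rfl, if_neg hpq.ne, add_zero, add_comm, Nat.even_add_one, Nat.not_even_iff_odd]
        exact this.2 (Or.inl rfl)
      · by_cases ha' : a = q
        · subst ha'
          rw [if_pos rfl, if_neg ha, zero_add, add_comm, Nat.even_add_one, Nat.not_even_iff_odd]
          exact this.2 (Or.inr rfl)
        · rw [if_neg ha, if_neg ha', zero_add, zero_add, ← Nat.not_odd_iff_even, this]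
          tauto
  · intro a b hab hne
    refine streamCoeff_zero_of_not_filled fun hf => hne ?_
    -- If the line `s(a, b)` fills the graph, its ends are exactly the replicas of odd degree, that
    -- is `p` and `q`.
    have hodd' : ∀ c, Odd (G.degree c) ↔ c = a ∨ c = b := by
      intro c
      have h1 : Even (degree (s(a, b) ::ₘ G) c) := hf c
      rw [degree_cons] at h1
      by_cases hca : c = a
      · subst hca
        rw [if_pos rfl, if_neg hab, add_zero, add_comm, Nat.even_add_one,
          Nat.not_even_iff_odd] at h1
        exact ⟨fun _ => Or.inl rfl, fun _ => h1⟩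
      · by_cases hcb : c = b
        · subst hcb
          rw [if_pos rfl, if_neg hca, zero_add, add_comm, Nat.even_add_one,
            Nat.not_even_iff_odd] at h1
          exact ⟨fun _ => Or.inr rfl, fun _ => h1⟩
        · rw [if_neg hca, if_neg hcb, zero_add, zero_add, ← Nat.not_odd_iff_even] at h1
          tauto
    have ha := (hodd a).1 ((hodd' a).2 (Or.inl rfl))
    have hb := (hodd b).1 ((hodd' b).2 (Or.inr rfl))
    rw [Sym2.eq_iff]
    omega

/-! ### The coefficients of the expansion through fourth order -/

section Explicit

variable {M : Type*} [AddCommGroup M] [Module ℝ M]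

theorem streamSum_two (f : Sym2 ℕ → M) :
    streamSum {1, 2} f = f s(1, 2) - (2 : ℝ) • (f s(1, 3) + f s(2, 3)) + (3 : ℝ) • f s(3, 4) := by
  norm_num [streamSum, Finset.sum_filter, Finset.sum_insert, Finset.sup_insert]

theorem streamSum_three (f : Sym2 ℕ → M) :
    streamSum {1, 2, 3} f = (f s(1, 2) + f s(1, 3) + f s(2, 3))
      - (3 : ℝ) • (f s(1, 4) + f s(2, 4) + f s(3, 4)) + (6 : ℝ) • f s(4, 5) := by
  norm_num [streamSum, Finset.sum_filter, Finset.sum_insert, Finset.sup_insert, add_assoc]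

theorem streamSum_four (f : Sym2 ℕ → M) :
    streamSum {1, 2, 3, 4} f
      = (f s(1, 2) + f s(1, 3) + f s(1, 4) + f s(2, 3) + f s(2, 4) + f s(3, 4))
      - (4 : ℝ) • (f s(1, 5) + f s(2, 5) + f s(3, 5) + f s(4, 5)) + (10 : ℝ) • f s(5, 6) := by
  norm_num [streamSum, Finset.sum_filter, Finset.sum_insert, Finset.sup_insert, add_assoc]

end Explicit

theorem streamCoeff_zero_graphQ : streamCoeff 0 graphQ = 0 :=
  streamCoeff_zero_of_not_filled (by decide)

theorem streamCoeff_one_graphQ : streamCoeff 1 graphQ = Finsupp.single ⟦graphQ2⟧ 1 :=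
  streamCoeff_one_of_two_odd (p := 1) (q := 2) (by decide) (by decide) (by decide) (by decide)

theorem class_eq {G H : OverlapGraph} (π : Equiv.Perm ℕ) (h : G.relabel π = H) :
    (⟦G⟧ : GraphClass) = ⟦H⟧ :=
  Quotient.sound ⟨π, h⟩

theorem streamCoeff_two_graphQ :
    streamCoeff 2 graphQ = (-2 : ℝ) • Finsupp.single ⟦graphTri⟧ 1 := by
  rw [streamCoeff_succ_of_not_filled 1 (by decide), verts_graphQ, streamSum_two]
  have h1 : streamCoeff 1 (s(1, 2) ::ₘ graphQ) = 0 :=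
    streamCoeff_succ_of_filled 0 (by decide)
  have h2 : streamCoeff 1 (s(3, 4) ::ₘ graphQ) = 0 :=
    streamCoeff_eq_zero_of_odd _ _ {1, 2, 3, 4} (by decide) (by decide)
  have h3 : streamCoeff 1 (s(1, 3) ::ₘ graphQ) = Finsupp.single ⟦graphTri⟧ 1 := by
    rw [streamCoeff_one_of_two_odd (p := 2) (q := 3) (by decide) (by decide) (by decide)
      (by decide), class_eq 1 (H := graphTri) (by decide)]
  have h4 : streamCoeff 1 (s(2, 3) ::ₘ graphQ) = Finsupp.single ⟦graphTri⟧ 1 := by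
    rw [streamCoeff_one_of_two_odd (p := 1) (q := 3) (by decide) (by decide) (by decide)
      (by decide), class_eq 1 (H := graphTri) (by decide)]
  rw [h1, h2, h3, h4]
  push_cast
  module

/-- Doubling either line of the path gives `graphA`, and joining an end to a new replica gives the
four-cycle. Closing the triangle fills the graph too early; the other lines leave four odd replicas.
-/
theorem streamCoeff_two_path₁ : streamCoeff 2 (s(1, 3) ::ₘ graphQ)
    = Finsupp.single ⟦graphA⟧ 1 - (3 : ℝ) • Finsupp.single ⟦graphC⟧ 1 := by
  rw [streamCoeff_succ_of_not_filled 1 (by decide),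
    show verts (s(1, 3) ::ₘ graphQ) = {1, 2, 3} by decide, streamSum_three]
  have h12 : streamCoeff 1 (s(1, 2) ::ₘ s(1, 3) ::ₘ graphQ) = Finsupp.single ⟦graphA⟧ 1 := by
    rw [streamCoeff_one_of_two_odd (p := 1) (q := 3) (by decide) (by decide) (by decide)
      (by decide), class_eq (Equiv.swap 1 2) (H := graphA) (by decide)]
  have h13 : streamCoeff 1 (s(1, 3) ::ₘ s(1, 3) ::ₘ graphQ) = Finsupp.single ⟦graphA⟧ 1 := by
    rw [streamCoeff_one_of_two_odd (p := 1) (q := 2) (by decide) (by decide) (by decide)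
      (by decide), class_eq (Equiv.swap 1 2) (H := graphA) (by decide)]
  have h23 : streamCoeff 1 (s(2, 3) ::ₘ s(1, 3) ::ₘ graphQ) = 0 :=
    streamCoeff_succ_of_filled 0 (by decide)
  have h14 : streamCoeff 1 (s(1, 4) ::ₘ s(1, 3) ::ₘ graphQ) = 0 :=
    streamCoeff_eq_zero_of_odd _ _ {1, 2, 3, 4} (by decide) (by decide)
  have h24 : streamCoeff 1 (s(2, 4) ::ₘ s(1, 3) ::ₘ graphQ) = Finsupp.single ⟦graphC⟧ 1 := by
    rw [streamCoeff_one_of_two_odd (p := 3) (q := 4) (by decide) (by decide) (by decide)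
      (by decide), class_eq (Equiv.swap 1 2) (H := graphC) (by decide)]
  have h34 : streamCoeff 1 (s(3, 4) ::ₘ s(1, 3) ::ₘ graphQ) = Finsupp.single ⟦graphC⟧ 1 := by
    rw [streamCoeff_one_of_two_odd (p := 2) (q := 4) (by decide) (by decide) (by decide)
      (by decide), class_eq (Equiv.swap 1 2) (H := graphC) (by decide)]
  have h45 : streamCoeff 1 (s(4, 5) ::ₘ s(1, 3) ::ₘ graphQ) = 0 :=
    streamCoeff_eq_zero_of_odd _ _ {2, 3, 4, 5} (by decide) (by decide)
  rw [h12, h13, h23, h14, h24, h34, h45]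
  push_cast
  module

theorem streamCoeff_two_path₂ : streamCoeff 2 (s(2, 3) ::ₘ graphQ)
    = Finsupp.single ⟦graphA⟧ 1 - (3 : ℝ) • Finsupp.single ⟦graphC⟧ 1 := by
  rw [streamCoeff_succ_of_not_filled 1 (by decide),
    show verts (s(2, 3) ::ₘ graphQ) = {1, 2, 3} by decide, streamSum_three]
  have h12 : streamCoeff 1 (s(1, 2) ::ₘ s(2, 3) ::ₘ graphQ) = Finsupp.single ⟦graphA⟧ 1 := by
    rw [streamCoeff_one_of_two_odd (p := 2) (q := 3) (by decide) (by decide) (by decide)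
      (by decide), class_eq 1 (H := graphA) (by decide)]
  have h23 : streamCoeff 1 (s(2, 3) ::ₘ s(2, 3) ::ₘ graphQ) = Finsupp.single ⟦graphA⟧ 1 := by
    rw [streamCoeff_one_of_two_odd (p := 1) (q := 2) (by decide) (by decide) (by decide)
      (by decide), class_eq 1 (H := graphA) (by decide)]
  have h13 : streamCoeff 1 (s(1, 3) ::ₘ s(2, 3) ::ₘ graphQ) = 0 :=
    streamCoeff_succ_of_filled 0 (by decide)
  have h24 : streamCoeff 1 (s(2, 4) ::ₘ s(2, 3) ::ₘ graphQ) = 0 :=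
    streamCoeff_eq_zero_of_odd _ _ {1, 2, 3, 4} (by decide) (by decide)
  have h14 : streamCoeff 1 (s(1, 4) ::ₘ s(2, 3) ::ₘ graphQ) = Finsupp.single ⟦graphC⟧ 1 := by
    rw [streamCoeff_one_of_two_odd (p := 3) (q := 4) (by decide) (by decide) (by decide)
      (by decide), class_eq 1 (H := graphC) (by decide)]
  have h34 : streamCoeff 1 (s(3, 4) ::ₘ s(2, 3) ::ₘ graphQ) = Finsupp.single ⟦graphC⟧ 1 := by
    rw [streamCoeff_one_of_two_odd (p := 1) (q := 4) (by decide) (by decide) (by decide)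
      (by decide), class_eq 1 (H := graphC) (by decide)]
  have h45 : streamCoeff 1 (s(4, 5) ::ₘ s(2, 3) ::ₘ graphQ) = 0 :=
    streamCoeff_eq_zero_of_odd _ _ {1, 3, 4, 5} (by decide) (by decide)
  rw [h12, h13, h23, h14, h24, h34, h45]
  push_cast
  module

/-- Doubling either of the two disjoint lines gives `graphB`, and each of the four lines joining
them gives the four-cycle. A line to a new replica leaves at least four odd replicas. -/
theorem streamCoeff_two_pair : streamCoeff 2 (s(3, 4) ::ₘ graphQ)
    = Finsupp.single ⟦graphB⟧ 1 + (2 : ℝ) • Finsupp.single ⟦graphC⟧ 1 := by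
  rw [streamCoeff_succ_of_not_filled 1 (by decide),
    show verts (s(3, 4) ::ₘ graphQ) = {1, 2, 3, 4} by decide, streamSum_four]
  have h12 : streamCoeff 1 (s(1, 2) ::ₘ s(3, 4) ::ₘ graphQ) = Finsupp.single ⟦graphB⟧ 1 := by
    rw [streamCoeff_one_of_two_odd (p := 3) (q := 4) (by decide) (by decide) (by decide)
      (by decide), class_eq 1 (H := graphB) (by decide)]
  have h34 : streamCoeff 1 (s(3, 4) ::ₘ s(3, 4) ::ₘ graphQ) = Finsupp.single ⟦graphB⟧ 1 := by
    rw [streamCoeff_one_of_two_odd (p := 1) (q := 2) (by decide) (by decide) (by decide)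
      (by decide), class_eq 1 (H := graphB) (by decide)]
  have h13 : streamCoeff 1 (s(1, 3) ::ₘ s(3, 4) ::ₘ graphQ) = Finsupp.single ⟦graphC⟧ 1 := by
    rw [streamCoeff_one_of_two_odd (p := 2) (q := 4) (by decide) (by decide) (by decide)
      (by decide), class_eq (Equiv.swap 1 2) (H := graphC) (by decide)]
  have h14 : streamCoeff 1 (s(1, 4) ::ₘ s(3, 4) ::ₘ graphQ) = Finsupp.single ⟦graphC⟧ 1 := by
    rw [streamCoeff_one_of_two_odd (p := 2) (q := 3) (by decide) (by decide) (by decide)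
      (by decide), class_eq 1 (H := graphC) (by decide)]
  have h23 : streamCoeff 1 (s(2, 3) ::ₘ s(3, 4) ::ₘ graphQ) = Finsupp.single ⟦graphC⟧ 1 := by
    rw [streamCoeff_one_of_two_odd (p := 1) (q := 4) (by decide) (by decide) (by decide)
      (by decide), class_eq 1 (H := graphC) (by decide)]
  have h24 : streamCoeff 1 (s(2, 4) ::ₘ s(3, 4) ::ₘ graphQ) = Finsupp.single ⟦graphC⟧ 1 := by
    rw [streamCoeff_one_of_two_odd (p := 1) (q := 3) (by decide) (by decide) (by decide)
      (by decide), class_eq (Equiv.swap 1 2) (H := graphC) (by decide)]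
  have h15 : streamCoeff 1 (s(1, 5) ::ₘ s(3, 4) ::ₘ graphQ) = 0 :=
    streamCoeff_eq_zero_of_odd _ _ {2, 3, 4, 5} (by decide) (by decide)
  have h25 : streamCoeff 1 (s(2, 5) ::ₘ s(3, 4) ::ₘ graphQ) = 0 :=
    streamCoeff_eq_zero_of_odd _ _ {1, 3, 4, 5} (by decide) (by decide)
  have h35 : streamCoeff 1 (s(3, 5) ::ₘ s(3, 4) ::ₘ graphQ) = 0 :=
    streamCoeff_eq_zero_of_odd _ _ {1, 2, 4, 5} (by decide) (by decide)
  have h45 : streamCoeff 1 (s(4, 5) ::ₘ s(3, 4) ::ₘ graphQ) = 0 :=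
    streamCoeff_eq_zero_of_odd _ _ {1, 2, 3, 5} (by decide) (by decide)
  have h56 : streamCoeff 1 (s(5, 6) ::ₘ s(3, 4) ::ₘ graphQ) = 0 :=
    streamCoeff_eq_zero_of_odd _ _ {1, 2, 3, 4, 5, 6} (by decide) (by decide)
  rw [h12, h13, h14, h23, h24, h34, h15, h25, h35, h45, h56]
  push_cast
  module

/-- The two paths enter with `-2` and the pair of lines with `3`: `-2 · 2 (A - 3 C) + 3 (B + 2 C) =
-4 A + 3 B + 18 C`. -/
theorem streamCoeff_three_graphQ :
    streamCoeff 3 graphQ = (1 / 3 : ℝ) • ((-4 : ℝ) • Finsupp.single ⟦graphA⟧ 1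
      + (3 : ℝ) • Finsupp.single ⟦graphB⟧ 1 + (18 : ℝ) • Finsupp.single ⟦graphC⟧ 1) := by
  rw [streamCoeff_succ_of_not_filled 2 (by decide), verts_graphQ, streamSum_two,
    streamCoeff_succ_of_filled 1 (G := s(1, 2) ::ₘ graphQ) (by decide), streamCoeff_two_path₁,
    streamCoeff_two_path₂, streamCoeff_two_pair]
  push_cast
  module

theorem alphaCoeff_succ (n : ℕ) : alphaCoeff (n + 2)
    = (-1 / (2 * ((n : ℝ) + 2))) • streamCoeff (n + 1) graphQ := by
  simp only [alphaCoeff, psiCoeff]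
  rw [if_neg (by omega), if_neg (by omega), if_neg (by omega)]
  push_cast
  rw [zero_add, zero_sub, sub_zero, smul_neg, ← neg_smul]
  congr 1
  rw [neg_div, add_assoc]
  norm_num

theorem alphaCoeff_zero : alphaCoeff 0 = Finsupp.single ⟦0⟧ (Real.log 2) := by
  simp [alphaCoeff, psiCoeff]

theorem alphaCoeff_one :
    alphaCoeff 1 = Finsupp.single ⟦0⟧ (1 / 4) + Finsupp.single ⟦graphQ2⟧ (1 / 4) := by
  simp only [alphaCoeff, psiCoeff, streamCoeff_zero_graphQ]
  norm_num [smul_sub]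
  rw [← sub_add, ← Finsupp.single_sub]
  norm_num

theorem alphaCoeff_two : alphaCoeff 2 = Finsupp.single ⟦graphQ2⟧ (-1 / 4) := by
  rw [alphaCoeff_succ 0, streamCoeff_one_graphQ, Finsupp.smul_single]
  norm_num

theorem alphaCoeff_three : alphaCoeff 3 = Finsupp.single ⟦graphTri⟧ (1 / 3) := by
  rw [alphaCoeff_succ 1, streamCoeff_two_graphQ, Finsupp.smul_single, Finsupp.smul_single]
  norm_num

theorem alphaCoeff_four : alphaCoeff 4 = Finsupp.single ⟦graphA⟧ (1 / 6)
    + Finsupp.single ⟦graphB⟧ (-1 / 8) + Finsupp.single ⟦graphC⟧ (-3 / 4) := by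
  rw [alphaCoeff_succ 2, streamCoeff_three_graphQ]
  simp only [Finsupp.smul_single, smul_add]
  norm_num

theorem filled_of_alphaCoeff_ne_zero (n : ℕ) (G : OverlapGraph) (h : alphaCoeff n ⟦G⟧ ≠ 0) :
    G.Filled := by
  classical
  have h0 : ∀ H : OverlapGraph, H.Filled → (⟦H⟧ : GraphClass) = ⟦G⟧ → G.Filled := by
    intro H hH h1
    obtain ⟨π, hπ⟩ := Quotient.exact h1
    rw [← hπ, filled_relabel]
    exact hH
  match n, h with
  | 0, h =>
    rw [alphaCoeff_zero, Finsupp.single_apply] at h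
    split_ifs at h with h1
    · exact h0 0 (by decide) h1
    · exact absurd rfl h
  | 1, h =>
    rw [alphaCoeff_one, Finsupp.add_apply, Finsupp.single_apply, Finsupp.single_apply] at h
    split_ifs at h with h1 h2 h2
    · exact h0 0 (by decide) h1
    · exact h0 0 (by decide) h1
    · exact h0 _ (by decide) h2
    · simp at h
  | n + 2, h =>
    rw [alphaCoeff_succ, Finsupp.smul_apply] at h
    exact (streamCoeff_apply_ne_zero _ _ _ (right_ne_zero_of_smul h)).1

theorem card_of_alphaCoeff_ne_zero (n : ℕ) (G : OverlapGraph) (h : alphaCoeff (n + 2) ⟦G⟧ ≠ 0) :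
    Multiset.card G = n + 2 := by
  rw [alphaCoeff_succ, Finsupp.smul_apply] at h
  have := (streamCoeff_apply_ne_zero _ _ _ (right_ne_zero_of_smul h)).2
  have h1 : Multiset.card graphQ = 1 := rfl
  omega

/-! ### The generator of the constraints -/

theorem bracket_graphQ2 {m : OverlapGraph → ℝ} (hm : ReplicaSymmetric m) :
    bracket m graphQ2 = firstAC m := by
  unfold bracket firstAC
  rw [verts_graphQ2, streamSum_two,
    hm.eq_of_relabel 1 (G := s(1, 2) ::ₘ s(1, 2) ::ₘ graphQ2)
      (G' := {s(1, 2), s(1, 2), s(1, 2), s(1, 2)}) (by decide),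
    hm.eq_of_relabel (Equiv.swap 1 2) (G := s(1, 3) ::ₘ s(1, 3) ::ₘ graphQ2)
      (G' := {s(1, 2), s(1, 2), s(2, 3), s(2, 3)}) (by decide),
    hm.eq_of_relabel 1 (G := s(2, 3) ::ₘ s(2, 3) ::ₘ graphQ2)
      (G' := {s(1, 2), s(1, 2), s(2, 3), s(2, 3)}) (by decide),
    hm.eq_of_relabel 1 (G := s(3, 4) ::ₘ s(3, 4) ::ₘ graphQ2)
      (G' := {s(1, 2), s(1, 2), s(3, 4), s(3, 4)}) (by decide)]
  simp only [smul_eq_mul]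
  ring

theorem bracket_graphTri {m : OverlapGraph → ℝ} (hm : ReplicaSymmetric m) :
    bracket m graphTri = 3 * secondAC m := by
  unfold bracket secondAC
  rw [show verts graphTri = {1, 2, 3} by decide, streamSum_three,
    hm.eq_of_relabel 1 (G := s(1, 2) ::ₘ s(1, 2) ::ₘ graphTri)
      (G' := {s(1, 2), s(1, 2), s(1, 2), s(2, 3), s(1, 3)}) (by decide),
    hm.eq_of_relabel (Equiv.swap 2 3) (G := s(1, 3) ::ₘ s(1, 3) ::ₘ graphTri)
      (G' := {s(1, 2), s(1, 2), s(1, 2), s(2, 3), s(1, 3)}) (by decide),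
    hm.eq_of_relabel (Equiv.swap 1 3) (G := s(2, 3) ::ₘ s(2, 3) ::ₘ graphTri)
      (G' := {s(1, 2), s(1, 2), s(1, 2), s(2, 3), s(1, 3)}) (by decide),
    hm.eq_of_relabel 1 (G := s(1, 4) ::ₘ s(1, 4) ::ₘ graphTri)
      (G' := {s(1, 2), s(2, 3), s(1, 3), s(1, 4), s(1, 4)}) (by decide),
    hm.eq_of_relabel (Equiv.swap 1 2) (G := s(2, 4) ::ₘ s(2, 4) ::ₘ graphTri)
      (G' := {s(1, 2), s(2, 3), s(1, 3), s(1, 4), s(1, 4)}) (by decide),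
    hm.eq_of_relabel (Equiv.swap 1 3) (G := s(3, 4) ::ₘ s(3, 4) ::ₘ graphTri)
      (G' := {s(1, 2), s(2, 3), s(1, 3), s(1, 4), s(1, 4)}) (by decide),
    hm.eq_of_relabel 1 (G := s(4, 5) ::ₘ s(4, 5) ::ₘ graphTri)
      (G' := {s(1, 2), s(2, 3), s(1, 3), s(4, 5), s(4, 5)}) (by decide)]
  simp only [smul_eq_mul]
  ring

theorem bracket_empty (m : OverlapGraph → ℝ) : bracket m 0 = 0 := by
  simp [bracket, streamSum, verts]

section Constraint

variable {m : OverlapGraph → ℝ} (hm : ReplicaSymmetric m)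
include hm

theorem thermoConstraint_zero : thermoConstraint m 0 = 0 := by
  rw [thermoConstraint, alphaCoeff_zero, Finsupp.sum_single_index (by simp), bracket_out hm,
    bracket_empty, mul_zero]

theorem thermoConstraint_one : thermoConstraint m 1 = 1 / 4 * firstAC m := by
  classical
  rw [thermoConstraint, alphaCoeff_one, Finsupp.sum_add_index' (by simp) (by intros; ring),
    Finsupp.sum_single_index (by simp), Finsupp.sum_single_index (by simp), bracket_out hm,
    bracket_out hm, bracket_empty, bracket_graphQ2 hm, mul_zero, zero_add]

theorem thermoConstraint_two : thermoConstraint m 2 = -(1 / 4) * firstAC m := by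
  rw [thermoConstraint, alphaCoeff_two, Finsupp.sum_single_index (by simp), bracket_out hm,
    bracket_graphQ2 hm]
  ring

theorem thermoConstraint_three : thermoConstraint m 3 = secondAC m := by
  rw [thermoConstraint, alphaCoeff_three, Finsupp.sum_single_index (by simp), bracket_out hm,
    bracket_graphTri hm]
  ring

theorem thermoConstraint_four : thermoConstraint m 4 = fourthOrderSum m := by
  classical
  rw [thermoConstraint, alphaCoeff_four, Finsupp.sum_add_index' (by simp) (by intros; ring),
    Finsupp.sum_add_index' (by simp) (by intros; ring),
    Finsupp.sum_single_index (by simp), Finsupp.sum_single_index (by simp),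
    Finsupp.sum_single_index (by simp), bracket_out hm, bracket_out hm, bracket_out hm,
    fourthOrderSum]
  ring

end Constraint

theorem filled_out_of_mem_support {n : ℕ} {C : GraphClass} (hC : C ∈ (alphaCoeff n).support) :
    C.out.Filled := by
  refine filled_of_alphaCoeff_ne_zero n C.out ?_
  rw [Quotient.out_eq]
  exact Finsupp.mem_support_iff.1 hC

theorem thermoConstraint_eq_zero {m : OverlapGraph → ℝ}
    (h : ∀ G : OverlapGraph, G.Filled → bracket m G = 0) (n : ℕ) : thermoConstraint m n = 0 :=
  Finset.sum_eq_zero fun C hC => by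
    beta_reduce
    rw [h _ (filled_out_of_mem_support hC), mul_zero]

theorem graphAvg_replicaSymmetric (N : ℕ) (β t : ℝ) : ReplicaSymmetric (graphAvg N β t) :=
  fun π G => graphAvg_relabel N β t π G

theorem card_eq_of_class_eq {G H : OverlapGraph} (h : (⟦G⟧ : GraphClass) = ⟦H⟧) :
    Multiset.card G = Multiset.card H ∧ G.verts.card = H.verts.card ∧ (G.Nodup ↔ H.Nodup) := by
  obtain ⟨π, hπ⟩ := Quotient.exact h
  rw [← hπ, card_relabel, card_verts_relabel, nodup_relabel]
  exact ⟨rfl, rfl, Iff.rfl⟩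

open Classical in
theorem hasDerivAt_alphaExpansion_update (M : ℕ) (C : GraphClass) (x : ℝ) (m : GraphClass → ℝ)
    (z : ℝ) : HasDerivAt (fun z => alphaExpansion M x (Function.update m C z))
      (∑ n ∈ Finset.range (M + 1), x ^ n * alphaCoeff n C) z := by
  unfold alphaExpansion Finsupp.sum
  refine HasDerivAt.fun_sum fun n _ => HasDerivAt.const_mul _ ?_
  have h1 : ∀ C' ∈ (alphaCoeff n).support, HasDerivAt
      (fun z => alphaCoeff n C' * Function.update m C z C')
      (if C = C' then alphaCoeff n C' else 0) z := by
    intro C' _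
    split_ifs with h
    · subst h
      simpa using (hasDerivAt_id z).const_mul (alphaCoeff n C)
    · simpa [Function.update_of_ne (Ne.symm h)] using hasDerivAt_const z (alphaCoeff n C' * m C')
  refine (HasDerivAt.fun_sum h1).congr_deriv ?_
  rw [Finset.sum_ite_eq]
  split_ifs with h
  · rfl
  · exact (Finsupp.notMem_support_iff.1 h).symm

theorem derivGraph_eq (M : ℕ) (C : GraphClass) (x : ℝ) (m : GraphClass → ℝ) :
    derivGraph M C x m = ∑ n ∈ Finset.range (M + 1), x ^ n * alphaCoeff n C :=
  (hasDerivAt_alphaExpansion_update M C x m (m C)).deriv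

/-- From second order on, the graphs at order `n` have exactly `n` lines. A graph with at most four
lines gets nothing from higher orders, so the truncation `M` does not matter. -/
theorem derivGraph_of_card_le {M : ℕ} (hM : 4 ≤ M) {G : OverlapGraph}
    (hG : Multiset.card G ≤ 4) (x : ℝ) (m : GraphClass → ℝ) :
    derivGraph M ⟦G⟧ x m = alphaCoeff 0 ⟦G⟧ + x * alphaCoeff 1 ⟦G⟧ + x ^ 2 * alphaCoeff 2 ⟦G⟧
      + x ^ 3 * alphaCoeff 3 ⟦G⟧ + x ^ 4 * alphaCoeff 4 ⟦G⟧ := by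
  rw [derivGraph_eq, ← Finset.sum_subset (Finset.range_subset_range.2 (by omega : 5 ≤ M + 1))]
  · simp [Finset.sum_range_succ]
  · intro n _ hn
    rw [Finset.mem_range, not_lt] at hn
    have : alphaCoeff n ⟦G⟧ = 0 := by
      by_contra h
      obtain ⟨k, rfl⟩ : ∃ k, n = k + 2 := ⟨n - 2, by omega⟩
      have := card_of_alphaCoeff_ne_zero k G h
      omega
    rw [this, mul_zero]

theorem derivGraph_explicit {M : ℕ} (hM : 4 ≤ M) (x : ℝ) (m : GraphClass → ℝ) :
    derivGraph M ⟦graphQ2⟧ x m = x / 4 * (1 - x) ∧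
      derivGraph M ⟦graphTri⟧ x m = x ^ 3 / 3 ∧
      derivGraph M ⟦graphA⟧ x m = x ^ 4 / 6 ∧
      derivGraph M ⟦graphB⟧ x m = -(x ^ 4 / 8) ∧
      derivGraph M ⟦graphC⟧ x m = -(3 * x ^ 4 / 4) := by
  classical
  -- The number of lines, the number of replicas and the absence of double lines are invariants of a
  -- class and separate all the graphs involved.
  have ne : ∀ {G H : OverlapGraph}, (Multiset.card G ≠ Multiset.card H ∨
      G.verts.card ≠ H.verts.card ∨ ¬ (G.Nodup ↔ H.Nodup)) → (⟦G⟧ : GraphClass) ≠ ⟦H⟧ := by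
    intro G H h he
    have := card_eq_of_class_eq he
    tauto
  rw [derivGraph_of_card_le hM (by decide), derivGraph_of_card_le hM (by decide),
    derivGraph_of_card_le hM (by decide), derivGraph_of_card_le hM (by decide),
    derivGraph_of_card_le hM (by decide), alphaCoeff_zero, alphaCoeff_one, alphaCoeff_two,
    alphaCoeff_three, alphaCoeff_four]
  have n1 : (⟦(0 : OverlapGraph)⟧ : GraphClass) ≠ ⟦graphQ2⟧ := ne (by decide)
  have n2 : (⟦(0 : OverlapGraph)⟧ : GraphClass) ≠ ⟦graphTri⟧ := ne (by decide)
  have n3 : (⟦(0 : OverlapGraph)⟧ : GraphClass) ≠ ⟦graphA⟧ := ne (by decide)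
  have n4 : (⟦(0 : OverlapGraph)⟧ : GraphClass) ≠ ⟦graphB⟧ := ne (by decide)
  have n5 : (⟦(0 : OverlapGraph)⟧ : GraphClass) ≠ ⟦graphC⟧ := ne (by decide)
  have n6 : (⟦graphQ2⟧ : GraphClass) ≠ ⟦graphTri⟧ := ne (by decide)
  have n7 : (⟦graphQ2⟧ : GraphClass) ≠ ⟦graphA⟧ := ne (by decide)
  have n8 : (⟦graphQ2⟧ : GraphClass) ≠ ⟦graphB⟧ := ne (by decide)
  have n9 : (⟦graphQ2⟧ : GraphClass) ≠ ⟦graphC⟧ := ne (by decide)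
  have n10 : (⟦graphTri⟧ : GraphClass) ≠ ⟦graphA⟧ := ne (by decide)
  have n11 : (⟦graphTri⟧ : GraphClass) ≠ ⟦graphB⟧ := ne (by decide)
  have n12 : (⟦graphTri⟧ : GraphClass) ≠ ⟦graphC⟧ := ne (by decide)
  have n13 : (⟦graphA⟧ : GraphClass) ≠ ⟦graphB⟧ := ne (by decide)
  have n14 : (⟦graphA⟧ : GraphClass) ≠ ⟦graphC⟧ := ne (by decide)
  have n15 : (⟦graphB⟧ : GraphClass) ≠ ⟦graphC⟧ := ne (by decide)
  simp only [Finsupp.add_apply, Finsupp.single_apply, n1, n2, n3, n4, n5, n6, n7, n8, n9, n10,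
    n11, n12, n13, n14, n15, n6.symm, n7.symm, n8.symm, n9.symm, n10.symm, n11.symm, n12.symm,
    n13.symm, n14.symm, n15.symm, if_true, if_false]
  refine ⟨?_, ?_, ?_, ?_, ?_⟩ <;> ring

/-! ### Total and partial derivative of the expansion -/

theorem classAvg_eq_out (N : ℕ) (β : ℝ) (C : GraphClass) :
    classAvg N β C = graphAvg N β 0 C.out := by
  conv_lhs => rw [← Quotient.out_eq C]
  rfl

theorem classAvg_hasDerivAt {N : ℕ} (hN : 1 ≤ N) {β : ℝ} (hβ : 0 < β) (C : GraphClass) :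
    HasDerivAt (fun y => classAvg N (√y) C) (N / 2 * bracket (graphAvg N β 0) C.out) (β ^ 2) := by
  simp only [classAvg_eq_out]
  have := graphAvg_hasDerivAt_sq hN 0 (pow_pos hβ 2) C.out
  rwa [Real.sqrt_sq hβ.le] at this

theorem derivAvg_eq {N : ℕ} (hN : 1 ≤ N) {β : ℝ} (hβ : 0 < β) (C : GraphClass) :
    derivAvg N β C = N / 2 * bracket (graphAvg N β 0) C.out :=
  (classAvg_hasDerivAt hN hβ C).deriv

theorem partialDeriv_eq (M N : ℕ) (β : ℝ) :
    partialDeriv M N β = ∑ n ∈ Finset.range (M + 1), n * (β ^ 2) ^ (n - 1) *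
      (alphaCoeff n).sum fun C c => c * classAvg N β C :=
  (HasDerivAt.fun_sum fun n _ => (hasDerivAt_pow n (β ^ 2)).mul_const _).deriv

theorem alphaExpansion_hasDerivAt (M : ℕ) {N : ℕ} (hN : 1 ≤ N) {β : ℝ} (hβ : 0 < β) :
    HasDerivAt (fun y => alphaExpansion M y (classAvg N (√y)))
      (partialDeriv M N β + N / 2 * ∑ n ∈ Finset.range (M + 1),
        (β ^ 2) ^ n * thermoConstraint (graphAvg N β 0) n) (β ^ 2) := by
  have h1 : ∀ n, HasDerivAt (fun y => (alphaCoeff n).sum fun C c => c * classAvg N (√y) C)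
      (N / 2 * thermoConstraint (graphAvg N β 0) n) (β ^ 2) := by
    intro n
    unfold Finsupp.sum
    refine (HasDerivAt.fun_sum fun C _ => (classAvg_hasDerivAt hN hβ C).const_mul _).congr_deriv ?_
    rw [thermoConstraint, Finsupp.sum, Finset.mul_sum]
    exact Finset.sum_congr rfl fun C _ => by ring
  unfold alphaExpansion
  refine (HasDerivAt.fun_sum fun n _ => (hasDerivAt_pow n (β ^ 2)).mul (h1 n)).congr_deriv ?_
  rw [partialDeriv_eq, Finset.mul_sum, ← Finset.sum_add_distrib, Real.sqrt_sq hβ.le]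
  exact Finset.sum_congr rfl fun n _ => by ring

theorem totalDeriv_eq (M : ℕ) {N : ℕ} (hN : 1 ≤ N) {β : ℝ} (hβ : 0 < β) :
    totalDeriv M N β = partialDeriv M N β + N / 2 * ∑ n ∈ Finset.range (M + 1),
        (β ^ 2) ^ n * thermoConstraint (graphAvg N β 0) n :=
  (alphaExpansion_hasDerivAt M hN hβ).deriv

theorem sum_derivGraph_mul_derivAvg (M : ℕ) {N : ℕ} (hN : 1 ≤ N) {β : ℝ} (hβ : 0 < β) :
    ∑ C ∈ graphsOfAlpha M, derivGraph M C (β ^ 2) (classAvg N β) * derivAvg N β C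
      = N / 2 * ∑ n ∈ Finset.range (M + 1),
          (β ^ 2) ^ n * thermoConstraint (graphAvg N β 0) n := by
  classical
  simp only [derivGraph_eq, derivAvg_eq hN hβ, Finset.sum_mul]
  rw [Finset.sum_comm, Finset.mul_sum]
  refine Finset.sum_congr rfl fun n hn => ?_
  rw [thermoConstraint, Finsupp.sum_of_support_subset _ (s := graphsOfAlpha M)
    (fun C hC => Finset.mem_biUnion.2 ⟨n, hn, hC⟩) _ (by simp), Finset.mul_sum, Finset.mul_sum]
  exact Finset.sum_congr rfl fun C _ => by ring

theorem generator (M N : ℕ) (β : ℝ) (hN : 1 ≤ N) (hβ : 0 < β) :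
    DifferentiableAt ℝ (fun y => alphaExpansion M y (classAvg N (Real.sqrt y))) (β ^ 2) ∧
      totalDeriv M N β = partialDeriv M N β
        + ∑ C ∈ graphsOfAlpha M, derivGraph M C (β ^ 2) (classAvg N β) * derivAvg N β C ∧
      (totalDeriv M N β = partialDeriv M N β →
        ∑ C ∈ graphsOfAlpha M, derivGraph M C (β ^ 2) (classAvg N β) * derivAvg N β C = 0) ∧
      ∑ C ∈ graphsOfAlpha M, derivGraph M C (β ^ 2) (classAvg N β) * derivAvg N β C
        = N / 2 * ∑ n ∈ Finset.range (M + 1),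
            (β ^ 2) ^ n * thermoConstraint (graphAvg N β 0) n := by
  have h := sum_derivGraph_mul_derivAvg M hN hβ
  have h' := totalDeriv_eq M hN hβ
  refine ⟨(alphaExpansion_hasDerivAt M hN hβ).differentiableAt, by rw [h, h'], fun he => ?_, h⟩
  rw [h]
  linarith

theorem total_sub_partial_div (M : ℕ) {N : ℕ} (hN : 1 ≤ N) {β : ℝ} (hβ : 0 < β) :
    (totalDeriv M N β - partialDeriv M N β) / (N : ℝ)
      = 1 / 2 * ∑ n ∈ Finset.range (M + 1),
          (β ^ 2) ^ n * thermoConstraint (graphAvg N β 0) n := by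
  have : (N : ℝ) ≠ 0 := by positivity
  rw [totalDeriv_eq M hN hβ]
  field_simp
  ring

/-- After division by the size, total minus partial derivative is half of a partial sum of `∑ β^(2n)
T_n`. Differences of consecutive truncations isolate the terms, which is why all `M ≤ L` are needed.
-/
theorem orderByOrder (β : ℝ) (φ : ℕ → ℕ) (L : ℕ) (hβ : 0 < β) (hφ : Tendsto φ atTop atTop) :
    (∀ M ≤ L, Tendsto (fun k => (totalDeriv M (φ k) β - partialDeriv M (φ k) β) / (φ k : ℝ))
        atTop (𝓝 0)) ↔
      ∀ n ≤ L, Tendsto (fun k => thermoConstraint (graphAvg (φ k) β 0) n) atTop (𝓝 0) := by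
  have key : ∀ M, (fun k => (totalDeriv M (φ k) β - partialDeriv M (φ k) β) / (φ k : ℝ))
      =ᶠ[atTop] fun k => 1 / 2 * ∑ n ∈ Finset.range (M + 1),
          (β ^ 2) ^ n * thermoConstraint (graphAvg (φ k) β 0) n := by
    intro M
    filter_upwards [hφ.eventually_ge_atTop 1] with k hk
    exact total_sub_partial_div M hk hβ
  rw [forall₂_congr fun M _ => tendsto_congr' (key M)]
  constructor
  · intro h n hn
    have hp : (β ^ 2) ^ n ≠ 0 := by positivity
    have h1 : Tendsto (fun k => (β ^ 2) ^ n * thermoConstraint (graphAvg (φ k) β 0) n)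
        atTop (𝓝 0) := by
      rcases n with _ | n
      · simpa using (h 0 hn).const_mul 2
      · have := ((h (n + 1) hn).sub (h n (by omega))).const_mul 2
        simp only [sub_self, mul_zero] at this
        refine this.congr fun k => ?_
        rw [Finset.sum_range_succ _ (n + 1)]
        ring
    have h2 := h1.const_mul ((β ^ 2) ^ n)⁻¹
    rw [mul_zero] at h2
    exact h2.congr fun k => inv_mul_cancel_left₀ hp _
  · intro h M hM
    have h1 : Tendsto (fun k => ∑ n ∈ Finset.range (M + 1),
        (β ^ 2) ^ n * thermoConstraint (graphAvg (φ k) β 0) n) atTop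
        (𝓝 (∑ n ∈ Finset.range (M + 1), (β ^ 2) ^ n * 0)) := by
      refine tendsto_finsetSum _ fun n hn => (h n ?_).const_mul _
      rw [Finset.mem_range] at hn
      omega
    have h2 := h1.const_mul (1 / 2)
    simp only [mul_zero, Finset.sum_const_zero] at h2
    exact h2

/-! ### The thermodynamic constraints are weaker than the symmetric ones -/

/-- Values of a functional on filled graphs with six lines, by the number of replicas. -/
noncomputable def sixLineValue (s : ℕ) : ℝ := if s = 3 then 1 else if s = 6 then 2 / 35 else 0

/-- A functional that satisfies the thermodynamic constraints but not the symmetric ones. -/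
noncomputable def sixLineState (G : OverlapGraph) : ℝ :=
  if G = 0 then 1 else if G.Filled ∧ Multiset.card G = 6 then sixLineValue G.verts.card else 0

theorem sixLineState_cons (e : Sym2 ℕ) (G : OverlapGraph) :
    sixLineState (e ::ₘ G) = if Filled (e ::ₘ G) ∧ Multiset.card (e ::ₘ G) = 6 then
      sixLineValue (verts (e ::ₘ G)).card else 0 := by
  rw [sixLineState, if_neg (Multiset.cons_ne_zero)]

theorem sixLineState_replicaSymmetric : ReplicaSymmetric sixLineState := by
  intro π G
  have h0 : G.relabel π = 0 ↔ G = 0 := Multiset.map_eq_zero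
  simp only [sixLineState, filled_relabel, card_relabel, card_verts_relabel, h0]

/-- The bracket adds two lines to the graph, and on nonempty graphs the functional sees six lines
only. -/
theorem bracket_sixLineState_of_card_ne {G : OverlapGraph} (h : Multiset.card G ≠ 4) :
    bracket sixLineState G = 0 := by
  unfold bracket
  have : ∀ e : Sym2 ℕ, sixLineState (e ::ₘ e ::ₘ G) = 0 := by
    intro e
    rw [sixLineState_cons, if_neg]
    simp only [Multiset.card_cons]
    omega
  simp only [this, streamSum_zero]

theorem verts_cons_cons (a b : ℕ) (G : OverlapGraph) :
    verts (s(a, b) ::ₘ s(a, b) ::ₘ G) = insert a (insert b G.verts) := by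
  ext c
  simp only [verts_cons, Sym2.mem_iff, Finset.mem_insert]
  tauto

/-- Doubled lines keep the graph filled, so only the number of replicas matters: the three kinds of
lines add none, one or two. -/
theorem bracket_sixLineState {G : OverlapGraph} (hG : G.Filled) (h : Multiset.card G = 4) :
    bracket sixLineState G
      = (G.verts.card * (G.verts.card - 1) / 2) * sixLineValue G.verts.card
        - G.verts.card ^ 2 * sixLineValue (G.verts.card + 1)
        + (G.verts.card * (G.verts.card + 1) / 2) * sixLineValue (G.verts.card + 2) := by
  have h1 : ∀ a b, sixLineState (s(a, b) ::ₘ s(a, b) ::ₘ G)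
      = sixLineValue (insert a (insert b G.verts)).card := by
    intro a b
    rw [sixLineState_cons, if_pos ⟨filled_cons_cons _ hG, by simp [h]⟩, verts_cons_cons]
  have hu : G.verts.sup id + 1 ∉ G.verts := fun h => by have := le_sup_id h; omega
  have hv : G.verts.sup id + 2 ∉ G.verts := fun h => by have := le_sup_id h; omega
  unfold bracket
  refine streamSum_of_eq (fun a ha b hb _ => ?_) (fun a ha => ?_) ?_
  · rw [h1, Finset.insert_eq_of_mem hb, Finset.insert_eq_of_mem ha]
  · rw [h1, Finset.insert_eq_of_mem (Finset.mem_insert_of_mem ha), Finset.card_insert_of_notMem hu]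
  · rw [h1, Finset.card_insert_of_notMem (by simp [hu]), Finset.card_insert_of_notMem hv]

theorem bracket_sixLineState_graphA : bracket sixLineState graphA = 3 := by
  rw [bracket_sixLineState (by decide) (by decide), show (verts graphA).card = 3 by decide]
  norm_num [sixLineValue]

theorem bracket_sixLineState_graphB : bracket sixLineState graphB = 4 / 7 := by
  rw [bracket_sixLineState (by decide) (by decide), show (verts graphB).card = 4 by decide]
  norm_num [sixLineValue]

theorem bracket_sixLineState_graphC : bracket sixLineState graphC = 4 / 7 := by
  rw [bracket_sixLineState (by decide) (by decide), show (verts graphC).card = 4 by decide]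
  norm_num [sixLineValue]

theorem thermoConstraint_sixLineState (n : ℕ) : thermoConstraint sixLineState n = 0 := by
  have hs := sixLineState_replicaSymmetric
  match n with
  | 0 => exact thermoConstraint_zero hs
  | 1 =>
    rw [thermoConstraint_one hs, ← bracket_graphQ2 hs,
      bracket_sixLineState_of_card_ne (by decide), mul_zero]
  | n + 2 =>
    by_cases h : n = 2
    · subst h
      -- The value `2/35` at six replicas is chosen for this: the brackets are `3`, `4/7`, `4/7`,
      -- and `3/6 - (1/8 + 3/4) · 4/7 = 0`.
      rw [thermoConstraint_four hs, fourthOrderSum, bracket_sixLineState_graphA,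
        bracket_sixLineState_graphB, bracket_sixLineState_graphC]
      norm_num
    · refine Finset.sum_eq_zero fun C hC => ?_
      have h1 := card_of_alphaCoeff_ne_zero n C.out (by
        rw [Quotient.out_eq]
        exact Finsupp.mem_support_iff.1 hC)
      beta_reduce
      rw [bracket_sixLineState_of_card_ne (by omega), mul_zero]

theorem exists_thermo_not_symmetric :
    ∃ m : OverlapGraph → ℝ, ReplicaSymmetric m ∧ m 0 = 1 ∧ (∀ G, |m G| ≤ 1) ∧
      (∀ G, ¬ G.Filled → m G = 0) ∧ (∀ n, thermoConstraint m n = 0) ∧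
      bracket m graphA ≠ 0 ∧ bracket m graphB ≠ 0 ∧ bracket m graphC ≠ 0 := by
  refine ⟨sixLineState, sixLineState_replicaSymmetric, if_pos rfl, fun G => ?_, fun G hG => ?_,
    thermoConstraint_sixLineState, ?_, ?_, ?_⟩
  · unfold sixLineState sixLineValue
    split_ifs <;> norm_num
  · rw [sixLineState, if_neg, if_neg fun h => hG h.1]
    rintro rfl
    exact hG (by decide)
  · rw [bracket_sixLineState_graphA]; norm_num
  · rw [bracket_sixLineState_graphB]; norm_num
  · rw [bracket_sixLineState_graphC]; norm_num

/-! ### The remainder of the expansion -/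

theorem Continuous.uncurry_along {X : Type*} [TopologicalSpace X] {f : ℝ → ℝ → ℝ}
    (hf : Continuous fun p : ℝ × ℝ => f p.1 p.2) {a b : X → ℝ} (ha : Continuous a)
    (hb : Continuous b) : Continuous fun x => f (a x) (b x) :=
  hf.comp (ha.prodMk hb)

/-- A function that vanishes at `0` is controlled by a monotone bound of its derivative. -/
theorem abs_le_mul_of_hasDerivAt {f f' b : ℝ → ℝ} (hf : Continuous f) (h0 : f 0 = 0)
    (hd : ∀ s, 0 < s → HasDerivAt f (f' s) s) (hb : ∀ s, 0 < s → |f' s| ≤ b s)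
    (hmono : ∀ s t, 0 < s → s ≤ t → b s ≤ b t) {t : ℝ} (ht : 0 ≤ t) : |f t| ≤ t * b t := by
  rcases ht.eq_or_lt with rfl | ht
  · simp [h0]
  · obtain ⟨c, hc, he⟩ := exists_hasDerivAt_eq_slope f f' ht hf.continuousOn
      fun s hs => hd s hs.1
    rw [h0, sub_zero, sub_zero, eq_div_iff ht.ne'] at he
    rw [← he, abs_mul, abs_of_pos ht, mul_comm]
    exact mul_le_mul_of_nonneg_left ((hb c hc.1).trans (hmono c t hc.1 hc.2.le)) ht.le

theorem card_verts_le (G : OverlapGraph) : G.verts.card ≤ 2 * Multiset.card G := by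
  unfold verts
  refine (Multiset.toFinset_card_le _).trans (le_of_eq ?_)
  rw [Multiset.card_bind]
  simp [mul_comm, Sym2.card_toMultiset]

/-- Five lines have at most ten ends, and with `s` replicas the absolute values of the coefficients
add up to `2 s²`. -/
theorem streamBound_le {G : OverlapGraph} (h : Multiset.card G ≤ 5) :
    streamBound G.verts ≤ 200 := by
  have h1 : (G.verts.card : ℝ) ≤ 10 := by
    have := card_verts_le G
    exact_mod_cast (by omega : G.verts.card ≤ 10)
  have h2 : (0 : ℝ) ≤ G.verts.card := Nat.cast_nonneg _
  unfold streamBound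
  nlinarith

theorem abs_streamSum_verts_le {G : OverlapGraph} (h : Multiset.card G ≤ 5) {f : Sym2 ℕ → ℝ}
    {B : ℝ} (hB : 0 ≤ B) (hf : ∀ a b, a ≠ b → |f s(a, b)| ≤ B) :
    |streamSum G.verts f| ≤ 200 * B :=
  (abs_streamSum_le hf).trans (mul_le_mul_of_nonneg_right (streamBound_le h) hB)

theorem not_filled_cons {G : OverlapGraph} (hG : G.Filled) {a b : ℕ} (hab : a ≠ b) :
    ¬ Filled (s(a, b) ::ₘ G) := by
  intro h
  have h1 : Even (degree (s(a, b) ::ₘ G) a) := h a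
  rw [degree_cons, if_pos rfl, if_neg hab, add_zero, add_comm, Nat.even_add_one] at h1
  exact h1 (hG a)

section Remainder

variable {N : ℕ} (hN : 1 ≤ N) (β : ℝ)

/-- The average of a formal linear combination of graphs. -/
noncomputable def formalAvg (N : ℕ) (β : ℝ) : (GraphClass →₀ ℝ) →ₗ[ℝ] ℝ :=
  Finsupp.linearCombination ℝ (classAvg N β)

theorem formalAvg_single (G : OverlapGraph) :
    formalAvg N β (Finsupp.single ⟦G⟧ 1) = graphAvg N β 0 G := by
  rw [formalAvg, Finsupp.linearCombination_single, one_smul]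
  rfl

/-- The expansion of `⟨G⟩_t` in filled graphs through order `n`. -/
noncomputable def streamApprox (N : ℕ) (β : ℝ) (n : ℕ) (G : OverlapGraph) (t : ℝ) : ℝ :=
  ∑ k ∈ Finset.range (n + 1), t ^ k * formalAvg N β (streamCoeff k G)

theorem formalAvg_streamCoeff_zero (G : OverlapGraph) :
    formalAvg N β (streamCoeff 0 G) = graphAvg N β 0 G := by
  by_cases h : G.Filled
  · rw [streamCoeff_zero_of_filled h, formalAvg_single]
  · rw [streamCoeff_zero_of_not_filled h, graphAvg_eq_zero β h, map_zero]

theorem streamApprox_zero (G : OverlapGraph) (t : ℝ) :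
    streamApprox N β 0 G t = graphAvg N β 0 G := by
  simp [streamApprox, formalAvg_streamCoeff_zero]

theorem streamApprox_of_filled (n : ℕ) {G : OverlapGraph} (h : G.Filled) (t : ℝ) :
    streamApprox N β n G t = graphAvg N β 0 G := by
  rw [streamApprox, Finset.sum_range_succ', Finset.sum_eq_zero, zero_add, pow_zero, one_mul,
    formalAvg_streamCoeff_zero]
  intro k _
  rw [streamCoeff_succ_of_filled k h, map_zero, mul_zero]

/-- The recursion of `streamCoeff` is made so that the truncations solve the streaming equation
exactly, with the order lowered by one. Remainders therefore obey the same equation. -/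
theorem streamApprox_hasDerivAt (n : ℕ) {G : OverlapGraph} (h : ¬ G.Filled) (t : ℝ) :
    HasDerivAt (streamApprox N β (n + 1) G)
      (streamSum G.verts fun e => streamApprox N β n (e ::ₘ G) t) t := by
  have h1 : streamApprox N β (n + 1) G = fun t => (∑ k ∈ Finset.range (n + 1),
      t ^ (k + 1) * formalAvg N β (streamCoeff (k + 1) G)) := by
    funext t
    rw [streamApprox, Finset.sum_range_succ', streamCoeff_zero_of_not_filled h, map_zero,
      mul_zero, add_zero]
  rw [h1]
  refine (HasDerivAt.fun_sum fun k _ => (hasDerivAt_pow (k + 1) t).mul_const _).congr_deriv ?_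
  unfold streamApprox
  rw [streamSum_finsetSum]
  refine Finset.sum_congr rfl fun k _ => ?_
  rw [streamCoeff_succ_of_not_filled k h, map_smul, map_streamSum, streamSum_mul, smul_eq_mul]
  have : (k : ℝ) + 1 ≠ 0 := by positivity
  push_cast
  field_simp

theorem continuous_graphAvg_field (G : OverlapGraph) : Continuous fun t => graphAvg N β t G :=
  Continuous.uncurry_along (f := fun β t => graphAvg N β t G) (a := fun _ => β) (b := fun t => t)
    (continuous_graphAvg G) continuous_const continuous_id

theorem continuous_streamApprox (n : ℕ) (G : OverlapGraph) :
    Continuous (streamApprox N β n G) := by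
  unfold streamApprox
  fun_prop

include hN

theorem graphAvg_sub_le {G : OverlapGraph} (hG : Multiset.card G ≤ 5) {b : ℝ → ℝ}
    (hb0 : ∀ s, 0 < s → 0 ≤ b s) (hmono : ∀ s t, 0 < s → s ≤ t → b s ≤ b t)
    (hb : ∀ s, 0 < s → ∀ x y, x ≠ y → |graphAvg N β s (s(x, y) ::ₘ G)| ≤ b s)
    {t : ℝ} (ht : 0 ≤ t) : |graphAvg N β t G - graphAvg N β 0 G| ≤ t * (200 * b t) := by
  refine abs_le_mul_of_hasDerivAt (f := fun t => graphAvg N β t G - graphAvg N β 0 G)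
    (b := fun s => 200 * b s)
    ((continuous_graphAvg_field β G).sub continuous_const) (sub_self _)
    (fun s hs => (graphAvg_hasDerivAt_field hN β hs G).sub_const _) (fun s hs => ?_)
    (fun s t hs hst => mul_le_mul_of_nonneg_left (hmono s t hs hst) (by norm_num)) ht
  exact abs_streamSum_verts_le hG (hb0 s hs) fun x y hxy => hb s hs x y hxy

/-- The remainder vanishes at `t = 0` and its derivative is the streaming sum of the remainders with
one more line. Each order gains a factor `t` and costs a factor `200`. -/
theorem graphAvg_sub_streamApprox_le (n : ℕ) {G : OverlapGraph} (hG : Multiset.card G ≤ 5)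
    (hf : ¬ G.Filled) {b : ℝ → ℝ}
    (hb0 : ∀ s, 0 < s → 0 ≤ b s) (hmono : ∀ s t, 0 < s → s ≤ t → b s ≤ b t)
    (hb : ∀ s, 0 < s → ∀ x y, x ≠ y →
      |graphAvg N β s (s(x, y) ::ₘ G) - streamApprox N β n (s(x, y) ::ₘ G) s| ≤ b s)
    {t : ℝ} (ht : 0 ≤ t) :
    |graphAvg N β t G - streamApprox N β (n + 1) G t| ≤ t * (200 * b t) := by
  refine abs_le_mul_of_hasDerivAt (f := fun t => graphAvg N β t G - streamApprox N β (n + 1) G t)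
    (b := fun s => 200 * b s)
    ((continuous_graphAvg_field β G).sub (continuous_streamApprox β _ G)) ?_
    (fun s hs => (graphAvg_hasDerivAt_field hN β hs G).sub (streamApprox_hasDerivAt β n hf s))
    (fun s hs => ?_)
    (fun s t hs hst => mul_le_mul_of_nonneg_left (hmono s t hs hst) (by norm_num)) ht
  · rw [graphAvg_eq_zero β hf, streamApprox, Finset.sum_range_succ',
      streamCoeff_zero_of_not_filled hf]
    simp
  · rw [← streamSum_sub]
    exact abs_streamSum_verts_le hG (hb0 s hs) fun x y hxy => hb s hs x y hxy

theorem remainder_zero {G : OverlapGraph} (hG : Multiset.card G ≤ 5) {t : ℝ} (ht : 0 ≤ t) :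
    |graphAvg N β t G - graphAvg N β 0 G| ≤ 200 * t := by
  have := graphAvg_sub_le hN β hG (b := fun _ => 1) (fun _ _ => zero_le_one)
    (fun _ _ _ _ => le_rfl) (fun s _ x y _ => abs_graphAvg_le β s _) ht
  linarith

/-- Filled graphs, which the expansion freezes, are off at order `t²` only: a further line between
different replicas leaves an unfilled graph, whose average is itself of order `t`. -/
theorem remainder_one {G : OverlapGraph} (hG : Multiset.card G ≤ 4) {t : ℝ} (ht : 0 ≤ t) :
    |graphAvg N β t G - streamApprox N β 1 G t| ≤ 200 ^ 2 * t ^ 2 := by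
  have hmono : ∀ s t : ℝ, 0 < s → s ≤ t → 200 * s ≤ 200 * t := fun s t _ h => by linarith
  have hcard : ∀ x y, Multiset.card (s(x, y) ::ₘ G) ≤ 5 := fun x y => by
    rw [Multiset.card_cons]; omega
  by_cases hf : G.Filled
  · rw [streamApprox_of_filled β 1 hf]
    have := graphAvg_sub_le hN β (by omega : Multiset.card G ≤ 5) (b := fun s => 200 * s)
      (fun s hs => by positivity) hmono (fun s hs x y hxy => ?_) ht
    · refine this.trans (le_of_eq ?_)
      ring
    · have h := remainder_zero hN β (hcard x y) hs.le
      rwa [graphAvg_eq_zero β (not_filled_cons hf hxy), sub_zero] at h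
  · have := graphAvg_sub_streamApprox_le hN β 0 (by omega : Multiset.card G ≤ 5) hf
      (b := fun s => 200 * s) (fun s hs => by positivity) hmono (fun s hs x y _ => ?_) ht
    · refine this.trans (le_of_eq ?_)
      ring
    · rw [streamApprox_zero]
      exact remainder_zero hN β (hcard x y) hs.le

/-- Filled graphs have to be excluded here, since freezing them may cost a term of order `t²`. -/
theorem remainder_two {G : OverlapGraph} (hG : Multiset.card G ≤ 3) (hf : ¬ G.Filled) {t : ℝ}
    (ht : 0 ≤ t) : |graphAvg N β t G - streamApprox N β 2 G t| ≤ 200 ^ 3 * t ^ 3 := by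
  have := graphAvg_sub_streamApprox_le hN β 1 (by omega : Multiset.card G ≤ 5) hf
    (b := fun s => 200 ^ 2 * s ^ 2) (fun s hs => by positivity)
    (fun s t hs h => by gcongr) (fun s hs x y _ => remainder_one hN β (by
      rw [Multiset.card_cons]; omega) hs.le) ht
  refine this.trans (le_of_eq ?_)
  ring

-- A filled graph with one additional line is completed by the same line again. The second streaming
-- order thus contains squared overlaps and reproduces the bracket.
omit hN in
theorem streamSum_formalAvg_graphQ2 :
    (streamSum graphQ2.verts fun e => formalAvg N β (streamCoeff 1 (e ::ₘ graphQ2)))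
      = firstAC (graphAvg N β 0) := by
  rw [← bracket_graphQ2 (graphAvg_replicaSymmetric N β 0), bracket, verts_graphQ2, streamSum_two,
    streamSum_two,
    streamCoeff_one_of_two_odd (p := 1) (q := 2) (G := s(1, 2) ::ₘ graphQ2) (by decide)
      (by decide) (by decide) (by decide),
    streamCoeff_one_of_two_odd (p := 1) (q := 3) (G := s(1, 3) ::ₘ graphQ2) (by decide)
      (by decide) (by decide) (by decide),
    streamCoeff_one_of_two_odd (p := 2) (q := 3) (G := s(2, 3) ::ₘ graphQ2) (by decide)
      (by decide) (by decide) (by decide),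
    streamCoeff_one_of_two_odd (p := 3) (q := 4) (G := s(3, 4) ::ₘ graphQ2) (by decide)
      (by decide) (by decide) (by decide)]
  simp only [formalAvg_single]

/-- Parity kills the first order in `t`; the second order is proportional to `firstAC`, and the rest
is of third order. -/
theorem remainder_graphQ2 {t : ℝ} (ht : 0 ≤ t) :
    |graphAvg N β t graphQ2 - graphAvg N β 0 graphQ2|
      ≤ 200 ^ 3 * t ^ 3 + t ^ 2 * |firstAC (graphAvg N β 0)| := by
  set A := firstAC (graphAvg N β 0)
  have := abs_le_mul_of_hasDerivAt (f := fun t => graphAvg N β t graphQ2 - graphAvg N β 0 graphQ2)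
    (b := fun s => 200 ^ 3 * s ^ 2 + s * |A|)
    ((continuous_graphAvg_field β graphQ2).sub continuous_const) (sub_self _)
    (fun s hs => (graphAvg_hasDerivAt_field hN β hs graphQ2).sub_const _) (fun s hs => ?_)
    (fun s t hs hst => by gcongr) ht
  · refine this.trans (le_of_eq ?_)
    ring
  · have h1 : (streamSum graphQ2.verts fun e => streamApprox N β 1 (e ::ₘ graphQ2) s) = s * A := by
      rw [show A = _ from (streamSum_formalAvg_graphQ2 β).symm, ← streamSum_mul]
      refine streamSum_congr fun x _ y _ hxy => ?_
      have hf : ¬ Filled (s(x, y) ::ₘ graphQ2) := not_filled_cons (by decide) hxy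
      simp [streamApprox, Finset.sum_range_succ, streamCoeff_zero_of_not_filled hf]
    have h2 : |(streamSum graphQ2.verts fun e => graphAvg N β s (e ::ₘ graphQ2))
        - streamSum graphQ2.verts fun e => streamApprox N β 1 (e ::ₘ graphQ2) s|
        ≤ 200 * (200 ^ 2 * s ^ 2) := by
      rw [← streamSum_sub]
      exact abs_streamSum_verts_le (by decide) (by positivity) fun x y _ =>
        remainder_one hN β (by rw [Multiset.card_cons]; decide) hs.le
    rw [h1] at h2
    have h3 := abs_sub_abs_le_abs_sub
      (streamSum graphQ2.verts fun e => graphAvg N β s (e ::ₘ graphQ2)) (s * A)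
    rw [abs_mul, abs_of_pos hs] at h3
    linarith

/-- Of the graphs obtained from `q_12` by adding a line between different replicas only `q_12²` is
filled, so the frozen-graph error enters through `remainder_graphQ2` alone. -/
theorem remainder_graphQ {t : ℝ} (ht : 0 ≤ t) :
    |graphAvg N β t graphQ - streamApprox N β 3 graphQ t|
      ≤ t * (200 * (200 ^ 3 * t ^ 3 + t ^ 2 * |firstAC (graphAvg N β 0)|)) := by
  refine graphAvg_sub_streamApprox_le hN β 2 (by decide) (by decide)
    (b := fun s => 200 ^ 3 * s ^ 3 + s ^ 2 * |firstAC (graphAvg N β 0)|)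
    (fun s hs => by positivity) (fun s t hs hst => by gcongr) (fun s hs x y hxy => ?_) ht
  by_cases hf : Filled (s(x, y) ::ₘ graphQ)
  · have he : s(x, y) ::ₘ graphQ = graphQ2 := by
      have hx : Even (degree (s(x, y) ::ₘ graphQ) x) := hf x
      have hy : Even (degree (s(x, y) ::ₘ graphQ) y) := hf y
      rw [graphQ, ← Multiset.cons_zero, degree_cons, degree_cons, degree_zero] at hx hy
      have h1 : (x = 1 ∧ y = 2) ∨ (x = 2 ∧ y = 1) := by
        rw [if_pos rfl, if_neg hxy] at hx
        rw [if_pos rfl, if_neg (Ne.symm hxy)] at hy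
        split_ifs at hx hy <;> first | omega | (exfalso; revert hx; decide) | (exfalso; revert hy; decide)
      rcases h1 with ⟨rfl, rfl⟩ | ⟨rfl, rfl⟩ <;> decide
    rw [he, streamApprox_of_filled β 2 (by decide)]
    exact remainder_graphQ2 hN β hs.le
  · have := remainder_two hN β (by rw [Multiset.card_cons]; decide) hf hs.le
    have h2 : 0 ≤ s ^ 2 * |firstAC (graphAvg N β 0)| := by positivity
    linarith

omit hN in
theorem alphaExpansion_four (t : ℝ) : alphaExpansion 4 t (classAvg N β)
    = Real.log 2 + t * (1 / 4 + 1 / 4 * graphAvg N β 0 graphQ2)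
      - ∑ n ∈ Finset.range 3, t ^ (n + 2) / (2 * ((n : ℝ) + 2))
        * formalAvg N β (streamCoeff (n + 1) graphQ) := by
  have h1 : ∀ n, ((alphaCoeff n).sum fun C c => c * classAvg N β C)
      = formalAvg N β (alphaCoeff n) := fun n => rfl
  have h0 : classAvg N β ⟦0⟧ = 1 := by
    change graphAvg N β 0 0 = 1
    have := formalAvg_streamCoeff_zero (N := N) β 0
    rw [graphAvg_eq]
    have h2 : monAvg N (verts 0) 0 = fun _ => 1 := by
      funext x
      simp only [monAvg, value_zero]
      exact repAvg_const _ _ _ _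
    rw [h2]
    simp [gaussAvg]
  have h2 : classAvg N β ⟦graphQ2⟧ = graphAvg N β 0 graphQ2 := rfl
  unfold alphaExpansion
  simp only [h1]
  rw [Finset.sum_range_succ', Finset.sum_range_succ']
  simp only [add_assoc, Nat.reduceAdd, alphaCoeff_succ, map_smul, smul_eq_mul]
  rw [alphaCoeff_zero, alphaCoeff_one, map_add]
  simp only [formalAvg, Finsupp.linearCombination_single, h0, h2, smul_eq_mul]
  rw [sub_eq_add_neg, ← Finset.sum_neg_distrib]
  have h3 : ∀ n : ℕ, t ^ (n + 2) * (-1 / (2 * ((n : ℝ) + 2)) *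
      Finsupp.linearCombination ℝ (classAvg N β) (streamCoeff (n + 1) graphQ))
      = -(t ^ (n + 2) / (2 * ((n : ℝ) + 2)) *
      Finsupp.linearCombination ℝ (classAvg N β) (streamCoeff (n + 1) graphQ)) := fun n => by ring
  simp only [h3]
  ring

omit hN in
theorem alphaExpansion_four_hasDerivAt (t : ℝ) :
    HasDerivAt (fun t => alphaExpansion 4 t (classAvg N β))
      (1 / 4 + 1 / 4 * graphAvg N β 0 graphQ2 - 1 / 2 * streamApprox N β 3 graphQ t) t := by
  simp only [alphaExpansion_four]
  have h1 : HasDerivAt (fun t : ℝ => ∑ n ∈ Finset.range 3, t ^ (n + 2) / (2 * ((n : ℝ) + 2))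
        * formalAvg N β (streamCoeff (n + 1) graphQ))
      (∑ n ∈ Finset.range 3, ((n + 2 : ℕ) : ℝ) * t ^ (n + 2 - 1) / (2 * ((n : ℝ) + 2))
        * formalAvg N β (streamCoeff (n + 1) graphQ)) t :=
    HasDerivAt.fun_sum fun n _ => ((hasDerivAt_pow (n + 2) t).div_const _).mul_const _
  refine ((((hasDerivAt_id t).mul_const _).const_add _).sub h1).congr_deriv ?_
  rw [one_mul, streamApprox, Finset.sum_range_succ' (fun k => t ^ k *
    formalAvg N β (streamCoeff k graphQ)) 3, streamCoeff_zero_graphQ, map_zero, mul_zero,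
    add_zero, Finset.mul_sum]
  congr 1
  refine Finset.sum_congr rfl fun n _ => ?_
  have : (n : ℝ) + 2 ≠ 0 := by positivity
  push_cast
  field_simp

theorem alphaRedundant_hasDerivAt {t : ℝ} (ht : 0 < t) :
    HasDerivAt (fun t => alphaRedundant N t β)
      (1 / 2 * (1 - graphAvg N β t graphQ) - 1 / 4 * (1 - graphAvg N β 0 graphQ2)) t := by
  unfold alphaRedundant
  simp only [cavityFn_eq]
  refine ((((freeEnergy_hasDerivAt_field hN β ht).sub_const _).const_add _).sub
    (((hasDerivAt_id t).div_const 4).mul_const _)).congr_deriv ?_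
  ring

/-- The `t`-derivatives differ by half the remainder of `⟨q_12⟩_t`, since the two contributions of
`⟨q_12²⟩` at `t = 0` agree; one more integration gives another factor `t`. -/
theorem remainder_alpha {t : ℝ} (ht : 0 ≤ t) :
    |alphaRedundant N t β - alphaExpansion 4 t (classAvg N β)|
      ≤ 200 ^ 4 * (t ^ 5 + t ^ 4 * |firstAC (graphAvg N β 0)|) := by
  set A := |firstAC (graphAvg N β 0)|
  have hA : 0 ≤ A := abs_nonneg _
  have hc : Continuous fun t => alphaRedundant N t β := by
    unfold alphaRedundant
    simp only [cavityFn_eq]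
    have : Continuous fun t => freeEnergy N β t :=
      Continuous.uncurry_along (f := freeEnergy N) (a := fun _ => β) (b := fun t => t)
        continuous_freeEnergy continuous_const continuous_id
    fun_prop
  have hc' : Continuous fun t => alphaExpansion 4 t (classAvg N β) :=
    continuous_iff_continuousAt.2 fun t => (alphaExpansion_four_hasDerivAt β t).continuousAt
  have := abs_le_mul_of_hasDerivAt
    (f := fun t => alphaRedundant N t β - alphaExpansion 4 t (classAvg N β))
    (b := fun s => s * (200 * (200 ^ 3 * s ^ 3 + s ^ 2 * A)))
    (f' := fun s => 1 / 2 * (1 - graphAvg N β s graphQ) - 1 / 4 * (1 - graphAvg N β 0 graphQ2)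
        - (1 / 4 + 1 / 4 * graphAvg N β 0 graphQ2 - 1 / 2 * streamApprox N β 3 graphQ s))
    (hc.sub hc') ?_
    (fun s hs => (alphaRedundant_hasDerivAt hN β hs).sub (alphaExpansion_four_hasDerivAt β s))
    (fun s hs => ?_) (fun s t hs hst => by have := hs.le.trans hst; gcongr) ht
  · refine this.trans ?_
    have h1 : 0 ≤ t ^ 4 * A := by positivity
    nlinarith
  · simp [alphaRedundant, cavityFn_eq, alphaExpansion_four]
  · have h1 := remainder_graphQ hN β hs.le
    have h2 : 1 / 2 * (1 - graphAvg N β s graphQ) - 1 / 4 * (1 - graphAvg N β 0 graphQ2)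
        - (1 / 4 + 1 / 4 * graphAvg N β 0 graphQ2 - 1 / 2 * streamApprox N β 3 graphQ s)
        = -(1 / 2) * (graphAvg N β s graphQ - streamApprox N β 3 graphQ s) := by ring
    rw [h2, abs_mul]
    have h3 : |(-(1 / 2) : ℝ)| ≤ 1 := by rw [abs_neg]; norm_num [abs_of_pos]
    calc _ ≤ 1 * |graphAvg N β s graphQ - streamApprox N β 3 graphQ s| :=
          mul_le_mul_of_nonneg_right h3 (abs_nonneg _)
      _ ≤ _ := by rw [one_mul]; exact h1

end Remainder

/-! ### Energy fluctuations -/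

section Energy

variable {N : ℕ}

theorem HasGrad.comp_path {ι : Type*} [Fintype ι] {F : (ι → ℝ) → ℝ} {D : ι → (ι → ℝ) → ℝ}
    (h : HasGrad F D) {γ : ℝ → ι → ℝ} {γ' : ι → ℝ} {y : ℝ} (hγ : HasDerivAt γ γ' y) :
    HasDerivAt (fun y => F (γ y)) (∑ k, D k (γ y) * γ' k) y := by
  refine ((h (γ y)).comp_hasDerivAt y hγ).congr_deriv ?_
  rw [sum_apply]
  simp

theorem skPoint_hasDerivAt (β : ℝ) :
    HasDerivAt (fun β => skPoint N β 0) (hamCoeff N) β := by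
  have h1 : HasDerivAt (fun β : ℝ => β / √N) (1 / √N) β := (hasDerivAt_id β).div_const _
  exact skScale_hasDerivAt h1 (hasDerivAt_const β (√(0 / N)))

theorem skPoint_mul_hasDerivAt (g : SKIndex N → ℝ) (β : ℝ) :
    HasDerivAt (fun β => skPoint N β 0 * g) (hamCoeff N * g) β :=
  (skPoint_hasDerivAt β).mul_const g

theorem abs_hamCoeff_le (k : SKIndex N) : |hamCoeff N k| ≤ 1 / √N := by
  have : 0 ≤ 1 / √(N : ℝ) := by positivity
  rcases k with p | i
  · simp only [hamCoeff, skScale]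
    split_ifs
    · rw [abs_of_nonneg this]
    · simpa using this
  · simpa [hamCoeff, skScale] using this

theorem abs_negHam_le (g : SKIndex N → ℝ) (σ : SpinConfig N) :
    |negHam g σ| ≤ 1 / √N * ∑ k, |g k| := by
  rw [Finset.mul_sum]
  refine (Finset.abs_sum_le_sum_abs _ _).trans (Finset.sum_le_sum fun k _ => ?_)
  rw [abs_mul, abs_mul, abs_skFeature, mul_one]
  exact mul_le_mul_of_nonneg_right (abs_hamCoeff_le k) (abs_nonneg _)

/-- The variance of the energy in the Gibbs state. -/
noncomputable def energyVar (N : ℕ) (β : ℝ) (g : SKIndex N → ℝ) : ℝ :=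
  gibbsAvg (skFeature N) (fun σ => negHam g σ ^ 2) (skPoint N β 0 * g)
    - gibbsAvg (skFeature N) (negHam g) (skPoint N β 0 * g) ^ 2

theorem energyVar_nonneg (β : ℝ) (g : SKIndex N → ℝ) : 0 ≤ energyVar N β g :=
  gibbsAvg_variance_nonneg _ _ _

theorem energyVar_le (β : ℝ) (g : SKIndex N → ℝ) :
    energyVar N β g ≤ (1 / √N) ^ 2 * (∑ k, |g k|) ^ 2 := by
  have h1 : gibbsAvg (skFeature N) (fun σ => negHam g σ ^ 2) (skPoint N β 0 * g)
      ≤ (1 / √N) ^ 2 * (∑ k, |g k|) ^ 2 := by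
    rw [← mul_pow, ← gibbsAvg_const (skFeature N) ((1 / √N * ∑ k, |g k|) ^ 2)
      (skPoint N β 0 * g)]
    refine gibbsAvg_mono _ (fun σ => ?_) _
    rw [← sq_abs]
    exact pow_le_pow_left₀ (abs_nonneg _) (abs_negHam_le g σ) 2
  have h2 := sq_nonneg (gibbsAvg (skFeature N) (negHam g) (skPoint N β 0 * g))
  unfold energyVar
  linarith

/-- A change of `β` moves the fields in the direction of the Hamiltonian itself, so linear response
gives the variance of the energy. -/
theorem gibbsAvg_negHam_hasDerivAt (g : SKIndex N → ℝ) (β : ℝ) :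
    HasDerivAt (fun β => gibbsAvg (skFeature N) (negHam g) (skPoint N β 0 * g))
      (energyVar N β g) β := by
  refine ((hasGrad_gibbsAvg (skFeature N) (negHam g)).comp_path
    (skPoint_mul_hasDerivAt g β)).congr_deriv ?_
  simp only [sub_mul, Finset.sum_sub_distrib, energyVar]
  congr 1
  · have h1 : (fun σ => negHam g σ ^ 2) = fun σ : SpinConfig N =>
        ∑ k, (hamCoeff N k * g k) * (negHam g σ * skFeature N k σ) := by
      funext σ
      conv_lhs => rw [sq]; arg 2; unfold negHam
      rw [Finset.mul_sum]
      exact Finset.sum_congr rfl fun k _ => by ring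
    rw [h1, gibbsAvg_sum]
    refine Finset.sum_congr rfl fun k _ => ?_
    rw [gibbsAvg_const_mul, Pi.mul_apply, mul_comm]
  · rw [sq]
    conv_rhs => arg 2; rw [gibbsAvg_negHam]
    rw [Finset.mul_sum]
    exact Finset.sum_congr rfl fun k _ => by rw [Pi.mul_apply]; ring

theorem continuous_gibbsAvg_family {ι S : Type*} [Fintype ι] [Fintype S] [Nonempty S]
    (s : ι → S → ℝ) {X : Type*} [TopologicalSpace X] {h : X → S → ℝ} {c : X → ι → ℝ}
    (hh : ∀ σ, Continuous fun x => h x σ) (hc : Continuous c) :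
    Continuous fun x => gibbsAvg s (h x) (c x) := by
  unfold gibbsAvg
  refine continuous_finsetSum _ fun σ _ => Continuous.mul ?_ (hh σ)
  exact (hasGrad_linGibbs s σ).continuous.comp hc

theorem continuous_negHam (σ : SpinConfig N) :
    Continuous fun g : SKIndex N → ℝ => negHam g σ := by
  unfold negHam
  fun_prop

theorem continuous_gibbsAvg_negHam (β : ℝ) : Continuous fun g : SKIndex N → ℝ =>
    gibbsAvg (skFeature N) (negHam g) (skPoint N β 0 * g) :=
  continuous_gibbsAvg_family (skFeature N) (h := fun g => negHam g) continuous_negHam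
    (continuous_const.mul continuous_id)

theorem continuous_energyVar (β : ℝ) : Continuous (energyVar N β) :=
  (continuous_gibbsAvg_family (skFeature N) (h := fun g σ => negHam g σ ^ 2)
    (fun σ => (continuous_negHam σ).pow 2) (continuous_const.mul continuous_id)).sub
    ((continuous_gibbsAvg_negHam β).pow 2)

theorem integrable_energyVar (β : ℝ) : Integrable (energyVar N β) (stdGauss (SKIndex N)) :=
  integrable_stdGauss_of_le (A := 0) (B := 0) (C := (1 / √N) ^ 2) (continuous_energyVar β)
    fun g => by
      rw [abs_of_nonneg (energyVar_nonneg β g), zero_mul, zero_add, zero_add]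
      exact energyVar_le β g

/-- The average variance of the energy. -/
noncomputable def meanEnergyVar (N : ℕ) (β : ℝ) : ℝ := ∫ g, energyVar N β g ∂(stdGauss (SKIndex N))

theorem meanEnergyVar_nonneg (β : ℝ) : 0 ≤ meanEnergyVar N β :=
  integral_nonneg fun g => energyVar_nonneg β g

theorem meanNegHam_hasDerivAt (β : ℝ) :
    HasDerivAt (meanNegHam N) (meanEnergyVar N β) β := by
  refine (hasDerivAt_integral_of_dominated_loc_of_deriv_le (μ := stdGauss (SKIndex N))
    (F := fun β g => gibbsAvg (skFeature N) (negHam g) (skPoint N β 0 * g))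
    (F' := fun β g => energyVar N β g) (x₀ := β) (s := Set.univ)
    (bound := fun g => (1 / √N) ^ 2 * (∑ k, |g k|) ^ 2) univ_mem
    (Eventually.of_forall fun β => (continuous_gibbsAvg_negHam β).aestronglyMeasurable)
    ?_ (continuous_energyVar β).aestronglyMeasurable
    (ae_of_all _ fun g β _ => ?_) (integrable_sum_abs_sq_stdGauss.const_mul _)
    (ae_of_all _ fun g β _ => gibbsAvg_negHam_hasDerivAt g β)).2
  · refine integrable_stdGauss_of_le (A := 0) (B := 1 / √N) (C := 0)
      (continuous_gibbsAvg_negHam β) fun g => ?_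
    rw [zero_mul, zero_add, add_zero]
    exact abs_gibbsAvg_le _ (abs_negHam_le g) _
  · rw [Real.norm_of_nonneg (energyVar_nonneg β g)]
    exact energyVar_le β g

theorem meanNegHam_monotone : Monotone (meanNegHam N) :=
  monotone_of_deriv_nonneg (fun β => (meanNegHam_hasDerivAt β).differentiableAt) fun β => by
    rw [(meanNegHam_hasDerivAt β).deriv]
    exact meanEnergyVar_nonneg β

theorem meanNegHam_nonneg (hN : 1 ≤ N) {β : ℝ} (hβ : 0 ≤ β) : 0 ≤ meanNegHam N β := by
  have := (meanNegHam_monotone (N := N)) hβ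
  rwa [meanNegHam_eq hN 0, mul_zero, zero_div, zero_mul] at this

theorem meanNegHam_le (hN : 1 ≤ N) {β : ℝ} (hβ : 0 ≤ β) : meanNegHam N β ≤ N * β := by
  rw [meanNegHam_eq hN]
  have h1 := (abs_le.1 (abs_graphAvg_le (N := N) β 0 graphQ2)).1
  have : (0 : ℝ) ≤ N * β := by positivity
  nlinarith

theorem intervalIntegrable_meanEnergyVar (a b : ℝ) :
    IntervalIntegrable (meanEnergyVar N) volume a b :=
  intervalIntegral.intervalIntegrable_deriv_of_nonneg
    (fun β _ => (meanNegHam_hasDerivAt β).continuousAt.continuousWithinAt)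
    (fun β _ => meanNegHam_hasDerivAt β) fun β _ => meanEnergyVar_nonneg β

/-- The variance is the derivative of the mean energy, which lies between `0` and `N β`. At a single
`β` the variance may be large, but on average over `β` it is of order `N`. -/
theorem integral_meanEnergyVar_le (hN : 1 ≤ N) {a b : ℝ} (ha : 0 ≤ a) (hab : a ≤ b) :
    ∫ β in a..b, meanEnergyVar N β ≤ N * b := by
  rw [intervalIntegral.integral_eq_sub_of_hasDerivAt (fun β _ => meanNegHam_hasDerivAt β)
    (intervalIntegrable_meanEnergyVar a b)]
  have := meanNegHam_nonneg hN ha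
  have := meanNegHam_le hN (ha.trans hab)
  linarith

/-- The integrand of the `β`-derivative of the average of a graph. -/
theorem monAvg_grad_mul (G : OverlapGraph) (g x : SKIndex N → ℝ) :
    ∑ k, (repAvg (skFeature N) G.verts
        (fun τ => G.value τ * ∑ a ∈ G.verts, skFeature N k (τ a)) x
        - G.verts.card * (repAvg (skFeature N) G.verts (fun τ => G.value τ) x
          * gibbsAvg (skFeature N) (skFeature N k) x)) * (hamCoeff N k * g k)
      = repAvg (skFeature N) G.verts (fun τ => G.value τ *
          ∑ a ∈ G.verts, (negHam g (τ a) - gibbsAvg (skFeature N) (negHam g) x)) x := by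
  have h1 : (fun τ : ℕ → SpinConfig N => G.value τ *
      ∑ a ∈ G.verts, (negHam g (τ a) - gibbsAvg (skFeature N) (negHam g) x))
      = fun τ => (∑ k, G.value τ * (∑ a ∈ G.verts, skFeature N k (τ a)) * (hamCoeff N k * g k))
        - G.value τ * (G.verts.card * gibbsAvg (skFeature N) (negHam g) x) := by
    funext τ
    rw [Finset.sum_sub_distrib, Finset.sum_const, nsmul_eq_mul, mul_sub]
    congr 1
    unfold negHam
    rw [Finset.sum_comm, Finset.mul_sum]
    refine Finset.sum_congr rfl fun k _ => ?_
    rw [← Finset.mul_sum]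
    ring
  rw [h1, repAvg_sub, repAvg_sum, repAvg_mul_right, gibbsAvg_negHam]
  simp only [repAvg_mul_right, sub_mul, Finset.sum_sub_distrib]
  congr 1
  rw [Finset.mul_sum, Finset.mul_sum]
  exact Finset.sum_congr rfl fun k _ => by ring

/-- Monomials are bounded by one, so the covariance with the energy is at most the first absolute
moment of the energy fluctuation, once per replica. -/
theorem abs_monAvg_grad_mul_le (G : OverlapGraph) (g x : SKIndex N → ℝ) :
    |repAvg (skFeature N) G.verts (fun τ => G.value τ *
          ∑ a ∈ G.verts, (negHam g (τ a) - gibbsAvg (skFeature N) (negHam g) x)) x|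
      ≤ G.verts.card * gibbsAvg (skFeature N)
          (fun σ => |negHam g σ - gibbsAvg (skFeature N) (negHam g) x|) x := by
  refine (abs_repAvg_le_repAvg_abs _ _ _ _).trans ?_
  refine (repAvg_mono (skFeature N) G.verts (h := fun τ => ∑ a ∈ G.verts,
    |negHam g (τ a) - gibbsAvg (skFeature N) (negHam g) x|) (fun τ => ?_) x).trans (le_of_eq ?_)
  · rw [abs_mul]
    exact (mul_le_of_le_one_left (abs_nonneg _) (abs_value_le τ G)).trans
      (Finset.abs_sum_le_sum_abs _ _)
  · rw [repAvg_sum, ← nsmul_eq_mul, ← Finset.sum_const]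
    exact Finset.sum_congr rfl fun a ha => repAvg_single (skFeature N) ha
      (fun σ => |negHam g σ - gibbsAvg (skFeature N) (negHam g) x|) x

theorem abs_grad_repAvg_le (G : OverlapGraph) (k : SKIndex N) (x : SKIndex N → ℝ) :
    |repAvg (skFeature N) G.verts
      (fun τ => G.value τ * ∑ a ∈ G.verts, skFeature N k (τ a)) x
      - G.verts.card * (repAvg (skFeature N) G.verts (fun τ => G.value τ) x
        * gibbsAvg (skFeature N) (skFeature N k) x)| ≤ 2 * G.verts.card := by
  have h1 : |repAvg (skFeature N) G.verts
    (fun τ => G.value τ * ∑ a ∈ G.verts, skFeature N k (τ a)) x| ≤ G.verts.card := by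
    refine abs_repAvg_le _ _ (fun τ => ?_) x
    rw [abs_mul]
    have h2 : |∑ a ∈ G.verts, skFeature N k (τ a)| ≤ G.verts.card := by
      refine (Finset.abs_sum_le_sum_abs _ _).trans ?_
      simp [abs_skFeature]
    exact (mul_le_of_le_one_left (abs_nonneg _) (abs_value_le τ G)).trans h2
  have h3 : |(G.verts.card : ℝ) * (repAvg (skFeature N) G.verts (fun τ => G.value τ) x
      * gibbsAvg (skFeature N) (skFeature N k) x)| ≤ G.verts.card := by
    rw [abs_mul, abs_mul, abs_of_nonneg (Nat.cast_nonneg _)]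
    refine mul_le_of_le_one_right (Nat.cast_nonneg _) ?_
    exact mul_le_one₀ (abs_monAvg_le G.verts G x) (abs_nonneg _) (abs_gibbsAvg_feature_le k x)
  have := abs_sub (repAvg (skFeature N) G.verts
    (fun τ => G.value τ * ∑ a ∈ G.verts, skFeature N k (τ a)) x) ((G.verts.card : ℝ) *
      (repAvg (skFeature N) G.verts (fun τ => G.value τ) x
      * gibbsAvg (skFeature N) (skFeature N k) x))
  linarith

theorem continuous_grad_repAvg (G : OverlapGraph) (k : SKIndex N) :
    Continuous fun x => repAvg (skFeature N) G.verts
      (fun τ => G.value τ * ∑ a ∈ G.verts, skFeature N k (τ a)) x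
      - G.verts.card * (repAvg (skFeature N) G.verts (fun τ => G.value τ) x
        * gibbsAvg (skFeature N) (skFeature N k) x) :=
  (continuous_repAvg _ _ _).sub
    (((continuous_repAvg _ _ _).mul (continuous_gibbsAvg _ _)).const_mul _)

/-- The derivative with respect to `β` is controlled by the fluctuations of the energy. -/
theorem graphAvg_hasDerivAt_beta (G : OverlapGraph) (β : ℝ) {r : ℝ} (hr : 0 < r) :
    ∃ D, HasDerivAt (fun β => graphAvg N β 0 G) D β ∧
      |D| ≤ G.verts.card * (r / 2 + meanEnergyVar N β / (2 * r)) := by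
  have h1 := (gaussAvg_hasFDerivAt (hasGrad_repAvg (skFeature N) G.verts fun τ => G.value τ)
    (continuous_grad_repAvg G) (abs_grad_repAvg_le G) (skPoint N β 0)).comp_hasDerivAt β
      (skPoint_hasDerivAt β)
  have e : (fun β => graphAvg N β 0 G) = gaussAvg (monAvg N G.verts G) ∘ fun β => skPoint N β 0 :=
    funext fun β => graphAvg_eq β 0 G
  rw [e]
  refine ⟨_, h1, ?_⟩
  have hint : ∀ k, Integrable (fun g : SKIndex N → ℝ => g k * (repAvg (skFeature N) G.verts
        (fun τ => G.value τ * ∑ a ∈ G.verts, skFeature N k (τ a)) (skPoint N β 0 * g)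
        - G.verts.card * (repAvg (skFeature N) G.verts (fun τ => G.value τ) (skPoint N β 0 * g)
          * gibbsAvg (skFeature N) (skFeature N k) (skPoint N β 0 * g)))) (stdGauss _) := by
    intro k
    refine ((integrable_abs_stdGauss k).mul_const (2 * (G.verts.card : ℝ))).mono'
      (((continuous_apply k).mul ((continuous_grad_repAvg G k).comp
        (continuous_const.mul continuous_id))).aestronglyMeasurable) (ae_of_all _ fun g => ?_)
    rw [Real.norm_eq_abs, abs_mul]
    exact mul_le_mul_of_nonneg_left (abs_grad_repAvg_le G k _) (abs_nonneg _)
  rw [sum_apply]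
  simp only [smul_apply, ContinuousLinearMap.proj_apply, smul_eq_mul]
  simp only [← integral_mul_const]
  rw [← integral_finsetSum _ fun k _ => (hint k).mul_const _]
  refine (abs_integral_le_integral_abs).trans ?_
  refine (integral_mono_of_nonneg (g := fun g => G.verts.card * (r / 2 + energyVar N β g / (2 * r)))
    (ae_of_all _ fun g => abs_nonneg _) ?_ (ae_of_all _ fun g => ?_)).trans (le_of_eq ?_)
  · exact ((integrable_const _).add ((integrable_energyVar β).div_const _)).const_mul _
  · beta_reduce
    have h2 := monAvg_grad_mul G g (skPoint N β 0 * g)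
    have h3 : (∑ k, g k * (repAvg (skFeature N) G.verts
        (fun τ => G.value τ * ∑ a ∈ G.verts, skFeature N k (τ a)) (skPoint N β 0 * g)
        - G.verts.card * (repAvg (skFeature N) G.verts (fun τ => G.value τ) (skPoint N β 0 * g)
          * gibbsAvg (skFeature N) (skFeature N k) (skPoint N β 0 * g))) * hamCoeff N k) = _ :=
      (Finset.sum_congr rfl fun k _ => by ring).trans h2
    rw [h3]
    refine (abs_monAvg_grad_mul_le G g _).trans ?_
    exact mul_le_mul_of_nonneg_left (gibbsAvg_abs_sub_le _ _ _ hr) (Nat.cast_nonneg _)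
  · rw [integral_const_mul, integral_add (integrable_const _)
      ((integrable_energyVar β).div_const _),
      integral_div (2 * r) (energyVar N β)]
    simp [meanEnergyVar]

theorem abs_bracket_le (m : OverlapGraph → ℝ) (hm : ∀ G, |m G| ≤ 1) (G : OverlapGraph) :
    |bracket m G| ≤ streamBound G.verts := by
  have := abs_streamSum_le (V := G.verts) (f := fun e => m (e ::ₘ e ::ₘ G)) (B := 1)
    fun a b _ => hm _
  rwa [mul_one] at this

/-- Two expressions for `∂⟨G⟩/∂β` are compared: `β N` times the bracket, and a covariance with the
energy. The choice `r = √N` balances the two terms because the variance is of order `N` on average.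
-/
theorem abs_bracket_mul_le (hN : 1 ≤ N) {β : ℝ} (hβ : 0 < β) (G : OverlapGraph) :
    β * N * |bracket (graphAvg N β 0) G|
      ≤ G.verts.card * (√N / 2 + meanEnergyVar N β / (2 * √N)) := by
  have hN' : (0 : ℝ) < √N := Real.sqrt_pos.2 (by exact_mod_cast hN)
  obtain ⟨D, hD, hle⟩ := graphAvg_hasDerivAt_beta (N := N) G β hN'
  have h0 := graphAvg_hasDerivAt_sq hN 0 (pow_pos hβ 2) G
  rw [Real.sqrt_sq hβ.le] at h0
  have h1 := HasDerivAt.comp (h₂ := fun y => graphAvg N (√y) 0 G) (h := fun b : ℝ => b ^ 2) β h0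
    (hasDerivAt_pow 2 β)
  have e : (fun β => graphAvg N β 0 G) =ᶠ[𝓝 β] (fun y => graphAvg N (√y) 0 G) ∘ fun β => β ^ 2 := by
    filter_upwards [lt_mem_nhds hβ] with b hb
    simp [Real.sqrt_sq hb.le]
  have h2 := hD.unique (h1.congr_of_eventuallyEq e)
  have h3 : D = β * N * bracket (graphAvg N β 0) G := by
    rw [h2]
    push_cast
    ring
  rwa [h3, abs_mul, abs_of_nonneg (by positivity)] at hle

theorem continuous_bracket (G : OverlapGraph) :
    Continuous fun β => bracket (graphAvg N β 0) G :=
  continuous_streamSum fun e => Continuous.uncurry_along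
    (f := fun β t => graphAvg N β t (e ::ₘ e ::ₘ G)) (a := fun β => β) (b := fun _ => 0)
    (continuous_graphAvg _) continuous_id continuous_const

end Energy

/-! ### Quantities that vanish in the average over `β` -/

/-- The integrals of `|u N|` over bounded intervals tend to zero. -/
def VanishesOnAverage (u : ℕ → ℝ → ℝ) : Prop :=
  (∀ N, Continuous (u N)) ∧ ∀ b₁ b₂ : ℝ, 0 ≤ b₁ → b₁ ≤ b₂ →
    Tendsto (fun N => ∫ β in b₁..b₂, |u N β|) atTop (𝓝 0)

namespace VanishesOnAverage

variable {u v : ℕ → ℝ → ℝ}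

theorem add (hu : VanishesOnAverage u) (hv : VanishesOnAverage v) :
    VanishesOnAverage fun N β => u N β + v N β := by
  refine ⟨fun N => (hu.1 N).add (hv.1 N), fun b₁ b₂ h1 h2 => ?_⟩
  refine squeeze_zero (fun N => intervalIntegral.integral_nonneg h2 fun _ _ => abs_nonneg _)
    (fun N => ?_) (by simpa using (hu.2 b₁ b₂ h1 h2).add (hv.2 b₁ b₂ h1 h2))
  have hu' := (hu.1 N).abs.intervalIntegrable (μ := volume) b₁ b₂
  have hv' := (hv.1 N).abs.intervalIntegrable (μ := volume) b₁ b₂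
  rw [← intervalIntegral.integral_add hu' hv']
  exact intervalIntegral.integral_mono_on h2
    (((hu.1 N).add (hv.1 N)).abs.intervalIntegrable _ _) (hu'.add hv') fun _ _ => abs_add_le _ _

theorem mul_left (hu : VanishesOnAverage u) {c : ℝ → ℝ} (hc : Continuous c) :
    VanishesOnAverage fun N β => c β * u N β := by
  refine ⟨fun N => hc.mul (hu.1 N), fun b₁ b₂ h1 h2 => ?_⟩
  obtain ⟨K, hK⟩ := (isCompact_Icc (a := b₁) (b := b₂)).exists_bound_of_continuousOn
    hc.continuousOn
  refine squeeze_zero (fun N => intervalIntegral.integral_nonneg h2 fun _ _ => abs_nonneg _)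
    (fun N => ?_) (by simpa using (hu.2 b₁ b₂ h1 h2).const_mul K)
  rw [← intervalIntegral.integral_const_mul]
  refine intervalIntegral.integral_mono_on h2 ((hc.mul (hu.1 N)).abs.intervalIntegrable _ _)
    (((hu.1 N).abs.const_mul K).intervalIntegrable _ _) fun β hβ => ?_
  beta_reduce
  rw [abs_mul]
  exact mul_le_mul_of_nonneg_right (hK β hβ) (abs_nonneg _)

theorem const_mul (hu : VanishesOnAverage u) (c : ℝ) :
    VanishesOnAverage fun N β => c * u N β :=
  hu.mul_left continuous_const

theorem sum {α : Type*} {A : Finset α} {u : α → ℕ → ℝ → ℝ}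
    (h : ∀ a ∈ A, VanishesOnAverage (u a)) :
    VanishesOnAverage fun N β => ∑ a ∈ A, u a N β := by
  classical
  induction A using Finset.induction_on with
  | empty => exact ⟨fun N => by simpa using continuous_const, fun _ _ _ _ => by simp⟩
  | insert a A ha ih =>
    have h1 := (h a (Finset.mem_insert_self _ _)).add
      (ih fun b hb => h b (Finset.mem_insert_of_mem hb))
    simpa only [Finset.sum_insert ha] using h1

end VanishesOnAverage

/-- Dividing by `β N ≥ ε N` a quantity whose integral is of order `√N` leaves `1/√N`. -/
theorem integral_abs_bracket_le {N : ℕ} (hN : 1 ≤ N) (G : OverlapGraph) {ε b : ℝ} (hε : 0 < ε)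
    (hb : ε ≤ b) :
    ∫ β in ε..b, |bracket (graphAvg N β 0) G| ≤ G.verts.card * b / ε * (1 / √N) := by
  have hN' : (0 : ℝ) < N := by exact_mod_cast hN
  have hs : (0 : ℝ) < √N := Real.sqrt_pos.2 hN'
  have h1 : ∀ β ∈ Set.Icc ε b, |bracket (graphAvg N β 0) G|
      ≤ G.verts.card / (ε * N) * (√N / 2 + meanEnergyVar N β / (2 * √N)) := by
    intro β hβ
    have h2 := abs_bracket_mul_le hN (hε.trans_le hβ.1) G
    have h3 : ε * N * |bracket (graphAvg N β 0) G| ≤ β * N * |bracket (graphAvg N β 0) G| := by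
      have := hβ.1
      gcongr
    rw [div_mul_eq_mul_div, le_div_iff₀ (by positivity), mul_comm]
    exact h3.trans h2
  have hi : IntervalIntegrable (fun β => meanEnergyVar N β / (2 * √N)) volume ε b :=
    (intervalIntegrable_meanEnergyVar ε b).div_const _
  have hi2 := (intervalIntegrable_const (c := √(N : ℝ) / 2) (μ := volume) (a := ε) (b := b)).add hi
  refine (intervalIntegral.integral_mono_on hb ((continuous_bracket G).abs.intervalIntegrable _ _)
    (hi2.const_mul (G.verts.card / (ε * N))) h1).trans ?_
  rw [intervalIntegral.integral_const_mul]
  rw [intervalIntegral.integral_add (by simp) hi, intervalIntegral.integral_const,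
    intervalIntegral.integral_div, smul_eq_mul]
  have h4 := integral_meanEnergyVar_le hN hε.le hb
  have h5 : ∀ x c : ℝ, 0 < x → c / (ε * (x * x)) * (b * (x / 2) + x * x * b / (2 * x))
      = c * b / ε * (1 / x) := fun x c hx => by field_simp; ring
  calc _ ≤ G.verts.card / (ε * N) * (b * (√N / 2) + N * b / (2 * √N)) := by
        have : (b - ε) * (√N / 2) ≤ b * (√N / 2) := by gcongr; linarith
        have hv := div_le_div_of_nonneg_right h4 (by positivity : 0 ≤ 2 * √(N : ℝ))
        refine mul_le_mul_of_nonneg_left ?_ (by positivity)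
        linarith
    _ = _ := by
        have h6 := h5 √N G.verts.card hs
        rwa [Real.mul_self_sqrt hN'.le] at h6

theorem vanishesOnAverage_bracket (G : OverlapGraph) :
    VanishesOnAverage fun N β => bracket (graphAvg N β 0) G := by
  refine ⟨fun N => continuous_bracket G, fun b₁ b₂ h1 h2 => ?_⟩
  have hnn := fun N => intervalIntegral.integral_nonneg (μ := volume) h2
    fun β _ => abs_nonneg (bracket (graphAvg N β 0) G)
  rw [Metric.tendsto_atTop]
  intro δ hδ
  set K := streamBound G.verts
  have hK : 0 ≤ K := streamBound_nonneg _
  -- The estimate degenerates at `β = 0`. On `[0, ε]` the trivial bound `K` suffices, as `ε * K ≤ δ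
  -- / 2`; the upper limit is enlarged to `b₂ + ε` so that it is at least `ε`.
  set ε := δ / (2 * (K + 1))
  have hε : 0 < ε := by positivity
  have hlim : Tendsto (fun N : ℕ => G.verts.card * (b₂ + ε) / ε * (1 / √(N : ℝ))) atTop (𝓝 0) := by
    have : Tendsto (fun N : ℕ => 1 / √(N : ℝ)) atTop (𝓝 0) := by
      simp only [one_div]
      exact (Real.tendsto_sqrt_atTop.comp tendsto_natCast_atTop_atTop).inv_tendsto_atTop
    simpa using this.const_mul (G.verts.card * (b₂ + ε) / ε)
  obtain ⟨N₀, hN₀⟩ := eventually_atTop.1 ((hlim.eventually_lt_const (half_pos hδ)).and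
    (eventually_ge_atTop 1))
  refine ⟨N₀, fun N hN => ?_⟩
  obtain ⟨h3, h4⟩ := hN₀ N hN
  rw [Real.dist_0_eq_abs, abs_of_nonneg (hnn N)]
  have hint : ∀ a b, IntervalIntegrable (fun β => |bracket (graphAvg N β 0) G|) volume a b :=
    fun a b => (continuous_bracket G).abs.intervalIntegrable a b
  have h5 : ∫ β in b₁..b₂, |bracket (graphAvg N β 0) G|
      ≤ ∫ β in (0)..(b₂ + ε), |bracket (graphAvg N β 0) G| :=
    intervalIntegral.integral_mono_interval h1 h2 (by linarith)
      (ae_of_all _ fun _ => abs_nonneg _) (hint _ _)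
  rw [← intervalIntegral.integral_add_adjacent_intervals (hint 0 ε) (hint ε (b₂ + ε))] at h5
  have h6 : ∫ β in (0)..ε, |bracket (graphAvg N β 0) G| ≤ δ / 2 := by
    refine (intervalIntegral.integral_mono_on hε.le (hint _ _)
      (intervalIntegrable_const (c := K)) fun β _ =>
        abs_bracket_le _ (abs_graphAvg_le β 0) G).trans ?_
    rw [intervalIntegral.integral_const, smul_eq_mul, sub_zero]
    change δ / (2 * (K + 1)) * K ≤ _
    rw [div_mul_eq_mul_div, div_le_iff₀ (by positivity)]
    nlinarith
  have h7 := integral_abs_bracket_le h4 G hε (b := b₂ + ε) (by linarith)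
  linarith

theorem vanishesOnAverage_thermoConstraint (n : ℕ) :
    VanishesOnAverage fun N β => thermoConstraint (graphAvg N β 0) n :=
  VanishesOnAverage.sum fun C _ => (vanishesOnAverage_bracket C.out).const_mul (alphaCoeff n C)

theorem vanishesOnAverage_total_sub_partial (M : ℕ) {b₁ b₂ : ℝ} (h1 : 0 ≤ b₁) (h2 : b₁ ≤ b₂) :
    Tendsto (fun N : ℕ => ∫ β in b₁..b₂, |(totalDeriv M N β - partialDeriv M N β) / (N : ℝ)|)
      atTop (𝓝 0) := by
  have h := VanishesOnAverage.const_mul (VanishesOnAverage.sum (A := Finset.range (M + 1))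
    fun n _ => (vanishesOnAverage_thermoConstraint n).mul_left
      (c := fun β => (β ^ 2) ^ n) (by fun_prop)) (1 / 2)
  refine (h.2 b₁ b₂ h1 h2).congr' ?_
  filter_upwards [eventually_ge_atTop 1] with N hN
  refine intervalIntegral.integral_congr_ae (ae_of_all _ fun β hβ => ?_)
  rw [Set.uIoc_of_le h2] at hβ
  rw [total_sub_partial_div M hN (h1.trans_lt hβ.1)]

theorem VanishesOnAverage.congr {u v : ℕ → ℝ → ℝ} (hu : VanishesOnAverage u)
    (h : ∀ N β, v N β = u N β) : VanishesOnAverage v := by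
  rwa [show v = u from funext fun N => funext fun β => h N β]

theorem vanishesOnAverage_firstAC : VanishesOnAverage fun N β => firstAC (graphAvg N β 0) :=
  (vanishesOnAverage_bracket graphQ2).congr fun N β =>
    (bracket_graphQ2 (graphAvg_replicaSymmetric N β 0)).symm

theorem vanishesOnAverage_secondAC : VanishesOnAverage fun N β => secondAC (graphAvg N β 0) :=
  (vanishesOnAverage_thermoConstraint 3).congr fun N β =>
    (thermoConstraint_three (graphAvg_replicaSymmetric N β 0)).symm

theorem vanishesOnAverage_fourthOrderSum :
    VanishesOnAverage fun N β => fourthOrderSum (graphAvg N β 0) :=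
  (vanishesOnAverage_thermoConstraint 4).congr fun N β =>
    (thermoConstraint_four (graphAvg_replicaSymmetric N β 0)).symm

/-! ### Adding a spin -/

section GibbsEquiv

variable {ι κ S S' E : Type*} [Fintype ι] [Fintype κ] [Fintype S] [Fintype S'] [Fintype E]
  {s : ι → S → ℝ} {s' : κ → S' → ℝ} {x : ι → ℝ} {x' : κ → ℝ}

theorem linPart_of_equiv (e : E × S ≃ S')
    (hw : ∀ p, linWeight s' x' (e p) = linWeight s x p.2) :
    linPart s' x' = Fintype.card E * linPart s x := by
  unfold linPart
  rw [← e.sum_comp, Fintype.sum_prod_type]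
  simp [hw]

/-- The variable in `E` influences neither the weight nor the observable, so it sums to the same
factor in numerator and denominator. It is the last spin in the gauge and trivial for a permutation
of sites. -/
theorem gibbsAvg_of_equiv [Nonempty S] [Nonempty E] (e : E × S ≃ S')
    (hw : ∀ p, linWeight s' x' (e p) = linWeight s x p.2) {h : S → ℝ} {h' : S' → ℝ}
    (hh : ∀ p, h' (e p) = h p.2) : gibbsAvg s' h' x' = gibbsAvg s h x := by
  have hE : (Fintype.card E : ℝ) ≠ 0 := by exact_mod_cast Fintype.card_ne_zero
  have hp := (linPart_pos s x).ne'
  unfold gibbsAvg linGibbs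
  rw [linPart_of_equiv e hw, ← e.sum_comp, Fintype.sum_prod_type]
  simp only [hw, hh, Finset.sum_const, Finset.card_univ, nsmul_eq_mul]
  rw [Finset.mul_sum]
  refine Finset.sum_congr rfl fun σ _ => ?_
  field_simp

theorem integral_comp_injective (j : κ → ι) (hj : Function.Injective j) {F : (κ → ℝ) → ℝ}
    (hF : Continuous F) (c : κ → ℝ) :
    ∫ g : ι → ℝ, F (c * fun k => g (j k)) ∂(stdGauss ι) = gaussAvg F c := by
  have h := measurePreserving_comp_injective j hj
  rw [gaussAvg, ← h.map_eq, integral_map h.measurable.aemeasurable]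
  exact (hF.comp (continuous_const.mul continuous_id)).aestronglyMeasurable

end GibbsEquiv

section Cavity

variable {N : ℕ}

/-- The configurations of `N + 1` spins, in the gauge given by the last spin. -/
def gaugeEquiv (N : ℕ) : ℤˣ × SpinConfig N ≃ SpinConfig (N + 1) where
  toFun p := Fin.snoc (α := fun _ => ℤˣ) (fun i => p.1 * p.2 i) p.1
  invFun σ := (σ (Fin.last N), fun i => σ (Fin.last N) * σ i.castSucc)
  left_inv p := by
    ext1
    · simp
    · funext i
      simp [← mul_assoc]
  right_inv σ := by
    funext i
    refine Fin.lastCases ?_ (fun i => ?_) i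
    · simp
    · simp [← mul_assoc]

theorem spin_gauge_last (p : ℤˣ × SpinConfig N) :
    spin (gaugeEquiv N p) (Fin.last N) = ((p.1 : ℤ) : ℝ) := by
  simp [spin, gaugeEquiv]

theorem spin_gauge_castSucc (p : ℤˣ × SpinConfig N) (i : Fin N) :
    spin (gaugeEquiv N p) i.castSucc = ((p.1 : ℤ) : ℝ) * spin p.2 i := by
  simp [spin, gaugeEquiv]

theorem units_mul_self (u : ℤˣ) : ((u : ℤ) : ℝ) * ((u : ℤ) : ℝ) = 1 := by
  rcases Int.units_eq_one_or u with h | h <;> simp [h]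

/-- The couplings among the first `N` spins, and those with the last spin as fields. -/
def cavityIndex (N : ℕ) : SKIndex N → SKIndex (N + 1)
  | Sum.inl p => Sum.inl (p.1.castSucc, p.2.castSucc)
  | Sum.inr i => Sum.inl (i.castSucc, Fin.last N)

theorem cavityIndex_injective : Function.Injective (cavityIndex N) := by
  rintro (⟨i, j⟩ | i) (⟨k, l⟩ | k) h <;>
    simp [cavityIndex, Fin.ext_iff] at h ⊢
  · exact h
  · omega
  · omega
  · exact h

/-- Multiplying the other spins by the last one leaves the products of pairs unchanged and turns the
couplings to the last spin into fields of the same scale `a`. The last spin drops out of the weight.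
-/
theorem linWeight_cavity (a : ℝ) (g : SKIndex (N + 1) → ℝ) (p : ℤˣ × SpinConfig N) :
    linWeight (skFeature (N + 1)) (skScale (N + 1) a 0 * g) (gaugeEquiv N p)
      = linWeight (skFeature N) (skScale N a a * fun k => g (cavityIndex N k)) p.2 := by
  unfold linWeight
  congr 1
  rw [Fintype.sum_sum_type, Fintype.sum_sum_type, Fintype.sum_prod_type, Fintype.sum_prod_type,
    Fin.sum_univ_castSucc]
  simp only [Fin.sum_univ_castSucc, skScale, skFeature, Pi.mul_apply, spin_gauge_last,
    spin_gauge_castSucc, cavityIndex, zero_mul, mul_zero, add_zero,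
    Fin.castSucc_lt_castSucc_iff, Fin.castSucc_lt_last, if_true, lt_irrefl, if_false,
    Finset.sum_add_distrib, (Fin.castSucc_lt_last _).not_gt, Finset.sum_const_zero]
  have h := units_mul_self p.1
  congr 1
  · refine Finset.sum_congr rfl fun i _ => Finset.sum_congr rfl fun k _ => ?_
    linear_combination (spin p.2 i * spin p.2 k * ((if i < k then a else 0) *
      g (Sum.inl (i.castSucc, k.castSucc)))) * h
  · refine Finset.sum_congr rfl fun i _ => ?_
    linear_combination (spin p.2 i * (a * g (Sum.inl (i.castSucc, Fin.last N)))) * h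

/-- The free energy of `N + 1` spins in terms of `N` spins in a field. -/
theorem gaussAvg_log_succ (a : ℝ) :
    gaussAvg (fun x => Real.log (linPart (skFeature (N + 1)) x)) (skScale (N + 1) a 0)
      = Real.log 2 + gaussAvg (fun x => Real.log (linPart (skFeature N) x)) (skScale N a a) := by
  rw [← integral_comp_injective (cavityIndex N) cavityIndex_injective continuous_log_linPart]
  have h1 : ∀ g : SKIndex (N + 1) → ℝ,
      Real.log (linPart (skFeature (N + 1)) (skScale (N + 1) a 0 * g))
      = Real.log 2 + Real.log (linPart (skFeature N)
          (skScale N a a * fun k => g (cavityIndex N k))) := by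
    intro g
    rw [linPart_of_equiv (gaugeEquiv N) (linWeight_cavity a g),
      Real.log_mul (by simp) (linPart_pos _ _).ne']
    simp
  have h2 : Integrable (fun g : SKIndex (N + 1) → ℝ => Real.log (linPart (skFeature N)
      (skScale N a a * fun k => g (cavityIndex N k)))) (stdGauss (SKIndex (N + 1))) := by
    have h3 := measurePreserving_comp_injective (cavityIndex N) cavityIndex_injective
    exact h3.integrable_comp_of_integrable (integrable_log_linPart (skScale N a a))
  unfold gaussAvg
  simp only [h1]
  rw [integral_add (integrable_const _) h2]
  simp

theorem repAvg_two {s : SKIndex N → SpinConfig N → ℝ} (h : SpinConfig N → ℝ) (x : SKIndex N → ℝ) :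
    repAvg s {1, 2} (fun τ => h (τ 1) * h (τ 2)) x = gibbsAvg s h x ^ 2 := by
  have h1 := repAvg_insert_mul s (V := {2}) (u := 1) (by simp)
    (f := fun τ => h (τ 2)) (fun τ σ => by simp) h x
  rw [repAvg_single _ (by simp)] at h1
  rw [sq, ← h1]
  congr 1
  funext τ
  rw [mul_comm]

theorem monAvg_graphQ (x : SKIndex N → ℝ) : monAvg N graphQ.verts graphQ x
    = 1 / N * ∑ i, gibbsAvg (skFeature N) (fun σ => spin σ i) x ^ 2 := by
  simp only [← repAvg_two]
  rw [← repAvg_sum, mul_comm, ← repAvg_mul_right, monAvg, verts_graphQ]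
  congr 1
  funext τ
  simp [graphQ, OverlapGraph.value, overlap, mul_comm]

theorem monAvg_graphQ2 (x : SKIndex N → ℝ) : monAvg N graphQ2.verts graphQ2 x
    = 1 / N ^ 2 * ∑ i, ∑ j, gibbsAvg (skFeature N) (fun σ => spin σ i * spin σ j) x ^ 2 := by
  simp only [← repAvg_two]
  simp only [← repAvg_sum]
  rw [mul_comm, ← repAvg_mul_right, monAvg, verts_graphQ2]
  congr 1
  funext τ
  simp only [graphQ2, OverlapGraph.value, Multiset.insert_eq_cons, Multiset.map_cons,
    Multiset.map_singleton, Multiset.prod_cons, Multiset.prod_singleton, Sym2.lift_mk, overlap]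
  rw [mul_mul_mul_comm, Finset.sum_mul_sum, mul_comm]
  congr 1
  · exact Finset.sum_congr rfl fun i _ => Finset.sum_congr rfl fun j _ => by ring
  · ring

/-- The average of the squared correlation of two spins without field. -/
noncomputable def pairCorr (N : ℕ) (a : ℝ) (i j : Fin N) : ℝ :=
  gaussAvg (fun x => gibbsAvg (skFeature N) (fun σ => spin σ i * spin σ j) x ^ 2) (skScale N a 0)

theorem abs_spin (σ : SpinConfig N) (i : Fin N) : |spin σ i| = 1 := abs_eq_one_of_sq (spin_sq σ i)

theorem gaussAvg_sum {ι α : Type*} [Fintype ι] (A : Finset α) {F : α → (ι → ℝ) → ℝ} {B : ℝ}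
    (hF : ∀ a, Continuous (F a)) (hB : ∀ a x, |F a x| ≤ B) (c : ι → ℝ) :
    gaussAvg (fun x => ∑ a ∈ A, F a x) c = ∑ a ∈ A, gaussAvg (F a) c :=
  integral_finsetSum _ fun a _ => integrable_stdGauss_of_bdd
    ((hF a).comp (continuous_const.mul continuous_id)) fun g => hB a (c * g)

theorem gaussAvg_const_mul {ι : Type*} [Fintype ι] (r : ℝ) (F : (ι → ℝ) → ℝ) (c : ι → ℝ) :
    gaussAvg (fun x => r * F x) c = r * gaussAvg F c :=
  integral_const_mul _ _

theorem abs_gibbsAvg_sq_le {h : SpinConfig N → ℝ} (hh : ∀ σ, |h σ| = 1) (x : SKIndex N → ℝ) :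
    |gibbsAvg (skFeature N) h x ^ 2| ≤ 1 := by
  rw [abs_pow]
  exact pow_le_one₀ (abs_nonneg _) (abs_gibbsAvg_le _ (fun σ => (hh σ).le) x)

theorem gaussAvg_monAvg_graphQ2 (a : ℝ) :
    gaussAvg (monAvg N graphQ2.verts graphQ2) (skScale N a 0)
      = 1 / N ^ 2 * ∑ i, ∑ j, pairCorr N a i j := by
  rw [show monAvg N graphQ2.verts graphQ2 = _ from funext monAvg_graphQ2, gaussAvg_const_mul]
  congr 1
  simp only [← Fintype.sum_prod_type' (f := fun i j => pairCorr N a i j),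
    ← Fintype.sum_prod_type' (f := fun i j => gibbsAvg (skFeature N)
      (fun σ => spin σ i * spin σ j) _ ^ 2)]
  exact gaussAvg_sum _ (B := 1) (fun p => (continuous_gibbsAvg _ _).pow 2)
    (fun p x => abs_gibbsAvg_sq_le (fun σ => by rw [abs_mul, abs_spin, abs_spin, one_mul]) x) _

theorem gaussAvg_monAvg_graphQ (c : SKIndex N → ℝ) :
    gaussAvg (monAvg N graphQ.verts graphQ) c
      = 1 / N * ∑ i, gaussAvg (fun x => gibbsAvg (skFeature N) (fun σ => spin σ i) x ^ 2) c := by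
  rw [show monAvg N graphQ.verts graphQ = _ from funext monAvg_graphQ, gaussAvg_const_mul]
  congr 1
  exact gaussAvg_sum _ (B := 1) (fun p => (continuous_gibbsAvg _ _).pow 2)
    (fun p x => abs_gibbsAvg_sq_le (fun σ => abs_spin σ p) x) _

/-- In the gauge of the last spin, the product of spin `i` with it is spin `i` of the smaller system
in the cavity field. -/
theorem pairCorr_castSucc_last (a : ℝ) (i : Fin N) :
    pairCorr (N + 1) a i.castSucc (Fin.last N)
      = gaussAvg (fun x => gibbsAvg (skFeature N) (fun σ => spin σ i) x ^ 2) (skScale N a a) := by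
  rw [← integral_comp_injective (cavityIndex N) cavityIndex_injective
    (F := fun x => gibbsAvg (skFeature N) (fun σ => spin σ i) x ^ 2)
    ((continuous_gibbsAvg _ _).pow 2)]
  refine integral_congr_ae (ae_of_all _ fun g => ?_)
  beta_reduce
  rw [gibbsAvg_of_equiv (gaugeEquiv N) (linWeight_cavity a g) (h := fun σ => spin σ i)]
  intro p
  rw [spin_gauge_last, spin_gauge_castSucc]
  linear_combination spin p.2 i * units_mul_self p.1

theorem pairCorr_self (a : ℝ) (i : Fin N) : pairCorr N a i i = 1 := by
  unfold pairCorr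
  have : ∀ σ : SpinConfig N, spin σ i * spin σ i = 1 := fun σ => by rw [← sq, spin_sq]
  simp [this, gibbsAvg_const, gaussAvg]

/-- Permutation of the sites of a pair that keeps the pair ordered. -/
def permPair (π : Equiv.Perm (Fin N)) (p : Fin N × Fin N) : Fin N × Fin N :=
  if p.1 < p.2 ↔ π p.1 < π p.2 then (π p.1, π p.2) else (π p.2, π p.1)

theorem permPair_lt_iff (π : Equiv.Perm (Fin N)) (p : Fin N × Fin N) :
    (permPair π p).1 < (permPair π p).2 ↔ p.1 < p.2 := by
  unfold permPair
  split_ifs with h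
  · exact h.symm
  · by_cases h1 : p.1 < p.2
    · have h2 : ¬ π p.1 < π p.2 := fun h2 => h ⟨fun _ => h2, fun _ => h1⟩
      exact ⟨fun _ => h1, fun _ => (not_lt.1 h2).lt_of_ne fun he => h1.ne' (π.injective he)⟩
    · have h2 : π p.1 < π p.2 := by
        by_contra h2
        exact h ⟨fun h3 => (h1 h3).elim, fun h3 => (h2 h3).elim⟩
      exact ⟨fun h3 => (lt_asymm h2 h3).elim, fun h3 => (h1 h3).elim⟩

theorem permPair_injective (π : Equiv.Perm (Fin N)) : Function.Injective (permPair π) := by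
  intro p q h
  have h1 := permPair_lt_iff π p
  rw [h, permPair_lt_iff] at h1
  have key : ∀ p : Fin N × Fin N, permPair π p = (π p.1, π p.2) ∨
      permPair π p = (π p.2, π p.1) := fun p => by unfold permPair; split_ifs <;> simp
  have h3 : p = q ∨ (p.1 = q.2 ∧ p.2 = q.1) := by
    rcases key p with hp | hp <;> rcases key q with hq | hq <;> rw [hp, hq] at h <;>
      simp only [Prod.mk.injEq, EmbeddingLike.apply_eq_iff_eq] at h
    · exact Or.inl (Prod.ext h.1 h.2)
    · exact Or.inr h
    · exact Or.inr ⟨h.2, h.1⟩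
    · exact Or.inl (Prod.ext h.2 h.1)
  rcases h3 with h3 | ⟨h3, h4⟩
  · exact h3
  · rw [h3, h4] at h1
    rcases lt_trichotomy q.1 q.2 with hlt | heq | hgt
    · exact (lt_asymm hlt (h1.1 hlt)).elim
    · exact Prod.ext (h3.trans heq.symm) (h4.trans heq)
    · exact (lt_asymm hgt (h1.2 hgt)).elim

theorem linWeight_perm (π : Equiv.Perm (Fin N)) (a : ℝ) (g : SKIndex N → ℝ) (σ : SpinConfig N) :
    linWeight (skFeature N) (skScale N a 0 * g) (σ ∘ π.symm)
      = linWeight (skFeature N) (skScale N a 0 * fun k => g (Sum.map (permPair π) id k)) σ := by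
  unfold linWeight
  congr 1
  rw [Fintype.sum_sum_type, Fintype.sum_sum_type]
  simp only [skScale, Pi.mul_apply, zero_mul, mul_zero, Sum.map_inl, skFeature]
  congr 1
  rw [← (Equiv.ofBijective _ (Finite.injective_iff_bijective.1 (permPair_injective π))).sum_comp]
  refine Finset.sum_congr rfl fun p _ => ?_
  simp only [Equiv.ofBijective_apply, permPair_lt_iff]
  congr 1
  have h : ∀ i, spin (σ ∘ π.symm) (π i) = spin σ i := fun i => by simp [spin]
  unfold permPair
  split_ifs
  · simp only [h]
  · simp only [h, mul_comm]

/-- The couplings are independent and identically distributed, so a permutation of the sites only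
permutes them. Since just the pairs `i < j` carry a coupling, the pairs are reordered by `permPair`.
-/
theorem pairCorr_perm (π : Equiv.Perm (Fin N)) (a : ℝ) (i j : Fin N) :
    pairCorr N a (π i) (π j) = pairCorr N a i j := by
  have hj : Function.Injective (Sum.map (permPair π) (id : Fin N → Fin N)) :=
    (permPair_injective π).sumMap Function.injective_id
  have h1 := integral_comp_injective (ι := SKIndex N) (κ := SKIndex N) _ hj
    (F := fun x => gibbsAvg (skFeature N) (fun σ => spin σ i * spin σ j) x ^ 2) ((continuous_gibbsAvg (skFeature N) (fun σ => spin σ i * spin σ j)).pow 2) (skScale N a 0)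
  rw [show pairCorr N a i j = _ from h1.symm]
  refine integral_congr_ae (ae_of_all _ fun g => ?_)
  beta_reduce
  rw [gibbsAvg_of_equiv (E := Unit) ((Equiv.punitProd _).trans (π.arrowCongr (Equiv.refl ℤˣ)))
    (fun p => linWeight_perm π a g p.2) (h := fun σ => spin σ i * spin σ j)]
  intro p
  simp [spin, Equiv.arrowCongr]

/-- The overlap in a field of the strength of the couplings, in terms of one more spin. -/
theorem gaussAvg_graphQ2_succ (a : ℝ) :
    (N + 1 : ℝ) * gaussAvg (monAvg (N + 1) graphQ2.verts graphQ2) (skScale (N + 1) a 0)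
      = 1 + N * gaussAvg (monAvg N graphQ.verts graphQ) (skScale N a a) := by
  -- By exchangeability every column has the sum of the last one, which consists of the correlations
  -- with the added spin and the diagonal term `1`.
  have h1 : ∀ j, ∑ i, pairCorr (N + 1) a i j = ∑ i, pairCorr (N + 1) a i (Fin.last N) := by
    intro j
    rw [← Equiv.sum_comp (Equiv.swap j (Fin.last N)) fun i => pairCorr (N + 1) a i (Fin.last N)]
    refine Finset.sum_congr rfl fun i _ => ?_
    rw [← pairCorr_perm (Equiv.swap j (Fin.last N)) a i j, Equiv.swap_apply_left]
  have h3 : ∑ i, pairCorr (N + 1) a i (Fin.last N) = (∑ i, gaussAvg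
      (fun x => gibbsAvg (skFeature N) (fun σ => spin σ i) x ^ 2) (skScale N a a)) + 1 := by
    rw [Fin.sum_univ_castSucc, pairCorr_self]
    simp only [pairCorr_castSucc_last]
  rw [gaussAvg_monAvg_graphQ2, Finset.sum_comm, Finset.sum_congr rfl fun j _ => h1 j,
    gaussAvg_monAvg_graphQ, h3, Finset.sum_const, Finset.card_univ, Fintype.card_fin, nsmul_eq_mul]
  have h2 : ((N : ℝ) + 1) ≠ 0 := by positivity
  push_cast
  rcases Nat.eq_zero_or_pos N with rfl | hN
  · simp
  · have : (N : ℝ) ≠ 0 := by positivity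
    field_simp
    ring

end Cavity

/-! ### The thermodynamic limit -/

/-- A Riemann sum of functions that converge uniformly. -/
theorem tendsto_riemann_sum {ψ : ℝ → ℝ} {f : ℕ → ℝ → ℝ} {y C : ℝ} (hy : 0 < y)
    (hψ : Continuous ψ) (hf : TendstoUniformlyOn f ψ atTop (Set.Icc 0 y))
    (hC : ∀ k, ∀ w ∈ Set.Icc 0 y, |f k w - ψ w| ≤ C) :
    Tendsto (fun N : ℕ => 1 / (N : ℝ) * ∑ k ∈ Finset.range N, f k (k * (y / N))) atTop
      (𝓝 (1 / y * ∫ w in (0)..y, ψ w)) := by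
  have hC0 : 0 ≤ C := (abs_nonneg _).trans (hC 0 0 ⟨le_rfl, hy.le⟩)
  suffices h : Tendsto (fun N : ℕ => y / N * ∑ k ∈ Finset.range N, f k (k * (y / N))) atTop
      (𝓝 (∫ w in (0)..y, ψ w)) by
    refine (h.const_mul (1 / y)).congr fun N => ?_
    field_simp
  rw [Metric.tendsto_atTop]
  intro δ hδ
  -- Every term has two errors of size `ε`, in total `y * (2 * ε) = δ / 2`; the other half is left
  -- for the first `K` terms.
  set ε := δ / (4 * y) with hε'
  have hε : 0 < ε := by positivity
  obtain ⟨K, hK⟩ := eventually_atTop.1 (Metric.tendstoUniformlyOn_iff.1 hf ε hε)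
  have huc : UniformContinuousOn ψ (Set.Icc 0 y) :=
    isCompact_Icc.uniformContinuousOn_of_continuous hψ.continuousOn
  obtain ⟨η, hη, hu⟩ := Metric.uniformContinuousOn_iff.1 huc ε hε
  have hz : Tendsto (fun N : ℕ => y / (N : ℝ)) atTop (𝓝 0) :=
    tendsto_const_div_atTop_nhds_zero_nat y
  have hz2 : Tendsto (fun N : ℕ => y / (N : ℝ) * (K * C)) atTop (𝓝 0) := by
    simpa using hz.mul_const (K * C)
  obtain ⟨N₀, hN₀⟩ := eventually_atTop.1 ((hz.eventually_lt_const hη).and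
    ((hz2.eventually_lt_const (half_pos hδ)).and (eventually_ge_atTop 1)))
  refine ⟨N₀, fun N hN => ?_⟩
  obtain ⟨h1, h2, h3⟩ := hN₀ N hN
  have hN' : (0 : ℝ) < N := by exact_mod_cast h3
  set z := y / (N : ℝ)
  have hzp : 0 < z := by positivity
  have hNz : N * z = y := by simp only [z]; field_simp
  have hsum : ∑ k ∈ Finset.range N, ∫ w in (k * z)..((k + 1 : ℕ) * z), ψ w
      = ∫ w in (0)..y, ψ w := by
    rw [intervalIntegral.sum_integral_adjacent_intervals (a := fun k : ℕ => (k : ℝ) * z)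
      fun k _ => hψ.intervalIntegrable _ _, hNz, Nat.cast_zero, zero_mul]
  rw [Real.dist_eq, ← hsum, Finset.mul_sum, ← Finset.sum_sub_distrib]
  -- The function in term `k` depends on `k` and is close to `ψ` only for `k ≥ K`. The other terms
  -- are bounded by `C` and have total weight at most `K z`, which tends to zero.
  have hterm : ∀ k ∈ Finset.range N,
      |z * f k (k * z) - ∫ w in (k * z)..((k + 1 : ℕ) * z), ψ w|
        ≤ z * (2 * ε) + z * (if k < K then C else 0) := by
    intro k hk
    have hkN : ((k + 1 : ℕ) : ℝ) ≤ N := by exact_mod_cast Finset.mem_range.1 hk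
    have hle : (k : ℝ) * z ≤ (k + 1 : ℕ) * z := by gcongr; simp
    have hle2 : ((k + 1 : ℕ) : ℝ) * z ≤ y := by rw [← hNz]; gcongr
    have hdiff : ((k + 1 : ℕ) : ℝ) * z - k * z = z := by push_cast; ring
    have hk0 : 0 ≤ (k : ℝ) * z := by positivity
    have hmem : (k : ℝ) * z ∈ Set.Icc 0 y := ⟨hk0, hle.trans hle2⟩
    have e1 : |f k (k * z) - ψ (k * z)| ≤ ε + if k < K then C else 0 := by
      split_ifs with hkK
      · have := hC k _ hmem
        linarith
      · have := hK k (not_lt.1 hkK) _ hmem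
        rw [Real.dist_eq, abs_sub_comm] at this
        linarith
    have e2 : |z * ψ (k * z) - ∫ w in (k * z)..((k + 1 : ℕ) * z), ψ w| ≤ ε * z := by
      have h4 : z * ψ (k * z) - ∫ w in (k * z)..((k + 1 : ℕ) * z), ψ w
          = ∫ w in (k * z)..((k + 1 : ℕ) * z), (ψ (k * z) - ψ w) := by
        rw [intervalIntegral.integral_sub (by simp) (hψ.intervalIntegrable _ _),
          intervalIntegral.integral_const, hdiff, smul_eq_mul]
      rw [h4]
      have h5 := intervalIntegral.norm_integral_le_of_norm_le_const
        (f := fun w => ψ (k * z) - ψ w) (C := ε) (a := k * z) (b := (k + 1 : ℕ) * z)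
        fun w hw => ?_
      · rwa [hdiff, abs_of_pos hzp, Real.norm_eq_abs] at h5
      · rw [Set.uIoc_of_le hle] at hw
        refine (hu _ hmem w ⟨hk0.trans hw.1.le, hw.2.trans hle2⟩ ?_).le
        rw [Real.dist_eq, abs_sub_comm, abs_of_nonneg (by linarith [hw.1])]
        linarith [hw.2]
    have e3 : z * f k (k * z) - ∫ w in (k * z)..((k + 1 : ℕ) * z), ψ w
        = z * (f k (k * z) - ψ (k * z))
          + (z * ψ (k * z) - ∫ w in (k * z)..((k + 1 : ℕ) * z), ψ w) := by ring
    rw [e3]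
    refine (abs_add_le _ _).trans ?_
    rw [abs_mul, abs_of_pos hzp]
    have := mul_le_mul_of_nonneg_left e1 hzp.le
    linarith
  have hcount : ∑ k ∈ Finset.range N, (if k < K then C else 0) ≤ K * C := by
    rw [← Finset.sum_filter, Finset.sum_const, nsmul_eq_mul]
    refine mul_le_mul_of_nonneg_right ?_ hC0
    have : (Finset.range N).filter (· < K) ⊆ Finset.range K := fun k hk =>
      Finset.mem_range.2 (Finset.mem_filter.1 hk).2
    simpa using Finset.card_le_card this
  refine ((Finset.abs_sum_le_sum_abs _ _).trans (Finset.sum_le_sum hterm)).trans_lt ?_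
  rw [Finset.sum_add_distrib, Finset.sum_const, Finset.card_range, nsmul_eq_mul, ← Finset.mul_sum,
    ← mul_assoc, hNz]
  have h6 := mul_le_mul_of_nonneg_left hcount hzp.le
  have h7 : y * (2 * ε) = δ / 2 := by simp only [ε]; field_simp; norm_num
  linarith

/-- Derivatives of convex functions converge where the limit is differentiable. -/
theorem tendsto_deriv_of_monotoneOn {f f' : ℕ → ℝ → ℝ} {F : ℝ → ℝ} {L b : ℝ} {x : ℕ → ℝ}
    (hb : 0 < b) (hd : ∀ n, 1 ≤ n → ∀ t, 0 < t → HasDerivAt (f n) (f' n t) t)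
    (hm : ∀ n, 1 ≤ n → MonotoneOn (f' n) (Set.Ioi 0))
    (hlim : ∀ t, 0 < t → Tendsto (fun n => f n t) atTop (𝓝 (F t)))
    (hF : HasDerivAt F L b) (hx : Tendsto x atTop (𝓝 b)) :
    Tendsto (fun n => f' n (x n)) atTop (𝓝 L) := by
  -- The quotient is taken over `b + η` and `b + 2 η`, away from `b`, so that the moving point `x n`
  -- eventually lies on one side of the interval. The limit is still `2 L - L = L`; negative `η`
  -- gives the lower bound and positive `η` the upper one.
  have hS : Tendsto (fun η : ℝ => (F (b + 2 * η) - F (b + η)) / η) (𝓝[≠] 0) (𝓝 L) := by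
    have h1 : HasDerivAt (fun η : ℝ => b + η) 1 0 := (hasDerivAt_id (0 : ℝ)).const_add b
    have h2 : HasDerivAt (fun η : ℝ => b + 2 * η) 2 0 := by
      simpa using ((hasDerivAt_id (0 : ℝ)).const_mul 2).const_add b
    have h3 : HasDerivAt (fun η : ℝ => F (b + 2 * η) - F (b + η)) L 0 := by
      have h4 : HasDerivAt F L (b + 2 * 0) := by simpa using hF
      have h5 : HasDerivAt F L (b + 0) := by simpa using hF
      refine ((h4.comp (0 : ℝ) h2).sub (h5.comp (0 : ℝ) h1)).congr_deriv ?_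
      ring
    refine (hasDerivAt_iff_tendsto_slope_zero.1 h3).congr fun η => ?_
    simp only [zero_add, mul_zero, sub_self, sub_zero, smul_eq_mul]
    rw [inv_mul_eq_div]
  have hslope : ∀ η, 0 < b + 2 * η → 0 < b + η →
      Tendsto (fun n => (f n (b + 2 * η) - f n (b + η)) / η) atTop
        (𝓝 ((F (b + 2 * η) - F (b + η)) / η)) := fun η h1 h2 =>
    ((hlim _ h1).sub (hlim _ h2)).div_const η
  refine tendsto_order.2 ⟨fun l hl => ?_, fun u hu => ?_⟩
  · have hev : ∀ᶠ η in 𝓝[<] (0 : ℝ), l < (F (b + 2 * η) - F (b + η)) / η :=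
      (hS.mono_left (nhdsWithin_mono _ fun η hη => (ne_of_lt hη))).eventually_const_lt hl
    have hev2 : ∀ᶠ η in 𝓝[<] (0 : ℝ), -b / 2 < η :=
      nhdsWithin_le_nhds (lt_mem_nhds (by linarith))
    obtain ⟨η, ⟨h1, h2⟩, h3⟩ := ((hev.and hev2).and self_mem_nhdsWithin).exists
    have h3 : η < 0 := h3
    filter_upwards [(hslope η (by linarith) (by linarith)).eventually_const_lt h1,
      hx.eventually_const_lt (by linarith : b + η < b), eventually_ge_atTop 1] with n h4 h5 h6
    have hpos : 0 < b + 2 * η := by linarith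
    obtain ⟨c, hc, he⟩ := exists_hasDerivAt_eq_slope (f n) (f' n)
      (by linarith : b + 2 * η < b + η)
      (fun t ht => (hd n h6 t (hpos.trans_le ht.1)).continuousAt.continuousWithinAt)
      fun t ht => hd n h6 t (hpos.trans ht.1)
    have h7 : (f n (b + 2 * η) - f n (b + η)) / η = f' n c := by
      rw [he, div_eq_div_iff h3.ne (by linarith)]
      ring
    rw [h7] at h4
    exact h4.trans_le (hm n h6 (hpos.trans hc.1) (show (0 : ℝ) < x n by linarith)
      (hc.2.trans h5).le)
  · have hev : ∀ᶠ η in 𝓝[>] (0 : ℝ), (F (b + 2 * η) - F (b + η)) / η < u :=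
      (hS.mono_left (nhdsWithin_mono _ fun η hη => (ne_of_gt hη))).eventually_lt_const hu
    obtain ⟨η, h1, h3⟩ := (hev.and self_mem_nhdsWithin).exists
    have h3 : 0 < η := h3
    filter_upwards [(hslope η (by linarith) (by linarith)).eventually_lt_const h1,
      hx.eventually_lt_const (by linarith : b < b + η), hx.eventually_const_lt hb,
      eventually_ge_atTop 1] with n h4 h5 h5' h6
    have hpos : 0 < b + η := by linarith
    obtain ⟨c, hc, he⟩ := exists_hasDerivAt_eq_slope (f n) (f' n)
      (by linarith : b + η < b + 2 * η)
      (fun t ht => (hd n h6 t (hpos.trans_le ht.1)).continuousAt.continuousWithinAt)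
      fun t ht => hd n h6 t (hpos.trans ht.1)
    have h7 : (f n (b + 2 * η) - f n (b + η)) / η = f' n c := by
      rw [he]
      congr 1
      ring
    rw [h7] at h4
    exact (hm n h6 h5' (hpos.trans hc.1) (h5.trans hc.1).le).trans_lt h4

/-! ### Telescoping over the number of spins -/

section Limit

variable {N : ℕ}

theorem skScale_zero_eq (c d : SKIndex 0 → ℝ) : c = d := by
  funext k
  rcases k with ⟨i, _⟩ | i <;> exact i.elim0

theorem cavityFn_zero (t β : ℝ) : cavityFn 0 t β = 0 := by
  rw [cavityFn_eq, freeEnergy, freeEnergy, skScale_zero_eq (skPoint 0 β t) (skPoint 0 β 0),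
    sub_self]

/-- For `β² = t = N z` couplings and fields have the same variance `z`, whatever the size; this is
the point where a cavity field imitates an added spin. -/
theorem skPoint_mul_sqrt (N : ℕ) (z : ℝ) : skPoint N (√(N * z)) (N * z) = skScale N (√z) (√z) := by
  rcases Nat.eq_zero_or_pos N with rfl | hN
  · exact skScale_zero_eq _ _
  · have hN' : (0 : ℝ) < N := by exact_mod_cast hN
    have : √(N : ℝ) ≠ 0 := (Real.sqrt_pos.2 hN').ne'
    rw [skPoint, mul_div_cancel_left₀ _ hN'.ne', Real.sqrt_mul hN'.le, mul_div_cancel_left₀ _ this]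

theorem skPoint_mul_sqrt_zero (hN : 1 ≤ N) (z : ℝ) : skPoint N (√(N * z)) 0 = skScale N (√z) 0 := by
  have hN' : (0 : ℝ) < N := by exact_mod_cast hN
  have : √(N : ℝ) ≠ 0 := (Real.sqrt_pos.2 hN').ne'
  rw [skPoint, zero_div, Real.sqrt_zero, Real.sqrt_mul hN'.le, mul_div_cancel_left₀ _ this]

/-- The variance `z` of a coupling is kept fixed instead of the temperature. The step from `N` to `N
+ 1` spins is then exact, without a correction for the changed normalization. -/
theorem freeEnergy_succ (N : ℕ) (z : ℝ) : freeEnergy (N + 1) (√((N + 1 : ℕ) * z)) 0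
    = Real.log 2 + freeEnergy N (√(N * z)) 0 + cavityFn N (N * z) (√(N * z)) := by
  rw [freeEnergy, skPoint_mul_sqrt_zero (by omega), gaussAvg_log_succ, cavityFn_eq,
    ← skPoint_mul_sqrt]
  unfold freeEnergy
  ring

theorem freeEnergy_eq_sum (N : ℕ) (z : ℝ) : freeEnergy N (√(N * z)) 0
    = N * Real.log 2 + ∑ k ∈ Finset.range N, cavityFn k (k * z) (√(k * z)) := by
  induction N with
  | zero => simp [freeEnergy, linPart, linWeight, gaussAvg]
  | succ N ih =>
    rw [freeEnergy_succ, ih, Finset.sum_range_succ]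
    push_cast
    ring

/-- The system is built up spin by spin with `z = y / N`. The increment at size `k` is the cavity
function at `β² = k y / N`, so the sum is a Riemann sum over `[0, y]`. -/
theorem alphaSK_eq_sum (hN : 1 ≤ N) (y : ℝ) : alphaSK N (√y)
    = Real.log 2 + 1 / N * ∑ k ∈ Finset.range N, cavityFn k (k * (y / N)) (√(k * (y / N))) := by
  have hN' : (N : ℝ) ≠ 0 := by positivity
  have h := freeEnergy_eq_sum N (y / N)
  rw [mul_div_cancel₀ _ hN'] at h
  rw [alphaSK_eq, h, mul_add, ← mul_assoc, one_div, inv_mul_cancel₀ hN', one_mul]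

theorem abs_cavityFn_le (N : ℕ) {t : ℝ} (ht : 0 ≤ t) (β : ℝ) : |cavityFn N t β| ≤ t := by
  rcases Nat.eq_zero_or_pos N with rfl | hN
  · rwa [cavityFn_zero, abs_zero]
  · have h := abs_le_mul_of_hasDerivAt (f := fun t => freeEnergy N β t - freeEnergy N β 0)
      (b := fun _ => 1) ((Continuous.uncurry_along (f := freeEnergy N) (a := fun _ => β)
        (b := fun t => t) continuous_freeEnergy continuous_const continuous_id).sub
          continuous_const) (sub_self _)
      (fun s hs => (freeEnergy_hasDerivAt_field hN β hs).sub_const _) (fun s _ => ?_)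
      (fun _ _ _ _ => le_rfl) ht
    · rwa [mul_one, ← cavityFn_eq] at h
    · have := abs_le.1 (abs_graphAvg_le (N := N) β s graphQ)
      rw [abs_le]
      constructor <;> linarith

theorem continuous_cavityFn_diag (N : ℕ) : Continuous fun β => cavityFn N (β ^ 2) β := by
  simp only [cavityFn_eq]
  exact (Continuous.uncurry_along (f := freeEnergy N) (a := fun β => β)
    (b := fun β => β ^ 2) continuous_freeEnergy continuous_id (continuous_pow 2)).sub
    (Continuous.uncurry_along (f := freeEnergy N) (a := fun β => β)
      (b := fun _ => 0) continuous_freeEnergy continuous_id continuous_const)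

theorem alphaSK_hasDerivAt_beta (hN : 1 ≤ N) {β : ℝ} (hβ : 0 < β) :
    HasDerivAt (alphaSK N) (β / 2 * (1 - graphAvg N β 0 graphQ2)) β := by
  have h0 := alphaSK_hasDerivAt hN (pow_pos hβ 2)
  rw [Real.sqrt_sq hβ.le] at h0
  have h1 := HasDerivAt.comp (h₂ := fun y => alphaSK N (√y)) (h := fun b : ℝ => b ^ 2) β h0
    (hasDerivAt_pow 2 β)
  have e : alphaSK N =ᶠ[𝓝 β] (fun y => alphaSK N (√y)) ∘ fun β => β ^ 2 := by
    filter_upwards [lt_mem_nhds hβ] with b hb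
    simp [Real.sqrt_sq hb.le]
  refine (h1.congr_of_eventuallyEq e).congr_deriv ?_
  push_cast
  ring

/-- This is the convexity of `α_N` in `β`: its derivative is the mean of minus the energy per spin,
which grows with slope the variance. -/
theorem monotone_energy (hN : 1 ≤ N) : Monotone fun β => β / 2 * (1 - graphAvg N β 0 graphQ2) := by
  have hN' : (0 : ℝ) < N := by exact_mod_cast hN
  have h : ∀ β, β / 2 * (1 - graphAvg N β 0 graphQ2) = meanNegHam N β / N := fun β => by
    rw [meanNegHam_eq hN]
    field_simp
  simp only [h]
  exact fun a b hab => div_le_div_of_nonneg_right (meanNegHam_monotone hab) hN'.le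

/-- The larger system has the same coupling variance `β² / N`, hence a slightly shifted temperature.
This is why the limit of `⟨q_12²⟩` is needed along moving sequences of temperatures. -/
theorem graphAvg_graphQ_diag (hN : 1 ≤ N) {β : ℝ} (hβ : 0 < β) :
    graphAvg N β (β ^ 2) graphQ
      = ((N + 1) * graphAvg (N + 1) (β * √((N + 1 : ℕ) / N)) 0 graphQ2 - 1) / N := by
  have hN' : (0 : ℝ) < N := by exact_mod_cast hN
  have h := gaussAvg_graphQ2_succ (N := N) (√(β ^ 2 / N))
  rw [← skPoint_mul_sqrt_zero (by omega), ← graphAvg_eq, ← skPoint_mul_sqrt, ← graphAvg_eq,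
    mul_div_cancel₀ _ hN'.ne', Real.sqrt_sq hβ.le] at h
  have e : √((N + 1 : ℕ) * (β ^ 2 / N)) = β * √((N + 1 : ℕ) / N) := by
    rw [show ((N + 1 : ℕ) : ℝ) * (β ^ 2 / N) = β ^ 2 * ((N + 1 : ℕ) / N) by ring,
      Real.sqrt_mul (by positivity), Real.sqrt_sq hβ.le]
  rw [e] at h
  rw [eq_div_iff hN'.ne', mul_comm, h]
  ring

end Limit

/-! ### Convergence of the energy and of the partial derivatives -/

section ThermodynamicLimit

/-- The limit of the free energy as a function of `y = β²`, for the limit `ψ` of the cavity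
function. -/
noncomputable def limitAlpha (ψ : ℝ → ℝ) (y : ℝ) : ℝ := Real.log 2 + 1 / y * ∫ w in (0)..y, ψ w

/-- The derivative of `limitAlpha`. -/
noncomputable def limitAlphaDeriv (ψ : ℝ → ℝ) (y : ℝ) : ℝ :=
  ψ y / y - (∫ w in (0)..y, ψ w) / y ^ 2

theorem limitAlpha_hasDerivAt {ψ : ℝ → ℝ} (hψ : Continuous ψ) {y : ℝ} (hy : 0 < y) :
    HasDerivAt (limitAlpha ψ) (limitAlphaDeriv ψ y) y := by
  have h1 : HasDerivAt (fun y => ∫ w in (0)..y, ψ w) (ψ y) y :=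
    intervalIntegral.integral_hasDerivAt_right (hψ.intervalIntegrable _ _)
      (hψ.stronglyMeasurableAtFilter _ _) hψ.continuousAt
  have h2 : HasDerivAt (fun y : ℝ => 1 / y) (-(y ^ 2)⁻¹) y := by
    simpa only [one_div] using hasDerivAt_inv hy.ne'
  refine ((h2.mul h1).const_add _).congr_deriv ?_
  unfold limitAlphaDeriv
  field_simp
  ring

theorem continuousOn_limitAlphaDeriv {ψ : ℝ → ℝ} (hψ : Continuous ψ) :
    ContinuousOn (limitAlphaDeriv ψ) (Set.Ioi 0) := by
  have h1 : Continuous fun y => ∫ w in (0)..y, ψ w :=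
    intervalIntegral.continuous_primitive (fun a b => hψ.intervalIntegrable a b) 0
  unfold limitAlphaDeriv
  refine (hψ.continuousOn.div continuousOn_id fun y hy => ?_).sub
    (h1.continuousOn.div (by fun_prop) fun y hy => ?_)
  · exact (Set.mem_Ioi.1 hy).ne'
  · exact (pow_pos (Set.mem_Ioi.1 hy) 2).ne'

theorem tendsto_succ_div : Tendsto (fun N : ℕ => ((N + 1 : ℕ) : ℝ) / N) atTop (𝓝 1) := by
  have h : Tendsto (fun N : ℕ => 1 + 1 / (N : ℝ)) atTop (𝓝 (1 + 0)) :=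
    tendsto_const_nhds.add tendsto_one_div_atTop_nhds_zero_nat
  rw [add_zero] at h
  refine h.congr' ?_
  filter_upwards [eventually_ge_atTop 1] with N hN
  have : (N : ℝ) ≠ 0 := by positivity
  push_cast
  field_simp

variable {ψ : ℝ → ℝ} (hψ : Continuous ψ)
  (hlim : ∀ y, TendstoUniformlyOn (fun N w => cavityFn N w (√w)) ψ atTop (Set.Icc 0 y))

include hlim

theorem tendsto_cavityFn {y : ℝ} (hy : 0 ≤ y) :
    Tendsto (fun N => cavityFn N y (√y)) atTop (𝓝 (ψ y)) :=
  (hlim y).tendsto_at ⟨hy, le_rfl⟩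

include hψ

theorem tendsto_alphaSK_sqrt {y : ℝ} (hy : 0 < y) :
    Tendsto (fun N => alphaSK N (√y)) atTop (𝓝 (limitAlpha ψ y)) := by
  have h := tendsto_riemann_sum (C := 2 * y) hy hψ (hlim y) fun k w hw => by
    have h1 := abs_cavityFn_le k hw.1 (√w)
    have h2 : |ψ w| ≤ w := le_of_tendsto (tendsto_cavityFn hlim hw.1).abs
      (Eventually.of_forall fun N => abs_cavityFn_le N hw.1 (√w))
    have h3 := abs_sub (cavityFn k w (√w)) (ψ w)
    have h4 := hw.2
    linarith
  refine (h.const_add (Real.log 2)).congr' ?_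
  filter_upwards [eventually_ge_atTop 1] with N hN
  exact (alphaSK_eq_sum hN y).symm

theorem tendsto_alphaSK {β : ℝ} (hβ : 0 < β) :
    Tendsto (fun N => alphaSK N β) atTop (𝓝 (limitAlpha ψ (β ^ 2))) := by
  have h := tendsto_alphaSK_sqrt hψ hlim (pow_pos hβ 2)
  rwa [Real.sqrt_sq hβ.le] at h

/-- The limit of `⟨q_12²⟩`, also along convergent sequences of temperatures. -/
theorem tendsto_graphQ2 {β : ℝ} (hβ : 0 < β) {x : ℕ → ℝ} (hx : Tendsto x atTop (𝓝 β)) :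
    Tendsto (fun N => graphAvg N (x N) 0 graphQ2) atTop
      (𝓝 (1 - 4 * limitAlphaDeriv ψ (β ^ 2))) := by
  have hF : HasDerivAt (fun β => limitAlpha ψ (β ^ 2)) (limitAlphaDeriv ψ (β ^ 2) * (2 * β)) β := by
    have := HasDerivAt.comp (h := fun b : ℝ => b ^ 2) β
      (limitAlpha_hasDerivAt hψ (pow_pos hβ 2)) (hasDerivAt_pow 2 β)
    refine this.congr_deriv ?_
    push_cast
    ring
  have h := tendsto_deriv_of_monotoneOn hβ
    (f := alphaSK) (f' := fun N β => β / 2 * (1 - graphAvg N β 0 graphQ2))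
    (fun n hn t ht => alphaSK_hasDerivAt_beta hn ht) (fun n hn => (monotone_energy hn).monotoneOn _)
    (fun t ht => tendsto_alphaSK hψ hlim ht) hF hx
  have h2 := (h.div hx hβ.ne').const_mul 2 |>.const_sub 1
  have e : 1 - 2 * (limitAlphaDeriv ψ (β ^ 2) * (2 * β) / β)
      = 1 - 4 * limitAlphaDeriv ψ (β ^ 2) := by
    field_simp
    ring
  rw [e] at h2
  refine h2.congr' ?_
  filter_upwards [hx.eventually_const_lt hβ] with N hN
  simp only [Pi.div_apply]
  field_simp
  ring

theorem tendsto_graphQ_diag {β : ℝ} (hβ : 0 < β) :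
    Tendsto (fun N => graphAvg N β (β ^ 2) graphQ) atTop
      (𝓝 (1 - 4 * limitAlphaDeriv ψ (β ^ 2))) := by
  set q := 1 - 4 * limitAlphaDeriv ψ (β ^ 2)
  -- The index is shifted so that the term at `N + 1` is the temperature of the system with `N + 1`
  -- spins; the truncated subtraction at `0` is irrelevant for the limit.
  have hx : Tendsto (fun N : ℕ => β * √(((N - 1 + 1 : ℕ) : ℝ) / (N - 1 : ℕ))) atTop (𝓝 β) := by
    have h := (tendsto_succ_div.comp (tendsto_sub_atTop_nat 1)).sqrt.const_mul β
    rwa [Real.sqrt_one, mul_one] at h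
  have h1 := (tendsto_graphQ2 hψ hlim hβ hx).comp (tendsto_add_atTop_nat 1)
  have h2 := (tendsto_succ_div.mul h1).sub tendsto_one_div_atTop_nhds_zero_nat
  rw [one_mul, sub_zero] at h2
  refine h2.congr' ?_
  filter_upwards [eventually_ge_atTop 1] with N hN
  have : (N : ℝ) ≠ 0 := by positivity
  rw [graphAvg_graphQ_diag hN hβ]
  simp only [Function.comp_apply, add_tsub_cancel_right]
  push_cast
  field_simp

/-- In the limit `(t/4)(1 - ⟨q_12²⟩)` becomes `y` times `limitAlphaDeriv`, that is `ψ y - y⁻¹ ∫ ψ`.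
The cavity function cancels and the mean of `ψ` remains. -/
theorem tendsto_alphaRedundant {β : ℝ} (hβ : 0 < β) :
    Tendsto (fun N => alphaRedundant N (β ^ 2) β) atTop (𝓝 (limitAlpha ψ (β ^ 2))) := by
  have h1 := tendsto_cavityFn hlim (pow_pos hβ 2).le
  rw [Real.sqrt_sq hβ.le] at h1
  have h2 := (h1.const_add (Real.log 2)).sub
    (((tendsto_graphQ2 hψ hlim hβ (x := fun _ => β) tendsto_const_nhds).const_sub 1).const_mul
      (β ^ 2 / 4))
  refine h2.trans (le_of_eq (congrArg 𝓝 ?_))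
  unfold limitAlpha limitAlphaDeriv
  field_simp
  ring

/-- At `t = β²` the averages `⟨q_12⟩_t` and `⟨q_12²⟩` have the same limit `q`, and `1/2 - 1/4 =
1/4`. -/
theorem tendsto_deriv_alphaRedundant {β : ℝ} (hβ : 0 < β) :
    Tendsto (fun N => deriv (fun t => alphaRedundant N t β) (β ^ 2)) atTop
      (𝓝 (limitAlphaDeriv ψ (β ^ 2))) := by
  have h1 := ((tendsto_graphQ_diag hψ hlim hβ).const_sub 1).const_mul (1 / 2)
  have h2 := ((tendsto_graphQ2 hψ hlim hβ (x := fun _ => β) tendsto_const_nhds).const_sub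
    1).const_mul (1 / 4)
  have h3 := h1.sub h2
  rw [show 1 / 2 * (1 - (1 - 4 * limitAlphaDeriv ψ (β ^ 2)))
    - 1 / 4 * (1 - (1 - 4 * limitAlphaDeriv ψ (β ^ 2))) = limitAlphaDeriv ψ (β ^ 2) by ring] at h3
  refine h3.congr' ?_
  filter_upwards [eventually_ge_atTop 1] with N hN
  exact (alphaRedundant_hasDerivAt hN β (pow_pos hβ 2)).deriv.symm

omit hψ hlim

/-- The derivative of `alphaRedundant` through the state. -/
noncomputable def stateDeriv (N : ℕ) (y : ℝ) : ℝ :=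
  N / 4 * (1 - graphAvg N (√y) y graphQ2) - N / 4 * (1 - graphAvg N (√y) 0 graphQ2)
    + y / 4 * (N / 2 * bracket (graphAvg N (√y) 0) graphQ2)

/-- The derivative of `alphaRedundant` in the explicit variable on the diagonal. -/
noncomputable def fieldDeriv (N : ℕ) (y : ℝ) : ℝ :=
  1 / 2 * (1 - graphAvg N (√y) y graphQ) - 1 / 4 * (1 - graphAvg N (√y) 0 graphQ2)

variable {N : ℕ}

theorem alphaRedundant_hasDerivAt_state (hN : 1 ≤ N) {y : ℝ} (hy : 0 < y) :
    HasDerivAt (fun z => alphaRedundant N y (√z)) (stateDeriv N y) y := by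
  unfold alphaRedundant
  simp only [cavityFn_eq]
  refine ((((freeEnergy_hasDerivAt_sq hN y hy).sub (freeEnergy_hasDerivAt_sq hN 0 hy)).const_add
    (Real.log 2)).sub (((graphAvg_hasDerivAt_sq hN 0 hy graphQ2).const_sub 1).const_mul
      (y / 4))).congr_deriv ?_
  unfold stateDeriv
  ring

theorem alphaRedundant_hasDerivAt_diag (hN : 1 ≤ N) {y : ℝ} (hy : 0 < y) :
    HasDerivAt (fun y => alphaRedundant N y (√y)) (fieldDeriv N y + stateDeriv N y) y := by
  unfold alphaRedundant
  simp only [cavityFn_eq]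
  refine ((((freeEnergy_hasDerivAt_diag hN hy).sub (freeEnergy_hasDerivAt_sq hN 0 hy)).const_add
    (Real.log 2)).sub (((hasDerivAt_id y).div_const 4).mul
      ((graphAvg_hasDerivAt_sq hN 0 hy graphQ2).const_sub 1))).congr_deriv ?_
  unfold stateDeriv fieldDeriv
  simp only [id]
  ring

theorem deriv_alphaRedundant_field (hN : 1 ≤ N) {y : ℝ} (hy : 0 < y) :
    deriv (fun t => alphaRedundant N t (√y)) y = fieldDeriv N y :=
  (alphaRedundant_hasDerivAt hN (√y) hy).deriv

theorem continuous_graphAvg_sqrt (G : OverlapGraph) {b : ℝ → ℝ} (hb : Continuous b) :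
    Continuous fun y => graphAvg N (√y) (b y) G :=
  Continuous.uncurry_along (f := fun β t => graphAvg N β t G) (a := fun y => √y) (b := b)
    (continuous_graphAvg G) Real.continuous_sqrt hb

theorem continuous_fieldDeriv : Continuous (fieldDeriv N) := by
  have h1 := continuous_graphAvg_sqrt (N := N) graphQ continuous_id
  have h2 := continuous_graphAvg_sqrt (N := N) graphQ2 (continuous_const (y := 0))
  unfold fieldDeriv
  simp only [id] at h1
  fun_prop

theorem continuous_stateDeriv : Continuous (stateDeriv N) := by
  have h1 := continuous_graphAvg_sqrt (N := N) graphQ2 continuous_id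
  have h2 := continuous_graphAvg_sqrt (N := N) graphQ2 (continuous_const (y := 0))
  have h3 : Continuous fun y => bracket (graphAvg N (√y) 0) graphQ2 :=
    (continuous_bracket graphQ2).comp Real.continuous_sqrt
  unfold stateDeriv
  simp only [id] at h1
  fun_prop

theorem abs_fieldDeriv_le (y : ℝ) : |fieldDeriv N y| ≤ 2 := by
  have h1 := abs_le.1 (abs_graphAvg_le (N := N) (√y) y graphQ)
  have h2 := abs_le.1 (abs_graphAvg_le (N := N) (√y) 0 graphQ2)
  unfold fieldDeriv
  rw [abs_le]
  constructor <;> linarith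

-- The state derivative contains terms with a factor `N` and is not estimated directly. Its integral
-- is the change of `alphaRedundant` minus the integral of the explicit derivative, and both tend to
-- the increment of `limitAlpha`.
include hψ hlim in
theorem tendsto_integral_stateDeriv {y₁ y₂ : ℝ} (h1 : 0 < y₁) (h2 : y₁ ≤ y₂) :
    Tendsto (fun N => ∫ y in y₁..y₂, deriv (fun z => alphaRedundant N y (√z)) y) atTop
      (𝓝 0) := by
  have hpos : ∀ y ∈ Set.uIcc y₁ y₂, 0 < y := fun y hy => by
    rw [Set.uIcc_of_le h2] at hy
    exact h1.trans_le hy.1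
  have hend : ∀ y, 0 < y → Tendsto (fun N => alphaRedundant N y (√y)) atTop
      (𝓝 (limitAlpha ψ y)) := fun y hy => by
    have := tendsto_alphaRedundant hψ hlim (Real.sqrt_pos.2 hy)
    rwa [Real.sq_sqrt hy.le] at this
  have hfield : Tendsto (fun N => ∫ y in y₁..y₂, fieldDeriv N y) atTop
      (𝓝 (∫ y in y₁..y₂, limitAlphaDeriv ψ y)) := by
    refine intervalIntegral.tendsto_integral_filter_of_dominated_convergence (fun _ => 2)
      (Eventually.of_forall fun N => continuous_fieldDeriv.aestronglyMeasurable)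
      (Eventually.of_forall fun N => ae_of_all _ fun y _ => abs_fieldDeriv_le y)
      intervalIntegrable_const (ae_of_all _ fun y hy => ?_)
    have hy' := hpos y (Set.uIoc_subset_uIcc hy)
    have h := tendsto_deriv_alphaRedundant hψ hlim (Real.sqrt_pos.2 hy')
    rw [Real.sq_sqrt hy'.le] at h
    refine h.congr' ?_
    filter_upwards [eventually_ge_atTop 1] with N hN
    exact deriv_alphaRedundant_field hN hy'
  have hint : ∫ y in y₁..y₂, limitAlphaDeriv ψ y = limitAlpha ψ y₂ - limitAlpha ψ y₁ :=
    intervalIntegral.integral_eq_sub_of_hasDerivAt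
      (fun y hy => limitAlpha_hasDerivAt hψ (hpos y hy))
      ((continuousOn_limitAlphaDeriv hψ).mono fun y hy => hpos y hy).intervalIntegrable
  have h3 := ((hend y₂ (h1.trans_le h2)).sub (hend y₁ h1)).sub hfield
  rw [hint, sub_self] at h3
  refine h3.congr' ?_
  filter_upwards [eventually_ge_atTop 1] with N hN
  have hf := continuous_fieldDeriv.intervalIntegrable (μ := volume) (u := fieldDeriv N) y₁ y₂
  have hs := continuous_stateDeriv.intervalIntegrable (μ := volume) (u := stateDeriv N) y₁ y₂
  rw [← intervalIntegral.integral_eq_sub_of_hasDerivAt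
    (fun y hy => alphaRedundant_hasDerivAt_diag hN (hpos y hy)) (hf.add hs),
    intervalIntegral.integral_add hf hs, add_sub_cancel_left]
  exact intervalIntegral.integral_congr fun y hy =>
    (alphaRedundant_hasDerivAt_state hN (hpos y hy)).deriv.symm

/-- The total and the partial derivative agree in the thermodynamic limit. -/
theorem thermodynamic_limit (Ψ : ℝ → ℝ)
    (h : ∀ B : ℝ, TendstoUniformlyOn (fun (N : ℕ) (β : ℝ) => cavityFn N (β ^ 2) β) Ψ atTop
      (Set.Icc 0 B)) :
    ∃ α q : ℝ → ℝ,
      (∀ β : ℝ, 0 < β →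
        Tendsto (fun N => graphAvg N β 0 graphQ2) atTop (𝓝 (q β)) ∧
        Tendsto (fun N => alphaSK N β) atTop (𝓝 (α β)) ∧
        Tendsto (fun N => alphaRedundant N (β ^ 2) β) atTop (𝓝 (α β)) ∧
        HasDerivAt (fun y => α (Real.sqrt y)) (1 / 4 * (1 - q β)) (β ^ 2) ∧
        Tendsto (fun N => deriv (fun t => alphaRedundant N t β) (β ^ 2)) atTop
          (𝓝 (1 / 4 * (1 - q β)))) ∧
      (∀ (N : ℕ) (β : ℝ), 1 ≤ N → 0 < β →
        HasDerivAt (fun y => alphaRedundant N y (Real.sqrt y))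
          (deriv (fun t => alphaRedundant N t β) (β ^ 2)
            + deriv (fun y => alphaRedundant N (β ^ 2) (Real.sqrt y)) (β ^ 2)) (β ^ 2)) ∧
      (∀ y₁ y₂ : ℝ, 0 < y₁ → y₁ ≤ y₂ →
        Tendsto (fun N => ∫ y in y₁..y₂,
            deriv (fun y' => alphaRedundant N y (Real.sqrt y')) y) atTop (𝓝 0)) := by
  have hΨ : ContinuousOn Ψ (Set.Ici 0) := by
    intro β hβ
    have h1 : ContinuousOn Ψ (Set.Icc 0 (β + 1)) := (h (β + 1)).continuousOn
      (Frequently.of_forall fun N => (continuous_cavityFn_diag N).continuousOn)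
    refine (h1 β ⟨hβ, by linarith⟩).mono_of_mem_nhdsWithin ?_
    rw [← Set.Ici_inter_Iic]
    exact inter_mem_nhdsWithin _ (Iic_mem_nhds (by linarith))
  -- For negative `y` the root is `0`, so `Ψ` is continued by a constant and continuity holds on the
  -- whole line.
  have hψ : Continuous fun y => Ψ (√y) :=
    hΨ.comp_continuous Real.continuous_sqrt fun y => Real.sqrt_nonneg y
  have hlim : ∀ y, TendstoUniformlyOn (fun N w => cavityFn N w (√w)) (fun y => Ψ (√y)) atTop
      (Set.Icc 0 y) := by
    intro y
    refine (((h √y).comp Real.sqrt).mono (s' := Set.Icc 0 y) fun w hw =>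
      ⟨Real.sqrt_nonneg w, Real.sqrt_le_sqrt hw.2⟩).congr (Eventually.of_forall fun N w hw => ?_)
    simp only [Function.comp_apply]
    rw [Real.sq_sqrt hw.1]
  have hq : ∀ r : ℝ, 1 / 4 * (1 - (1 - 4 * r)) = r := fun r => by ring
  refine ⟨fun β => limitAlpha (fun y => Ψ (√y)) (β ^ 2),
    fun β => 1 - 4 * limitAlphaDeriv (fun y => Ψ (√y)) (β ^ 2), fun β hβ =>
      ⟨tendsto_graphQ2 hψ hlim hβ tendsto_const_nhds, tendsto_alphaSK hψ hlim hβ,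
        tendsto_alphaRedundant hψ hlim hβ, ?_, ?_⟩, fun N β hN hβ => ?_,
    fun y₁ y₂ h1 h2 => tendsto_integral_stateDeriv hψ hlim h1 h2⟩
  · rw [hq]
    refine (limitAlpha_hasDerivAt hψ (pow_pos hβ 2)).congr_of_eventuallyEq ?_
    filter_upwards [lt_mem_nhds (pow_pos hβ 2)] with y hy
    rw [Real.sq_sqrt hy.le]
  · rw [hq]
    exact tendsto_deriv_alphaRedundant hψ hlim hβ
  · have hy := pow_pos hβ 2
    have h1 := deriv_alphaRedundant_field hN hy
    rw [Real.sqrt_sq hβ.le] at h1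
    rw [h1, (alphaRedundant_hasDerivAt_state hN hy).deriv]
    exact alphaRedundant_hasDerivAt_diag hN hy

end ThermodynamicLimit

/-! ### The theorem, assembled from the parts above -/

theorem mainTheorem6 :
    -- The standard thermodynamics at finite size: internal energy and total derivative.
    (∀ (N : ℕ) (β : ℝ), 1 ≤ N → 0 < β →
      internalEnergy N β = -(β / 2) * (1 - graphAvg N β 0 graphQ2) ∧
      HasDerivAt (fun y => alphaSK N (Real.sqrt y)) (1 / 4 * (1 - graphAvg N β 0 graphQ2))
        (β ^ 2)) ∧
    -- In the thermodynamic limit the total and the partial derivative of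
    -- `α = ln 2 + Ψ(t) - (t/4)(1 - ⟨q_12²⟩)` at `t = β²` are both equal to the internal energy (up
    -- to sign and the factor `2 β`), so that the contribution of the state vanishes.
    (∀ Ψ : ℝ → ℝ,
      (∀ B : ℝ, TendstoUniformlyOn (fun (N : ℕ) (β : ℝ) => cavityFn N (β ^ 2) β) Ψ atTop
        (Set.Icc 0 B)) →
      ∃ α q : ℝ → ℝ,
        (∀ β : ℝ, 0 < β →
          Tendsto (fun N => graphAvg N β 0 graphQ2) atTop (𝓝 (q β)) ∧
          Tendsto (fun N => alphaSK N β) atTop (𝓝 (α β)) ∧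
          Tendsto (fun N => alphaRedundant N (β ^ 2) β) atTop (𝓝 (α β)) ∧
          HasDerivAt (fun y => α (Real.sqrt y)) (1 / 4 * (1 - q β)) (β ^ 2) ∧
          Tendsto (fun N => deriv (fun t => alphaRedundant N t β) (β ^ 2)) atTop
            (𝓝 (1 / 4 * (1 - q β)))) ∧
        (∀ (N : ℕ) (β : ℝ), 1 ≤ N → 0 < β →
          HasDerivAt (fun y => alphaRedundant N y (Real.sqrt y))
            (deriv (fun t => alphaRedundant N t β) (β ^ 2)
              + deriv (fun y => alphaRedundant N (β ^ 2) (Real.sqrt y)) (β ^ 2)) (β ^ 2)) ∧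
        (∀ y₁ y₂ : ℝ, 0 < y₁ → y₁ ≤ y₂ →
          Tendsto (fun N => ∫ y in y₁..y₂,
              deriv (fun y' => alphaRedundant N y (Real.sqrt y')) y) atTop (𝓝 0))) ∧
    -- The expansion of `α` in filled graphs, in general and explicitly through order `β⁸`.
    (∀ (n : ℕ) (G : OverlapGraph), alphaCoeff n ⟦G⟧ ≠ 0 → G.Filled) ∧
    (alphaCoeff 0 = Finsupp.single ⟦0⟧ (Real.log 2) ∧
      alphaCoeff 1 = Finsupp.single ⟦0⟧ (1 / 4) + Finsupp.single ⟦graphQ2⟧ (1 / 4) ∧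
      alphaCoeff 2 = Finsupp.single ⟦graphQ2⟧ (-1 / 4) ∧
      alphaCoeff 3 = Finsupp.single ⟦graphTri⟧ (1 / 3) ∧
      alphaCoeff 4 = Finsupp.single ⟦graphA⟧ (1 / 6) + Finsupp.single ⟦graphB⟧ (-1 / 8)
        + Finsupp.single ⟦graphC⟧ (-3 / 4)) ∧
    (∃ K : ℝ, ∀ (N : ℕ) (β t : ℝ), 1 ≤ N → 0 ≤ t →
      |alphaRedundant N t β - alphaExpansion 4 t (classAvg N β)|
        ≤ K * (t ^ 5 + t ^ 4 * |firstAC (graphAvg N β 0)|)) ∧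
    (∀ (M : ℕ) (x : ℝ) (m : GraphClass → ℝ), 4 ≤ M →
      derivGraph M ⟦graphQ2⟧ x m = x / 4 * (1 - x) ∧
      derivGraph M ⟦graphTri⟧ x m = x ^ 3 / 3 ∧
      derivGraph M ⟦graphA⟧ x m = x ^ 4 / 6 ∧
      derivGraph M ⟦graphB⟧ x m = -(x ^ 4 / 8) ∧
      derivGraph M ⟦graphC⟧ x m = -(3 * x ^ 4 / 4)) ∧
    -- The generator: total minus partial derivative is the sum over the filled graphs, so that
    -- the sum vanishes if the two derivatives agree; and its form in terms of overlaps.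
    (∀ (M N : ℕ) (β : ℝ), 1 ≤ N → 0 < β →
      DifferentiableAt ℝ (fun y => alphaExpansion M y (classAvg N (Real.sqrt y))) (β ^ 2) ∧
      totalDeriv M N β = partialDeriv M N β
        + ∑ C ∈ graphsOfAlpha M, derivGraph M C (β ^ 2) (classAvg N β) * derivAvg N β C ∧
      (totalDeriv M N β = partialDeriv M N β →
        ∑ C ∈ graphsOfAlpha M, derivGraph M C (β ^ 2) (classAvg N β) * derivAvg N β C = 0) ∧
      ∑ C ∈ graphsOfAlpha M, derivGraph M C (β ^ 2) (classAvg N β) * derivAvg N β C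
        = N / 2 * ∑ n ∈ Finset.range (M + 1),
            (β ^ 2) ^ n * thermoConstraint (graphAvg N β 0) n) ∧
    (∀ (N : ℕ) (β : ℝ) (G : OverlapGraph), 1 ≤ N → 0 < β →
      HasDerivAt (fun y => classAvg N (Real.sqrt y) ⟦G⟧) (N / 2 * bracket (graphAvg N β 0) G)
        (β ^ 2)) ∧
    -- Order by order: the requirement, through order `L`, that the total and the partial
    -- derivative agree (already up to `o(N)`, along any sequence of sizes) is the vanishing of
    -- each coefficient of the generator through order `L`.
    (∀ (β : ℝ) (φ : ℕ → ℕ) (L : ℕ), 0 < β → Tendsto φ atTop atTop →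
      ((∀ M ≤ L, Tendsto (fun k => (totalDeriv M (φ k) β - partialDeriv M (φ k) β) / (φ k : ℝ))
          atTop (𝓝 0)) ↔
        ∀ n ≤ L, Tendsto (fun k => thermoConstraint (graphAvg (φ k) β 0) n) atTop (𝓝 0))) ∧
    -- The coefficients: the two linear relations, then only a sum.
    (∀ m : OverlapGraph → ℝ, ReplicaSymmetric m →
      bracket m graphQ2 = firstAC m ∧ bracket m graphTri = 3 * secondAC m ∧
      thermoConstraint m 0 = 0 ∧
      thermoConstraint m 1 = 1 / 4 * firstAC m ∧
      thermoConstraint m 2 = -(1 / 4) * firstAC m ∧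
      thermoConstraint m 3 = secondAC m ∧
      thermoConstraint m 4 = fourthOrderSum m) ∧
    -- The SK model satisfies the requirement, and hence the relations, in `β`-average; it even
    -- satisfies the symmetric constraint of every filled graph.
    (∀ β₁ β₂ : ℝ, 0 ≤ β₁ → β₁ ≤ β₂ →
      (∀ M : ℕ, Tendsto (fun N : ℕ => ∫ β in β₁..β₂,
        |(totalDeriv M N β - partialDeriv M N β) / (N : ℝ)|) atTop (𝓝 0)) ∧
      Tendsto (fun N => ∫ β in β₁..β₂, |firstAC (graphAvg N β 0)|) atTop (𝓝 0) ∧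
      Tendsto (fun N => ∫ β in β₁..β₂, |secondAC (graphAvg N β 0)|) atTop (𝓝 0) ∧
      Tendsto (fun N => ∫ β in β₁..β₂, |fourthOrderSum (graphAvg N β 0)|) atTop (𝓝 0) ∧
      ∀ G : OverlapGraph, G.Filled →
        Tendsto (fun N => ∫ β in β₁..β₂, |bracket (graphAvg N β 0) G|) atTop (𝓝 0)) ∧
    -- The symmetric constraints imply the thermodynamic ones, and are strictly stronger: already
    -- at order `β⁸` only the sum is constrained.
    (∀ m : OverlapGraph → ℝ, ReplicaSymmetric m →
      (∀ G : OverlapGraph, G.Filled → bracket m G = 0) → ∀ n, thermoConstraint m n = 0) ∧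
    (∃ m : OverlapGraph → ℝ, ReplicaSymmetric m ∧ m 0 = 1 ∧ (∀ G, |m G| ≤ 1) ∧
      (∀ G : OverlapGraph, ¬ G.Filled → m G = 0) ∧
      (∀ n, thermoConstraint m n = 0) ∧
      bracket m graphA ≠ 0 ∧ bracket m graphB ≠ 0 ∧ bracket m graphC ≠ 0) := by
  refine ⟨fun N β hN hβ => ⟨?_, ?_⟩, thermodynamic_limit, filled_of_alphaCoeff_ne_zero,
    ⟨alphaCoeff_zero, alphaCoeff_one, alphaCoeff_two, alphaCoeff_three, alphaCoeff_four⟩,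
    ⟨200 ^ 4, fun N β t hN ht => remainder_alpha hN β ht⟩,
    fun M x m hM => derivGraph_explicit hM x m, generator, fun N β G hN hβ => ?_, orderByOrder,
    fun m hm => ⟨bracket_graphQ2 hm, bracket_graphTri hm, thermoConstraint_zero hm,
      thermoConstraint_one hm, thermoConstraint_two hm, thermoConstraint_three hm,
      thermoConstraint_four hm⟩,
    fun β₁ β₂ h1 h2 => ⟨fun M => vanishesOnAverage_total_sub_partial M h1 h2,
      vanishesOnAverage_firstAC.2 β₁ β₂ h1 h2, vanishesOnAverage_secondAC.2 β₁ β₂ h1 h2,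
      vanishesOnAverage_fourthOrderSum.2 β₁ β₂ h1 h2,
      fun G _ => (vanishesOnAverage_bracket G).2 β₁ β₂ h1 h2⟩,
    fun m _ h n => thermoConstraint_eq_zero h n, exists_thermo_not_symmetric⟩
  · have : (N : ℝ) ≠ 0 := by positivity
    rw [internalEnergy_eq, meanNegHam_eq hN]
    field_simp
  · have h := alphaSK_hasDerivAt hN (pow_pos hβ 2)
    rwa [Real.sqrt_sq hβ.le] at h
  · have h := graphAvg_hasDerivAt_sq hN 0 (pow_pos hβ 2) G
    rw [Real.sqrt_sq hβ.le] at h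
    exact h
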